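/- **Setting.** There are $N\ge 1$ nodes, $d\ge 0$ and $p\ge1$, and all norms are $\ell_2$ (spectral for matrices). Node $i$ has losses $f_i(x,y)=\mathbb E_{\xi\sim\mathcal D_{f_i}}F(x,y;\xi)$ and $g_i(x,y)=\mathbb E_{\zeta\sim\mathcal D_{g_i}}G(x,y;\zeta)$ on $\mathbb R^d\times\mathbb R^p$, the expectations being finite, with $F(\cdot;\xi)$ differentiable and $G(\cdot;\zeta)$ of class $C^2$. Put $f=\frac1N\sum_i f_i$, $g=\frac1N\sum_i g_i$, $y^\star(x)=\arg\min_y g(x,y)$, $\Phi(x)=f(x,y^\star(x))$ and $z^\star(x)=[\nabla^2_{22}g(x,y^\star(x))]^{-1}\nabla_2f(x,y^\star(x))$. A bar denotes the average over the nodes. **Assumptions.** 1. (Smoothness) For positive constants $L_f,L_{\nabla f},L_{\nabla g},L_{\nabla^2g},\mu_g$ and all $i$: $f_i$ is differentiable, $g_i$ is twice differentiable, $\nabla f_i,\nabla g_i,\nabla^2g_i$ are Lipschitz with constants $L_{\nabla f},L_{\nabla g},L_{\nabla^2g}$; $\|\nabla_2f_i(x,y^\star(x))\|\le L_f$ for all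 $x$; and $g_i(x,\cdot)$ is $\mu_g$-strongly convex for all $x$. 2. (Gradient dissimilarity) For constants $b_1,b_2\ge0$ and all $(x,y)$: $\frac1N\sum_i\|\nabla_kf_i-\nabla_kf\|^2\le b_1^2$ for $k=1,2$; $\frac1N\sum_i\|\nabla_2g_i-\nabla_2g\|^2\le b_2^2$; and $\frac1N\sum_i\|\nabla^2_{k2}g_i-\nabla^2_{k2}g\|^2\le b_2^2$ for $k=1,2$. 3. (Noiseless oracles) At every $(x,y)$ and for every $i$, the sampled $\nabla_1F,\nabla_2F$ (with $\xi\sim\mathcal D_{f_i}$) and $\nabla_2G,\nabla^2_{12}G,\nabla^2_{22}G$ (with $\zeta\sim\mathcal D_{g_i}$) are unbiased estimates of the corresponding derivatives of $f_i$ and $g_i$, with variance $\sigma^2=0$. 4. (Mixing matrix) $W=(w_{ij})\in\mathbb R^{N\times N}$ satisfies $\mathbb 1^\top W=\mathbb 1^\top$, $W\mathbb 1=\mathbb 1$ and $\rho:=\|W-\mathbb 1\mathbb 1^\top/N\|_2\in[0,1)$. **Algorithms.** From $x_i^{(0)},h_i^{(0)}\in\mathbb R^d$ and $y_i^{(0)},z_i^{(0)}\in\mathbb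 R^p$, with constant parameters $\alpha,\beta,\gamma,\theta,\tau$ and samples $\xi_i^{(t)}\sim\mathcal D_{f_i}$, $\zeta_i^{(t)}\sim\mathcal D_{g_i}$, iterate $$x_i^{(t+1)}=\sum_jw_{ij}\big(x_j^{(t)}-\tau\alpha h_j^{(t)}\big),\qquad y_i^{(t+1)}=\sum_jw_{ij}\big(y_j^{(t)}-\beta\nabla_2G(x_j^{(t)},y_j^{(t)};\zeta_j^{(t)})\big),$$ $$z_i^{(t+1)}=\sum_jw_{ij}\big(z_j^{(t)}-\gamma(p_{H,j}^{(t)}-\nabla_2F(x_j^{(t)},y_j^{(t)};\xi_j^{(t)}))\big),$$ $$h_i^{(t+1)}=(1-\theta)h_i^{(t)}+\theta\big(\nabla_1F(x_i^{(t)},y_i^{(t)};\xi_i^{(t)})-p_{J,i}^{(t)}\big).$$ In D-SOBA-SO, $p_{H,i}^{(t)}$ and $p_{J,i}^{(t)}$ are $\nabla^2_{22}G(x_i^{(t)},y_i^{(t)};\zeta_i^{(t)})z_i^{(t)}$ and $\nabla^2_{12}G(x_i^{(t)},y_i^{(t)};\zeta_i^{(t)})z_i^{(t)}$. In D-SOBA-FO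 they are $\frac1{2\delta_t}\big(\nabla_kG(x_i^{(t)},y_i^{(t)}+\delta_tz_i^{(t)};\zeta_i^{(t)})-\nabla_kG(x_i^{(t)},y_i^{(t)}-\delta_tz_i^{(t)};\zeta_i^{(t)})\big)$ with $k=2$ and $k=1$ respectively. **Claim.** Let $L=\max\{L_f,L_{\nabla f},L_{\nabla g},L_{\nabla^2g}\}$ and $\kappa=L/\mu_g$, and let $D\ge0$ be an upper bound for $\Phi(\bar x^{(0)})-\inf\Phi$, $\|\bar h^{(0)}-\nabla\Phi(\bar x^{(0)})\|^2$, $\|\bar y^{(0)}-y^\star(\bar x^{(0)})\|^2$, $\|\bar z^{(0)}-z^\star(\bar x^{(0)})\|^2$, $\frac1N\sum_i\|h_i^{(0)}-\bar h^{(0)}\|^2$ and $$\Delta_0^2=\kappa^2\sum_i\big(\|x_i^{(0)}-\bar x^{(0)}\|^2+\|y_i^{(0)}-\bar y^{(0)}\|^2\big)+\sum_i\|z_i^{(0)}-\bar z^{(0)}\|^2.$$ There are positive constants $C,c_1,c_2,c_3,c_4$ depending only on $L$ and $D$, and for every $T\ge1$ there are $\alpha>0$ and $\iota>0$ depending only on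 $L$, $D$, $L_f,L_{\nabla f},L_{\nabla g},L_{\nabla^2g},\mu_g,b_1,b_2,\rho,N,T$, such that with $\beta=c_1\alpha$, $\gamma=c_2\alpha$, $\theta=c_3\alpha$, $\tau=c_4\kappa^{-4}$ the following holds. The function $\Phi$ is differentiable, and almost surely the iterates of D-SOBA-SO satisfy $$\frac1T\sum_{t=0}^{T-1}\|\nabla\Phi(\bar x^{(t)})\|^2\le C\left(\frac{\rho^{2/3}\big(b_1^{2/3}\kappa^{16/3}+b_2^{2/3}\kappa^6\big)}{T^{2/3}(1-\rho)^{2/3}}+\frac{\rho\kappa^6}{(1-\rho)T}+\frac{\kappa^4}{(1-\rho)NT}+\frac{\kappa^{13}}T\right).$$ For every sequence $(\delta_t)$, almost surely, the iterates of D-SOBA-FO satisfy the same bound whenever $\delta_t>0$ and $L_{\nabla^2g}\,\delta_t\|z_i^{(t)}\|^2\le\sqrt3\,\iota$ for all $t<T$ and all $i$; and a sequence $(\delta_t)$ exists for which this condition holds almost surely. -/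

import Mathlib

open MeasureTheory

universe u v w

noncomputable section

namespace DSOBA

/-- The product `X × Y` with the `ℓ²` norm `‖(x, y)‖² = ‖x‖² + ‖y‖²`; for Euclidean spaces
`X = ℝᵈ` and `Y = ℝᵖ` this is the Euclidean space `ℝᵈ⁺ᵖ`. -/
abbrev Joint (X Y : Type*) := WithLp 2 (X × Y)

/-- The point `(x, y)` of `X × Y`. -/
abbrev pair {X Y : Type*} (x : X) (y : Y) : Joint X Y := WithLp.toLp 2 (x, y)

/-- Arithmetic mean `N⁻¹ ∑ᵢ aᵢ` over the nodes. -/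
def mean {N : ℕ} {E : Type*} [AddCommGroup E] [Module ℝ E] (a : Fin N → E) : E :=
  (N : ℝ)⁻¹ • ∑ i, a i

section Algorithms

variable {X Y : Type*} [NormedAddCommGroup X] [InnerProductSpace ℝ X] [CompleteSpace X]
  [NormedAddCommGroup Y] [InnerProductSpace ℝ Y] [CompleteSpace Y]

/-- Partial gradient `∇₁φ(x, y)`, the `x`-block of the gradient. -/
def grad1 (φ : Joint X Y → ℝ) (x : X) (y : Y) : X :=
  (gradient φ (pair x y)).fst

/-- Partial gradient `∇₂φ(x, y)`, the `y`-block of the gradient. -/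
def grad2 (φ : Joint X Y → ℝ) (x : X) (y : Y) : Y :=
  (gradient φ (pair x y)).snd

/-- The full Hessian `∇²φ(v)`, as a linear map. -/
def hess (φ : Joint X Y → ℝ) (v : Joint X Y) : Joint X Y →L[ℝ] Joint X Y :=
  fderiv ℝ (gradient φ) v

/-- The inclusion `z ↦ (0, z)` of `Y` in `X × Y`. -/
def inclY (X Y : Type*) [NormedAddCommGroup X] [InnerProductSpace ℝ X]
    [NormedAddCommGroup Y] [InnerProductSpace ℝ Y] : Y →L[ℝ] Joint X Y :=
  ((WithLp.prodContinuousLinearEquiv 2 ℝ (X) (Y)).symm :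
    (X × Y) →L[ℝ] Joint X Y).comp (ContinuousLinearMap.inr ℝ (X) (Y))

/-- The block `∇²₁₂φ(x, y)`, the derivative of `∇₁φ` in `y`. -/
def hess12 (φ : Joint X Y → ℝ) (x : X) (y : Y) : Y →L[ℝ] X :=
  (WithLp.fstL 2 ℝ (X) (Y)).comp ((hess φ (pair x y)).comp (inclY X Y))

/-- The block `∇²₂₂φ(x, y)`, the derivative of `∇₂φ` in `y`. -/
def hess22 (φ : Joint X Y → ℝ) (x : X) (y : Y) : Y →L[ℝ] Y :=
  (WithLp.sndL 2 ℝ (X) (Y)).comp ((hess φ (pair x y)).comp (inclY X Y))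

/-- Data of a distributed stochastic bilevel problem with `N` nodes: sample losses `F(x, y; ξ)`,
`G(x, y; ζ)` and the local data distributions of the nodes. -/
structure Problem (N : ℕ) (X Y : Type*) (Ξ : Type u) (Z : Type v)
    [MeasurableSpace Ξ] [MeasurableSpace Z] where
  /-- upper-level sample loss -/
  F : Ξ → Joint X Y → ℝ
  /-- lower-level sample loss -/
  G : Z → Joint X Y → ℝ
  /-- upper-level data distribution of each node -/
  Df : Fin N → Measure Ξ
  /-- lower-level data distribution of each node -/
  Dg : Fin N → Measure Z

/-- The random vector `o`, sampled from `P`, is an unbiased estimate of `m` with variance at most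
`σ²`. -/
def UnbiasedOracle {S : Type*} [MeasurableSpace S] {E : Type*} [NormedAddCommGroup E]
    [NormedSpace ℝ E] (P : Measure S) (o : S → E) (m : E) (σ : ℝ) : Prop :=
  Integrable o P ∧ ∫ s, o s ∂P = m ∧ ∫⁻ s, ‖o s - m‖ₑ ^ 2 ∂P ≤ ENNReal.ofReal (σ ^ 2)

namespace Problem

variable {N : ℕ} {Ξ : Type u} {Z : Type v} [MeasurableSpace Ξ] [MeasurableSpace Z]
variable (P : Problem N X Y Ξ Z)

/-- Local upper-level loss `fᵢ(x, y) = 𝔼_{ξ ∼ D_{fᵢ}} F(x, y; ξ)`. -/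
def f (i : Fin N) (v : Joint X Y) : ℝ := ∫ ξ, P.F ξ v ∂(P.Df i)

/-- Local lower-level loss `gᵢ(x, y) = 𝔼_{ζ ∼ D_{gᵢ}} G(x, y; ζ)`. -/
def g (i : Fin N) (v : Joint X Y) : ℝ := ∫ ζ, P.G ζ v ∂(P.Dg i)

/-- Global upper-level loss `f`. -/
def fAvg (v : Joint X Y) : ℝ := mean fun i => P.f i v

/-- Global lower-level loss `g`. -/
def gAvg (v : Joint X Y) : ℝ := mean fun i => P.g i v

/-- Lower-level solution `y⋆(x) = argmin_y g(x, y)`. -/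
def yStar (x : X) : Y :=
  Classical.epsilon fun y => ∀ y', P.gAvg (pair x y) ≤ P.gAvg (pair x y')

/-- Bilevel objective `Φ(x) = f(x, y⋆(x))`. -/
def Phi (x : X) : ℝ := P.fAvg (pair x (P.yStar x))

/-- `z⋆(x) = [∇²₂₂ g(x, y⋆(x))]⁻¹ ∇₂ f(x, y⋆(x))`. -/
def zStar (x : X) : Y :=
  (hess22 P.gAvg x (P.yStar x)).inverse (grad2 P.fAvg x (P.yStar x))

/-- Smoothness and lower-level strong convexity. -/
structure Smooth (Lf Ldf Ldg Lddg μ : ℝ) : Prop where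
  diff_f : ∀ i, Differentiable ℝ (P.f i)
  diff_g : ∀ i, Differentiable ℝ (P.g i)
  diff_grad_g : ∀ i, Differentiable ℝ (gradient (P.g i))
  lip_f : ∀ i v v', ‖gradient (P.f i) v - gradient (P.f i) v'‖ ≤ Ldf * ‖v - v'‖
  lip_g : ∀ i v v', ‖gradient (P.g i) v - gradient (P.g i) v'‖ ≤ Ldg * ‖v - v'‖
  lip_hess_g : ∀ i v v', ‖hess (P.g i) v - hess (P.g i) v'‖ ≤ Lddg * ‖v - v'‖
  bound_f : ∀ i x, ‖grad2 (P.f i) x (P.yStar x)‖ ≤ Lf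
  strong : ∀ i x, StrongConvexOn Set.univ μ fun y => P.g i (pair x y)

/-- Bounded gradient dissimilarity between the nodes. -/
structure Dissimilar (b₁ b₂ : ℝ) : Prop where
  f1 : ∀ (x : X) (y : Y), mean (fun i => ‖grad1 (P.f i) x y - grad1 P.fAvg x y‖ ^ 2) ≤ b₁ ^ 2
  f2 : ∀ (x : X) (y : Y), mean (fun i => ‖grad2 (P.f i) x y - grad2 P.fAvg x y‖ ^ 2) ≤ b₁ ^ 2
  g2 : ∀ (x : X) (y : Y), mean (fun i => ‖grad2 (P.g i) x y - grad2 P.gAvg x y‖ ^ 2) ≤ b₂ ^ 2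
  g12 : ∀ (x : X) (y : Y), mean (fun i => ‖hess12 (P.g i) x y - hess12 P.gAvg x y‖ ^ 2) ≤ b₂ ^ 2
  g22 : ∀ (x : X) (y : Y), mean (fun i => ‖hess22 (P.g i) x y - hess22 P.gAvg x y‖ ^ 2) ≤ b₂ ^ 2

/-- The sample oracles are unbiased with variances at most `σ²`; the sample losses have the
derivatives that the algorithms evaluate. -/
structure Stochastic (σ : ℝ) : Prop where
  prob_f : ∀ i, IsProbabilityMeasure (P.Df i)
  prob_g : ∀ i, IsProbabilityMeasure (P.Dg i)
  diff_F : ∀ ξ, Differentiable ℝ (P.F ξ)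
  diff_G : ∀ ζ, ContDiff ℝ 2 (P.G ζ)
  int_F : ∀ i v, Integrable (fun ξ => P.F ξ v) (P.Df i)
  int_G : ∀ i v, Integrable (fun ζ => P.G ζ v) (P.Dg i)
  F1 : ∀ i (x : X) (y : Y),
    UnbiasedOracle (P.Df i) (fun ξ => grad1 (P.F ξ) x y) (grad1 (P.f i) x y) σ
  F2 : ∀ i (x : X) (y : Y),
    UnbiasedOracle (P.Df i) (fun ξ => grad2 (P.F ξ) x y) (grad2 (P.f i) x y) σ
  G2 : ∀ i (x : X) (y : Y),
    UnbiasedOracle (P.Dg i) (fun ζ => grad2 (P.G ζ) x y) (grad2 (P.g i) x y) σ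
  G12 : ∀ i (x : X) (y : Y),
    UnbiasedOracle (P.Dg i) (fun ζ => hess12 (P.G ζ) x y) (hess12 (P.g i) x y) σ
  G22 : ∀ i (x : X) (y : Y),
    UnbiasedOracle (P.Dg i) (fun ζ => hess22 (P.G ζ) x y) (hess22 (P.g i) x y) σ

end Problem

/-- The matrix `W` is doubly stochastic: `𝟙ᵀ W = 𝟙ᵀ` and `W 𝟙 = 𝟙`. -/
def IsMixing {N : ℕ} (W : Matrix (Fin N) (Fin N) ℝ) : Prop :=
  Matrix.vecMul 1 W = 1 ∧ Matrix.mulVec W 1 = 1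

/-- `ρ = ‖W - 𝟙𝟙ᵀ/N‖₂`, the spectral norm. -/
def mixingRate {N : ℕ} (W : Matrix (Fin N) (Fin N) ℝ) : ℝ :=
  ‖Matrix.toEuclideanCLM (n := Fin N) (𝕜 := ℝ) (W - Matrix.of fun _ _ => (N : ℝ)⁻¹)‖

/-- The local variables of all nodes. -/
structure State (N : ℕ) (X Y : Type*) where
  x : Fin N → X
  y : Fin N → Y
  z : Fin N → Y
  h : Fin N → X

/-- A rule for evaluating `∇²₂₂ψ(x, y) z` and `∇²₁₂ψ(x, y) z`. -/
structure ProductRule (X Y : Type*) where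
  pH : (Joint X Y → ℝ) → X → Y → Y → Y
  pJ : (Joint X Y → ℝ) → X → Y → Y → X

/-- The exact products, used by D-SOBA-SO. -/
def secondOrder (X Y : Type*) [NormedAddCommGroup X] [InnerProductSpace ℝ X]
    [CompleteSpace X] [NormedAddCommGroup Y] [InnerProductSpace ℝ Y] [CompleteSpace Y] : ProductRule X Y where
  pH ψ x y z := hess22 ψ x y z
  pJ ψ x y z := hess12 ψ x y z

/-- The central finite differences with parameter `δ`, used by D-SOBA-FO. -/
def firstOrder (X Y : Type*) [NormedAddCommGroup X] [InnerProductSpace ℝ X]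
    [CompleteSpace X] [NormedAddCommGroup Y] [InnerProductSpace ℝ Y] [CompleteSpace Y] (δ : ℝ) : ProductRule X Y where
  pH ψ x y z := (2 * δ)⁻¹ • (grad2 ψ x (y + δ • z) - grad2 ψ x (y - δ • z))
  pJ ψ x y z := (2 * δ)⁻¹ • (grad1 ψ x (y + δ • z) - grad1 ψ x (y - δ • z))

/-- One iteration of D-SOBA; `φ i` and `ψ i` are the sampled losses
`F(·, ·; ξᵢ)` and `G(·, ·; ζᵢ)` of node `i`. -/
def step {N : ℕ} (W : Matrix (Fin N) (Fin N) ℝ) (τ α β γ θ : ℝ) (R : ProductRule X Y)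
    (φ ψ : Fin N → Joint X Y → ℝ) (s : State N X Y) : State N X Y where
  x i := ∑ j, W i j • (s.x j - (τ * α) • s.h j)
  y i := ∑ j, W i j • (s.y j - β • grad2 (ψ j) (s.x j) (s.y j))
  z i := ∑ j, W i j •
    (s.z j - γ • (R.pH (ψ j) (s.x j) (s.y j) (s.z j) - grad2 (φ j) (s.x j) (s.y j)))
  h i := (1 - θ) • s.h i +
    θ • (grad1 (φ i) (s.x i) (s.y i) - R.pJ (ψ i) (s.x i) (s.y i) (s.z i))

/-- The iterates of D-SOBA with constant step sizes, started in `s₀`; the product rule and the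
sampled losses may change from iteration to iteration. -/
def iterate {N : ℕ} (W : Matrix (Fin N) (Fin N) ℝ) (τ α β γ θ : ℝ) (R : ℕ → ProductRule X Y)
    (φ ψ : ℕ → Fin N → Joint X Y → ℝ) (s₀ : State N X Y) : ℕ → State N X Y
  | 0 => s₀
  | t + 1 => step W τ α β γ θ (R t) (φ t) (ψ t) (iterate W τ α β γ θ R φ ψ s₀ t)

/-- The quantities of the initialization that enter the constant of the rate are at most `D`. -/
structure InitBound {N : ℕ} {Ξ : Type u} {Z : Type v} [MeasurableSpace Ξ] [MeasurableSpace Z]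
    (P : Problem N X Y Ξ Z) (κ : ℝ) (s : State N X Y) (D : ℝ) : Prop where
  gap : ∀ x, P.Phi (mean s.x) - P.Phi x ≤ D
  h_err : ‖mean s.h - gradient P.Phi (mean s.x)‖ ^ 2 ≤ D
  y_err : ‖mean s.y - P.yStar (mean s.x)‖ ^ 2 ≤ D
  z_err : ‖mean s.z - P.zStar (mean s.x)‖ ^ 2 ≤ D
  consensus : κ ^ 2 * (∑ i, ‖s.x i - mean s.x‖ ^ 2 + ∑ i, ‖s.y i - mean s.y‖ ^ 2)
    + ∑ i, ‖s.z i - mean s.z‖ ^ 2 ≤ D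
  h_consensus : mean (fun i => ‖s.h i - mean s.h‖ ^ 2) ≤ D

/-- The perturbations `δₜ` are positive and `δₜ ≤ √3 ι / (L_{∇²g} ‖zᵢ⁽ᵗ⁾‖²)` for all nodes `i`,
along the iterates `s`, for all `t < T`. -/
def SmallPerturbation {N : ℕ} (Lddg ι : ℝ) (T : ℕ) (δ : ℕ → ℝ) (s : ℕ → State N X Y) : Prop :=
  ∀ t < T, 0 < δ t ∧ ∀ i, Lddg * δ t * ‖(s t).z i‖ ^ 2 ≤ √3 * ι

/-- `T⁻¹ ∑_{t < T} ‖∇Φ(x̄⁽ᵗ⁾)‖²`. -/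
def avgSqGrad {N : ℕ} {Ξ : Type u} {Z : Type v} [MeasurableSpace Ξ] [MeasurableSpace Z]
    (P : Problem N X Y Ξ Z) (T : ℕ) (s : ℕ → State N X Y) : ℝ :=
  (T : ℝ)⁻¹ * ∑ t ∈ Finset.range T, ‖gradient P.Phi (mean (s t).x)‖ ^ 2

end Algorithms

end DSOBA

end

/-! With zero variance every sampled oracle agrees almost surely with the exact derivative at a
fixed point. The run driven by the local losses `P.f`, `P.g` is a nonrandom sequence, so countably
many such events make the random run coincide with it almost surely (`ae_iterate_eq`). D-SOBA-FO
also evaluates `∇₁G`, about which the proof needs nothing beyond `∇²₁₂G`: only differences along `y`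
occur, and these are determined by the mixed Hessian block (`ae_grad1_sub_eq`). What remains is a
deterministic algorithm whose Hessian products have error at most `2 / T`.

Strong convexity makes `y⋆`, `z⋆` and `∇Φ` Lipschitz with constants of order `κ`, `κ³` and `L κ³`.
One step then gives coupled recursions. The spreads of `x`, `y`, `z` contract by `ρ` through mixing,
that of `h` by `1 - α` through averaging in time. The errors of `ȳ` and `z̄` contract by `1 - αμ/2`,
that of `h̄` by `1 - α/2`; they are disturbed by the spreads, by one another and by the drift of
their targets, which is proportional to `τα‖h̄‖`. Finally `Φ` decreases by a multiple of `‖∇Φ‖² +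
‖h̄‖²`, up to the error of `h̄`. Heterogeneity enters through the spreads alone, because the local
directions at the reference point `(x̄, y⋆, z⋆)` average to the right value (`mean_refZ`,
`mean_refH`).

Summation over time turns this into linear inequalities between sums. In `sum_tracking_le` the
choice of `τ` proportional to `κ⁻⁴` lets the descent term absorb the drift; in `sum_consensus_le`
the spreads feed back on themselves only with a factor of order `(ρακ/(1-ρ))²`, which the step size
makes small. The outcome, `sum_sq_gradient_le`, contains `κ⁵D/α` and a heterogeneity term of order
`α²`. Balancing the two in `1/α` produces the rate `T^(-2/3)` (`heterogeneity_le_rateTerm`), and the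
other parts of `1/α` and the initial consensus error give terms of order `1/T`. -/

noncomputable section
set_option linter.unusedSectionVars false
namespace DSOBA

/-! ### Averages over the nodes and the spread around them. -/

section Mean

variable {N : ℕ} {E E' : Type*} [NormedAddCommGroup E] [InnerProductSpace ℝ E]
  [NormedAddCommGroup E'] [InnerProductSpace ℝ E']

lemma mean_add (a b : Fin N → E) : mean (fun i => a i + b i) = mean a + mean b := by
  simp [mean, Finset.sum_add_distrib]

lemma mean_sub (a b : Fin N → E) : mean (fun i => a i - b i) = mean a - mean b := by
  simp [mean, Finset.sum_sub_distrib, smul_sub]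

lemma mean_smul (c : ℝ) (a : Fin N → E) : mean (fun i => c • a i) = c • mean a := by
  simp only [mean, ← Finset.smul_sum, smul_comm c]

lemma mean_mul_left (c : ℝ) (a : Fin N → ℝ) : mean (fun i => c * a i) = c * mean a :=
  mean_smul c a

lemma mean_const (hN : 0 < N) (c : E) : mean (fun _ : Fin N => c) = c := by
  have : (N : ℝ) ≠ 0 := by positivity
  simp [mean, ← Nat.cast_smul_eq_nsmul ℝ, smul_smul, this]

lemma map_mean {V V' : Type*} [NormedAddCommGroup V] [NormedSpace ℝ V] [NormedAddCommGroup V']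
    [NormedSpace ℝ V'] (A : V →L[ℝ] V') (a : Fin N → V) : A (mean a) = mean fun i => A (a i) := by
  simp [mean, map_sum]

lemma mean_le_mean {a b : Fin N → ℝ} (h : ∀ i, a i ≤ b i) : mean a ≤ mean b := by
  unfold mean
  exact smul_le_smul_of_nonneg_left (Finset.sum_le_sum fun i _ => h i) (by positivity)

lemma mean_nonneg {a : Fin N → ℝ} (h : ∀ i, 0 ≤ a i) : 0 ≤ mean a :=
  smul_nonneg (by positivity) (Finset.sum_nonneg fun i _ => h i)

lemma mean_sub_mean (hN : 0 < N) (a : Fin N → E) : mean (fun i => a i - mean a) = 0 := by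
  rw [mean_sub, mean_const hN, sub_self]

/-- Mean squared deviation of the local variables from their average. -/
def spread (a : Fin N → E) : ℝ := mean fun i => ‖a i - mean a‖ ^ 2

lemma spread_nonneg (a : Fin N → E) : 0 ≤ spread a := mean_nonneg fun _ => by positivity

/-- The variance decomposition: the cross term vanishes because deviations from the mean average to
zero. -/
lemma mean_norm_sub_sq (hN : 0 < N) (a : Fin N → E) (c : E) :
    mean (fun i => ‖a i - c‖ ^ 2) = spread a + ‖mean a - c‖ ^ 2 := by
  have h : ∀ i, ‖a i - c‖ ^ 2 = (‖a i - mean a‖ ^ 2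
      + 2 * inner ℝ (mean a - c) (a i - mean a)) + ‖mean a - c‖ ^ 2 := by
    intro i
    have := norm_add_sq_real (mean a - c) (a i - mean a)
    rw [show mean a - c + (a i - mean a) = a i - c by abel] at this
    rw [this]; ring
  have h2 : mean (fun i => inner ℝ (mean a - c) (a i - mean a)) = 0 := by
    have := map_mean (innerSL ℝ (mean a - c)) (fun i => a i - mean a)
    simp only [innerSL_apply_apply] at this
    rw [← this, mean_sub_mean hN, inner_zero_right]
  simp_rw [h]
  rw [mean_add, mean_add, mean_mul_left, h2, mean_const hN, spread]
  ring

lemma spread_le (hN : 0 < N) (a : Fin N → E) (c : E) :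
    spread a ≤ mean fun i => ‖a i - c‖ ^ 2 := by
  rw [mean_norm_sub_sq hN]
  linarith [sq_nonneg ‖mean a - c‖]

lemma norm_mean_sq_le (hN : 0 < N) (a : Fin N → E) : ‖mean a‖ ^ 2 ≤ mean fun i => ‖a i‖ ^ 2 := by
  have := mean_norm_sub_sq hN a 0
  simp only [sub_zero] at this
  linarith [spread_nonneg a]

lemma norm_mean_le {V : Type*} [NormedAddCommGroup V] [NormedSpace ℝ V] (hN : 0 < N)
    (a : Fin N → V) {C : ℝ} (h : ∀ i, ‖a i‖ ≤ C) : ‖mean a‖ ≤ C := by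
  have hN' : (0 : ℝ) < N := by positivity
  unfold mean
  rw [norm_smul, norm_inv, Real.norm_natCast, inv_mul_le_iff₀ hN']
  exact (norm_sum_le _ _).trans ((Finset.sum_le_sum fun i _ => h i).trans (by simp))

lemma inner_mean (a : Fin N → E) (c : E) : inner ℝ (mean a) c = mean fun i => inner ℝ (a i) c := by
  have := map_mean (innerSL ℝ c) a
  simp only [innerSL_apply_apply] at this
  simp_rw [real_inner_comm c]
  exact this

end Mean

/-! ### Contraction by the mixing matrix and weighted Young inequalities. -/

section Mixing

variable {N : ℕ} {E : Type*} [NormedAddCommGroup E] [InnerProductSpace ℝ E]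
  {W : Matrix (Fin N) (Fin N) ℝ}

lemma sum_mulVec_sq_le (M : Matrix (Fin N) (Fin N) ℝ) (b : Fin N → ℝ) :
    ∑ i, (∑ j, M i j * b j) ^ 2 ≤
      ‖Matrix.toEuclideanCLM (n := Fin N) (𝕜 := ℝ) M‖ ^ 2 * ∑ i, b i ^ 2 := by
  have h := (Matrix.toEuclideanCLM (n := Fin N) (𝕜 := ℝ) M).le_opNorm (WithLp.toLp 2 b)
  have h2 := pow_le_pow_left₀ (norm_nonneg _) h 2
  rw [mul_pow, EuclideanSpace.norm_sq_eq, EuclideanSpace.norm_sq_eq] at h2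
  simpa [Matrix.mulVec, dotProduct] using h2

/-- The matrix acts on each coordinate in an orthonormal basis separately, so the scalar bound can
be summed over coordinates. -/
lemma sum_norm_sq_mix_le [FiniteDimensional ℝ E] (M : Matrix (Fin N) (Fin N) ℝ) (b : Fin N → E) :
    ∑ i, ‖∑ j, M i j • b j‖ ^ 2 ≤
      ‖Matrix.toEuclideanCLM (n := Fin N) (𝕜 := ℝ) M‖ ^ 2 * ∑ i, ‖b i‖ ^ 2 := by
  let e := stdOrthonormalBasis ℝ E
  have hn : ∀ v : E, ‖v‖ ^ 2 = ∑ k, (inner ℝ (e k) v) ^ 2 := fun v => by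
    rw [← e.sum_sq_norm_inner_right v]; simp
  simp_rw [hn, inner_sum, inner_smul_right]
  rw [Finset.sum_comm, Finset.sum_comm (γ := Fin N), Finset.mul_sum]
  exact Finset.sum_le_sum fun k _ => sum_mulVec_sq_le M _

lemma IsMixing.row_sum (hW : IsMixing W) (i : Fin N) : ∑ j, W i j = 1 := by
  have := congrFun hW.2 i
  simpa [Matrix.mulVec, dotProduct] using this

lemma IsMixing.col_sum (hW : IsMixing W) (j : Fin N) : ∑ i, W i j = 1 := by
  have := congrFun hW.1 j
  simpa [Matrix.vecMul, dotProduct] using this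

lemma IsMixing.mean_mix (hW : IsMixing W) (a : Fin N → E) :
    mean (fun i => ∑ j, W i j • a j) = mean a := by
  unfold mean
  rw [Finset.sum_comm]
  simp_rw [← Finset.sum_smul, hW.col_sum, one_smul]

lemma IsMixing.spread_mix_le [FiniteDimensional ℝ E] (hN : 0 < N) (hW : IsMixing W)
    (a : Fin N → E) : spread (fun i => ∑ j, W i j • a j) ≤ mixingRate W ^ 2 * spread a := by
  have hN' : (N : ℝ) ≠ 0 := by positivity
  -- Unit row sums let the mean be subtracted inside the sum; subtracting `𝟙𝟙ᵀ/N` then changes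
  -- nothing, since the deviations sum to zero.
  have h : ∀ i, (∑ j, W i j • a j) - mean a
      = ∑ j, (W - Matrix.of fun _ _ => (N : ℝ)⁻¹ : Matrix (Fin N) (Fin N) ℝ) i j • (a j - mean a) := by
    intro i
    have hz : ∑ j, (a j - mean a) = 0 := by
      have := mean_sub_mean hN a
      unfold mean at this
      exact (smul_eq_zero.mp this).resolve_left (inv_ne_zero hN')
    simp only [Matrix.sub_apply, Matrix.of_apply, sub_smul _ _ (_ - _)]
    rw [Finset.sum_sub_distrib, ← Finset.smul_sum, hz, smul_zero, sub_zero]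
    simp only [smul_sub, Finset.sum_sub_distrib, ← Finset.sum_smul, hW.row_sum, one_smul]
  unfold spread
  rw [hW.mean_mix]
  simp_rw [h]
  have := sum_norm_sq_mix_le (W - Matrix.of fun _ _ => (N : ℝ)⁻¹) fun j => a j - mean a
  unfold mean
  rw [smul_eq_mul, smul_eq_mul, mul_left_comm]
  exact mul_le_mul_of_nonneg_left this (by positivity)

/-- Young's inequality with weights that spend one factor `ρ` of the contraction. The perturbation
keeps the factor `ρ²`, so it disappears for `ρ = 0`; this is the origin of `ρ^(2/3)` in the rate. -/
lemma norm_add_sq_le_of_rate {ρ : ℝ} (h0 : 0 ≤ ρ) (h1 : ρ < 1) (a b : E) :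
    ρ ^ 2 * ‖a + b‖ ^ 2 ≤ ρ * ‖a‖ ^ 2 + ρ ^ 2 / (1 - ρ) * ‖b‖ ^ 2 := by
  have hr : 0 < 1 - ρ := by linarith
  have h2 : ‖a + b‖ ^ 2 ≤ (‖a‖ + ‖b‖) ^ 2 := by gcongr; exact norm_add_le _ _
  have h3 : ρ * ‖a‖ ^ 2 + ρ ^ 2 / (1 - ρ) * ‖b‖ ^ 2 - ρ ^ 2 * (‖a‖ + ‖b‖) ^ 2
      = ρ * (1 - ρ) * (‖a‖ - ρ / (1 - ρ) * ‖b‖) ^ 2 := by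
    field_simp; ring
  have h4 : 0 ≤ ρ * (1 - ρ) * (‖a‖ - ρ / (1 - ρ) * ‖b‖) ^ 2 := by positivity
  nlinarith [mul_le_mul_of_nonneg_left h2 (sq_nonneg ρ)]

lemma IsMixing.spread_mix_sub_smul_le [FiniteDimensional ℝ E] (hN : 0 < N) (hW : IsMixing W)
    {ρ : ℝ} (hρ : mixingRate W = ρ) (h1 : ρ < 1) (a b : Fin N → E) (c : ℝ) :
    spread (fun i => ∑ j, W i j • (a j - c • b j)) ≤
      ρ * spread a + ρ ^ 2 / (1 - ρ) * c ^ 2 * spread b := by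
  have h0 : 0 ≤ ρ := hρ ▸ norm_nonneg _
  refine (hW.spread_mix_le hN _).trans ?_
  rw [hρ]
  unfold spread
  rw [← mean_mul_left, ← mean_mul_left, ← mean_mul_left, ← mean_add]
  refine mean_le_mean fun i => ?_
  have := norm_add_sq_le_of_rate h0 h1 (a i - mean a) (-(c • (b i - mean b)))
  rw [norm_neg, norm_smul, mul_pow, Real.norm_eq_abs, sq_abs] at this
  rw [mean_sub, mean_smul, mul_assoc _ (c ^ 2)]
  convert this using 4
  module

/-- Perturbation of a contraction. -/
lemma norm_add_sq_le_of_contraction {s e : ℝ} (h0 : 0 < s) (h1 : s ≤ 1) {a b : E}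
    (ha : ‖a‖ ^ 2 ≤ (1 - s) * e) (he : 0 ≤ e) :
    ‖a + b‖ ^ 2 ≤ (1 - s / 2) * e + 3 / s * ‖b‖ ^ 2 := by
  have h2 : ‖a + b‖ ^ 2 ≤ (‖a‖ + ‖b‖) ^ 2 := by gcongr; exact norm_add_le _ _
  have h3 : (1 + s / 2) * ‖a‖ ^ 2 + (1 + 2 / s) * ‖b‖ ^ 2 - (‖a‖ + ‖b‖) ^ 2
      = s / 2 * (‖a‖ - 2 / s * ‖b‖) ^ 2 := by
    field_simp; ring
  have h4 : 0 ≤ s / 2 * (‖a‖ - 2 / s * ‖b‖) ^ 2 := by positivity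
  have h5 : (1 + 2 / s) ≤ 3 / s := by
    rw [show (3 : ℝ) / s = 1 / s + 2 / s by ring]
    have : 1 ≤ 1 / s := by rw [le_div_iff₀ h0]; linarith
    linarith
  have h6 := mul_le_mul_of_nonneg_right h5 (sq_nonneg ‖b‖)
  have h7 : (1 + s / 2) * ‖a‖ ^ 2 ≤ (1 + s / 2) * ((1 - s) * e) := by gcongr
  nlinarith [mul_nonneg (sq_nonneg s) he, mul_nonneg h0.le he]

lemma norm_add_sq_le_two (a b : E) : ‖a + b‖ ^ 2 ≤ 2 * ‖a‖ ^ 2 + 2 * ‖b‖ ^ 2 := by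
  have h2 : ‖a + b‖ ^ 2 ≤ (‖a‖ + ‖b‖) ^ 2 := by gcongr; exact norm_add_le _ _
  nlinarith [sq_nonneg (‖a‖ - ‖b‖)]

lemma norm_sub_sq_le_two (a b : E) : ‖a - b‖ ^ 2 ≤ 2 * ‖a‖ ^ 2 + 2 * ‖b‖ ^ 2 := by
  simpa [sub_eq_add_neg] using norm_add_sq_le_two a (-b)

lemma spread_convex_le {θ : ℝ} (h0 : 0 ≤ θ) (h1 : θ ≤ 1) (a b : Fin N → E) :
    spread (fun i => (1 - θ) • a i + θ • b i) ≤ (1 - θ) * spread a + θ * spread b := by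
  unfold spread
  rw [← mean_mul_left, ← mean_mul_left, ← mean_add]
  refine mean_le_mean fun i => ?_
  rw [mean_add, mean_smul, mean_smul]
  rw [show (1 - θ) • a i + θ • b i - ((1 - θ) • mean a + θ • mean b)
    = (1 - θ) • (a i - mean a) + θ • (b i - mean b) by simp only [smul_sub]; abel]
  have h2 : ‖(1 - θ) • (a i - mean a) + θ • (b i - mean b)‖
      ≤ (1 - θ) * ‖a i - mean a‖ + θ * ‖b i - mean b‖ := by
    refine (norm_add_le _ _).trans ?_
    rw [norm_smul, norm_smul, Real.norm_of_nonneg h0, Real.norm_of_nonneg (by linarith)]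
  have h3 := pow_le_pow_left₀ (norm_nonneg _) h2 2
  nlinarith [mul_nonneg (mul_nonneg h0 (sub_nonneg.2 h1))
    (sq_nonneg (‖a i - mean a‖ - ‖b i - mean b‖))]

end Mixing

open Filter Topology

/-! ### Blocks of gradients and Hessians, strong convexity, Taylor-type bounds. -/

section Calculus

variable {X Y : Type*} [NormedAddCommGroup X] [InnerProductSpace ℝ X] [CompleteSpace X]
  [NormedAddCommGroup Y] [InnerProductSpace ℝ Y] [CompleteSpace Y]

lemma norm_pair_sub_sq (x x' : X) (y y' : Y) :
    ‖pair x y - pair x' y'‖ ^ 2 = ‖x - x'‖ ^ 2 + ‖y - y'‖ ^ 2 := by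
  rw [WithLp.prod_norm_sq_eq_of_L2]; rfl

lemma norm_pair_sub_left (x : X) (y y' : Y) : ‖pair x y - pair x y'‖ = ‖y - y'‖ := by
  have := norm_pair_sub_sq x x y y'
  rw [sub_self, norm_zero] at this
  exact (pow_left_inj₀ (norm_nonneg _) (norm_nonneg _) two_ne_zero).1 (by linarith)

lemma norm_pair_sub_right (x x' : X) (y : Y) : ‖pair x y - pair x' y‖ = ‖x - x'‖ := by
  have := norm_pair_sub_sq x x' y y
  rw [sub_self y, norm_zero] at this
  exact (pow_left_inj₀ (norm_nonneg _) (norm_nonneg _) two_ne_zero).1 (by linarith)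

lemma inclY_apply (z : Y) : inclY X Y z = pair 0 z := rfl

lemma norm_inclY_apply (z : Y) : ‖inclY X Y z‖ = ‖z‖ := by
  rw [inclY_apply]; exact WithLp.norm_toLp_snd _ _ _ z

lemma norm_fst_comp_inclY_le (A : Joint X Y →L[ℝ] Joint X Y) :
    ‖(WithLp.fstL 2 ℝ X Y).comp (A.comp (inclY X Y))‖ ≤ ‖A‖ := by
  refine ContinuousLinearMap.opNorm_le_bound _ (norm_nonneg A) fun z => ?_
  refine (WithLp.norm_fst_le _ _).trans ((A.le_opNorm _).trans ?_)
  exact le_of_eq (congrArg (‖A‖ * ·) (norm_inclY_apply z))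

lemma norm_snd_comp_inclY_le (A : Joint X Y →L[ℝ] Joint X Y) :
    ‖(WithLp.sndL 2 ℝ X Y).comp (A.comp (inclY X Y))‖ ≤ ‖A‖ := by
  refine ContinuousLinearMap.opNorm_le_bound _ (norm_nonneg A) fun z => ?_
  refine (WithLp.norm_snd_le _ _).trans ((A.le_opNorm _).trans ?_)
  exact le_of_eq (congrArg (‖A‖ * ·) (norm_inclY_apply z))

variable {φ : Joint X Y → ℝ} {L μ : ℝ}

lemma norm_hess12_sub_le (ψ : Joint X Y → ℝ) (x x' : X) (y y' : Y) :
    ‖hess12 φ x y - hess12 ψ x' y'‖ ≤ ‖hess φ (pair x y) - hess ψ (pair x' y')‖ := by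
  simpa [hess12] using norm_fst_comp_inclY_le (hess φ (pair x y) - hess ψ (pair x' y'))

lemma norm_hess22_sub_le (ψ : Joint X Y → ℝ) (x x' : X) (y y' : Y) :
    ‖hess22 φ x y - hess22 ψ x' y'‖ ≤ ‖hess φ (pair x y) - hess ψ (pair x' y')‖ := by
  simpa [hess22] using norm_snd_comp_inclY_le (hess φ (pair x y) - hess ψ (pair x' y'))

lemma norm_hess_le (hL : 0 ≤ L) (h : ∀ v v', ‖gradient φ v - gradient φ v'‖ ≤ L * ‖v - v'‖)
    (v : Joint X Y) : ‖hess φ v‖ ≤ L :=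
  norm_fderiv_le_of_lip' ℝ hL (Eventually.of_forall fun v' => h v' v)

lemma hess_symm (hφ : Differentiable ℝ φ) (hg : Differentiable ℝ (gradient φ))
    (v a b : Joint X Y) : inner ℝ (hess φ v a) b = inner ℝ a (hess φ v b) := by
  have h1 : ∀ y, HasFDerivAt φ (innerSL ℝ (gradient φ y)) y := fun y => by
    have := (hφ y).hasFDerivAt
    rwa [show fderiv ℝ φ y = innerSL ℝ (gradient φ y) by
      ext z; rw [innerSL_apply_apply, inner_gradient_left]] at this
  have h2 : HasFDerivAt (fun y => innerSL ℝ (gradient φ y)) ((innerSL ℝ).comp (hess φ v)) v :=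
    (innerSL ℝ).hasFDerivAt.comp v (hg v).hasFDerivAt
  have h3 := second_derivative_symmetric h1 h2 a b
  simp only [ContinuousLinearMap.comp_apply, innerSL_apply_apply] at h3
  rw [h3, real_inner_comm]

lemma hasDerivAt_pair_line (x : X) (y z : Y) (s : ℝ) :
    HasDerivAt (fun s : ℝ => pair x (y + s • z)) (inclY X Y z) s := by
  have h : (fun s : ℝ => pair x (y + s • z)) = fun s : ℝ => pair x y + s • inclY X Y z := by
    funext s
    rw [inclY_apply, ← WithLp.toLp_smul, ← WithLp.toLp_add]
    simp [pair]
  rw [h]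
  simpa using ((hasDerivAt_id s).smul_const (inclY X Y z)).const_add (pair x y)

lemma hasDerivAt_gradient_line (hg : Differentiable ℝ (gradient φ)) (x : X) (y z : Y) (s : ℝ) :
    HasDerivAt (fun s : ℝ => gradient φ (pair x (y + s • z)))
      (hess φ (pair x (y + s • z)) (inclY X Y z)) s :=
  (hg _).hasFDerivAt.comp_hasDerivAt s (hasDerivAt_pair_line x y z s)

lemma hasDerivAt_grad1_line (hg : Differentiable ℝ (gradient φ)) (x : X) (y z : Y) (s : ℝ) :
    HasDerivAt (fun s : ℝ => grad1 φ x (y + s • z)) (hess12 φ x (y + s • z) z) s :=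
  (WithLp.fstL 2 ℝ X Y).hasFDerivAt.comp_hasDerivAt s (hasDerivAt_gradient_line hg x y z s)

lemma hasDerivAt_grad2_line (hg : Differentiable ℝ (gradient φ)) (x : X) (y z : Y) (s : ℝ) :
    HasDerivAt (fun s : ℝ => grad2 φ x (y + s • z)) (hess22 φ x (y + s • z) z) s :=
  (WithLp.sndL 2 ℝ X Y).hasFDerivAt.comp_hasDerivAt s (hasDerivAt_gradient_line hg x y z s)

lemma inner_gradient_inclY (v : Joint X Y) (z : Y) :
    inner ℝ (gradient φ v) (inclY X Y z) = inner ℝ (gradient φ v).snd z := by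
  rw [inclY_apply, WithLp.prod_inner_apply]
  simp

lemma hasDerivAt_line (hφ : Differentiable ℝ φ) (x : X) (y z : Y) (s : ℝ) :
    HasDerivAt (fun s : ℝ => φ (pair x (y + s • z))) (inner ℝ (grad2 φ x (y + s • z)) z) s := by
  have := (hφ (pair x (y + s • z))).hasFDerivAt.comp_hasDerivAt s (hasDerivAt_pair_line x y z s)
  rwa [← inner_gradient_left, inner_gradient_inclY] at this

/-- The right difference quotients at `0` are nonpositive. This converts the convexity and
monotonicity inequalities below into statements on derivatives. -/
lemma deriv_nonpos_of_nonpos_right {k : ℝ → ℝ} {k' : ℝ} (hk : HasDerivAt k k' 0) (h0 : k 0 = 0)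
    (h : ∀ s, 0 < s → s ≤ 1 → k s ≤ 0) : k' ≤ 0 := by
  have h1 : Tendsto (slope k 0) (𝓝[>] 0) (𝓝 k') :=
    (hasDerivAt_iff_tendsto_slope.1 hk).mono_left (nhdsWithin_mono _ fun x hx => ne_of_gt hx)
  refine le_of_tendsto h1 ?_
  filter_upwards [Ioc_mem_nhdsGT (zero_lt_one' ℝ)] with s hs
  rw [slope_def_field, h0]
  have := h s hs.1 hs.2
  exact div_nonpos_of_nonpos_of_nonneg (by linarith) (by linarith [hs.1])

lemma strong_first_order (hφ : Differentiable ℝ φ) {x : X}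
    (hc : StrongConvexOn Set.univ μ fun y => φ (pair x y)) (y y' : Y) :
    φ (pair x y) + inner ℝ (grad2 φ x y) (y' - y) + μ / 2 * ‖y' - y‖ ^ 2 ≤ φ (pair x y') := by
  set c := μ / 2 * ‖y' - y‖ ^ 2
  have hd := hasDerivAt_line hφ x y (y' - y) 0
  rw [zero_smul, add_zero] at hd
  -- Strong convexity says exactly that this function is nonpositive on `[0, 1]`; it vanishes at
  -- `0`, and its derivative there is the claimed inequality.
  have hk : HasDerivAt (fun s : ℝ => φ (pair x (y + s • (y' - y))) - φ (pair x y)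
      - s * (φ (pair x y') - φ (pair x y)) + s * (1 - s) * c)
      (inner ℝ (grad2 φ x y) (y' - y) - (φ (pair x y') - φ (pair x y)) + c) 0 := by
    have h2 := ((hd.sub_const (φ (pair x y))).sub
      ((hasDerivAt_id (0 : ℝ)).mul_const (φ (pair x y') - φ (pair x y)))).add
      (((hasDerivAt_id (0 : ℝ)).mul ((hasDerivAt_id (0 : ℝ)).const_sub 1)).mul_const c)
    exact h2.congr_deriv (by simp)
  have := deriv_nonpos_of_nonpos_right hk (by simp) fun s h0 h1 => by
    have h3 := hc.2 (Set.mem_univ y) (Set.mem_univ y') (by linarith : 0 ≤ 1 - s) h0.le (by ring)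
    have h4 : (1 - s) • y + s • y' = y + s • (y' - y) := by module
    rw [h4, norm_sub_rev y y'] at h3
    simp only [smul_eq_mul] at h3
    change _ ≤ _ - (1 - s) * s * c at h3
    linarith
  linarith

lemma strong_monotone (hφ : Differentiable ℝ φ) {x : X}
    (hc : StrongConvexOn Set.univ μ fun y => φ (pair x y)) (y y' : Y) :
    μ * ‖y - y'‖ ^ 2 ≤ inner ℝ (grad2 φ x y - grad2 φ x y') (y - y') := by
  have h1 := strong_first_order hφ hc y y'
  have h2 := strong_first_order hφ hc y' y
  rw [norm_sub_rev, ← neg_sub y y', inner_neg_right] at h1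
  rw [inner_sub_left]
  linarith

/-- Strong monotonicity between `y` and `y + s v`, divided by `s²`, passes to the derivative at `s =
0`. -/
lemma le_inner_hess22 (hg : Differentiable ℝ (gradient φ)) {x : X} {y : Y}
    (hm : ∀ y y', μ * ‖y - y'‖ ^ 2 ≤ inner ℝ (grad2 φ x y - grad2 φ x y') (y - y')) (v : Y) :
    μ * ‖v‖ ^ 2 ≤ inner ℝ (hess22 φ x y v) v := by
  have hd := hasDerivAt_grad2_line hg x y v 0
  have hd2 : HasDerivAt (fun s : ℝ => s * (μ * ‖v‖ ^ 2)
      - inner ℝ (grad2 φ x (y + s • v) - grad2 φ x y) v)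
      (μ * ‖v‖ ^ 2 - inner ℝ (hess22 φ x (y + (0 : ℝ) • v) v) v) 0 := by
    have h2 := ((hasDerivAt_id (0 : ℝ)).mul_const (μ * ‖v‖ ^ 2)).sub
      ((hd.sub_const (grad2 φ x y)).inner ℝ (hasDerivAt_const (0 : ℝ) v))
    exact h2.congr_deriv (by simp)
  have := deriv_nonpos_of_nonpos_right hd2 (by simp) fun s h0 _ => by
    have h3 := hm (y + s • v) y
    rw [add_sub_cancel_left, norm_smul, inner_smul_right, Real.norm_of_nonneg h0.le] at h3
    have h4 : s * (s * (μ * ‖v‖ ^ 2)) ≤ s * inner ℝ (grad2 φ x (y + s • v) - grad2 φ x y) v := by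
      linarith
    have := le_of_mul_le_mul_left h4 h0
    linarith
  rw [zero_smul, add_zero] at this
  linarith

lemma norm_sub_smul_sq_le {e a : Y} {η s : ℝ} (hη : 0 ≤ η) (hin : s * ‖e‖ ^ 2 ≤ inner ℝ a e)
    (ha : ‖a‖ ≤ L * ‖e‖) : ‖e - η • a‖ ^ 2 ≤ (1 - 2 * η * s + η ^ 2 * L ^ 2) * ‖e‖ ^ 2 := by
  rw [norm_sub_sq_real, norm_smul, mul_pow, inner_smul_right, Real.norm_eq_abs, sq_abs,
    real_inner_comm]
  have h1 := pow_le_pow_left₀ (norm_nonneg _) ha 2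
  nlinarith [mul_le_mul_of_nonneg_left h1 (sq_nonneg η), mul_le_mul_of_nonneg_left hin hη]

/-- The damped map `y ↦ y - η F y` is a contraction for `η = μ / L²`, the minimiser of `1 - 2ημ +
η²L²`; its fixed point is the zero. -/
lemma exists_zero_of_strong_monotone (hμ : 0 < μ) (hL : 0 < L) {F : Y → Y}
    (hm : ∀ y y', μ * ‖y - y'‖ ^ 2 ≤ inner ℝ (F y - F y') (y - y'))
    (hF : ∀ y y', ‖F y - F y'‖ ≤ L * ‖y - y'‖) : ∃ y, F y = 0 := by
  set q : ℝ := 1 - μ ^ 2 / L ^ 2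
  have hη : 0 < μ / L ^ 2 := by positivity
  have hq1 : q < 1 := by have : 0 < μ ^ 2 / L ^ 2 := by positivity
                         simp only [q]; linarith
  -- Since `μ ≤ L` is not assumed here, `q` may be negative; then `√q = 0` and the estimate below
  -- remains valid.
  have hsq : √q < 1 := by rw [Real.sqrt_lt' one_pos]; simpa using hq1
  have hc : ContractingWith ⟨√q, Real.sqrt_nonneg q⟩ fun y => y - (μ / L ^ 2) • F y := by
    refine ⟨by exact_mod_cast hsq, LipschitzWith.of_dist_le_mul fun y y' => ?_⟩
    rw [dist_eq_norm, dist_eq_norm]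
    have h1 := norm_sub_smul_sq_le hη.le (hm y y') (hF y y')
    have h2 : 1 - 2 * (μ / L ^ 2) * μ + (μ / L ^ 2) ^ 2 * L ^ 2 = q := by
      simp only [q]; field_simp; ring
    rw [h2] at h1
    have h3 := Real.sqrt_le_sqrt h1
    rw [Real.sqrt_sq (norm_nonneg _), Real.sqrt_mul' _ (sq_nonneg _),
      Real.sqrt_sq (norm_nonneg _)] at h3
    rw [show y - (μ / L ^ 2) • F y - (y' - (μ / L ^ 2) • F y')
      = y - y' - (μ / L ^ 2) • (F y - F y') by module]
    exact h3
  refine ⟨hc.fixedPoint, ?_⟩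
  have := hc.fixedPoint_isFixedPt
  unfold Function.IsFixedPt at this
  have h2 : (μ / L ^ 2) • F hc.fixedPoint = 0 := by
    simpa using this
  exact (smul_eq_zero.1 h2).resolve_left hη.ne'

lemma norm_le_of_le_inner {a b : Y} (h : μ * ‖b‖ ^ 2 ≤ inner ℝ a b) :
    μ * ‖b‖ ≤ ‖a‖ := by
  have h1 := h.trans (real_inner_le_norm a b)
  rcases (norm_nonneg b).eq_or_lt with h0 | h0
  · rw [← h0]; simp
  · nlinarith

/-- Coercivity gives injectivity, which in finite dimension is bijectivity. -/
lemma isInvertible_of_coercive [FiniteDimensional ℝ Y] (hμ : 0 < μ) {A : Y →L[ℝ] Y}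
    (h : ∀ v, μ * ‖v‖ ^ 2 ≤ inner ℝ (A v) v) : A.IsInvertible := by
  have hinj : Function.Injective (A : Y →ₗ[ℝ] Y) := by
    rw [injective_iff_map_eq_zero]
    intro v hv
    have := norm_le_of_le_inner (h v)
    rw [show A v = 0 from hv, norm_zero] at this
    exact norm_eq_zero.1 (le_antisymm (by nlinarith) (norm_nonneg _))
  exact ⟨(LinearEquiv.ofInjectiveEndo (A : Y →ₗ[ℝ] Y) hinj).toContinuousLinearEquiv, by ext; rfl⟩

/-- Error of the central difference. -/
lemma norm_central_diff_sub_le {E : Type*} [NormedAddCommGroup E] [NormedSpace ℝ E] {u u' : ℝ → E}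
    {C δ : ℝ} (hC : 0 ≤ C) (hδ : 0 < δ) (hu : ∀ s, HasDerivAt u (u' s) s)
    (hu' : ∀ s, ‖u' s - u' 0‖ ≤ C * |s|) :
    ‖(2 * δ)⁻¹ • (u δ - u (-δ)) - u' 0‖ ≤ C * δ := by
  -- After removal of the linear part the derivative is at most `C δ` on an interval of length `2δ`,
  -- which cancels the factor `(2δ)⁻¹`.
  have h1 : ∀ s ∈ Set.Icc (-δ) δ, HasDerivWithinAt (fun s => u s - s • u' 0) (u' s - u' 0)
      (Set.Icc (-δ) δ) s := fun s _ => by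
    have := ((hu s).sub ((hasDerivAt_id s).smul_const (u' 0))).hasDerivWithinAt
      (s := Set.Icc (-δ) δ)
    exact this.congr_deriv (by simp)
  have h2 := norm_image_sub_le_of_norm_deriv_le_segment' (C := C * δ) h1 (fun s hs =>
    (hu' s).trans (by
      gcongr
      exact abs_le.2 ⟨hs.1, hs.2.le⟩)) δ ⟨by linarith, le_rfl⟩
  have h3 : (2 * δ)⁻¹ • (u δ - u (-δ)) - u' 0
      = (2 * δ)⁻¹ • (u δ - δ • u' 0 - (u (-δ) - (-δ) • u' 0)) := by
    have : u' 0 = (2 * δ)⁻¹ • ((2 * δ) • u' 0) := by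
      rw [smul_smul, inv_mul_cancel₀ (by positivity), one_smul]
    nth_rewrite 1 [this]
    module
  rw [h3, norm_smul, norm_inv, Real.norm_of_nonneg (by positivity),
    inv_mul_le_iff₀ (by positivity)]
  linarith

/-- Quadratic upper bound for a function with Lipschitz gradient. -/
lemma descent {E : Type*} [NormedAddCommGroup E] [InnerProductSpace ℝ E] [CompleteSpace E]
    {Ψ : E → ℝ} (hΨ : Differentiable ℝ Ψ) (hL : 0 ≤ L)
    (h : ∀ a b, ‖gradient Ψ a - gradient Ψ b‖ ≤ L * ‖a - b‖) (a d : E) :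
    Ψ (a + d) ≤ Ψ a + inner ℝ (gradient Ψ a) d + L * ‖d‖ ^ 2 := by
  have hd : ∀ s : ℝ, HasDerivAt (fun s : ℝ => Ψ (a + s • d) - s * inner ℝ (gradient Ψ a) d)
      (inner ℝ (gradient Ψ (a + s • d) - gradient Ψ a) d) s := fun s => by
    have h1 : HasDerivAt (fun s : ℝ => a + s • d) d s := by
      simpa using ((hasDerivAt_id s).smul_const d).const_add a
    have h2 := (hΨ (a + s • d)).hasFDerivAt.comp_hasDerivAt s h1
    rw [← inner_gradient_left] at h2
    rw [inner_sub_left]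
    exact (h2.sub ((hasDerivAt_id s).mul_const (inner ℝ (gradient Ψ a) d))).congr_deriv (by simp)
  -- The derivative is bounded uniformly on `[0, 1]` instead of being integrated, hence the constant
  -- `L` in place of `L / 2`.
  have h2 := norm_image_sub_le_of_norm_deriv_le_segment_01' (C := L * ‖d‖ ^ 2)
    (fun s _ => (hd s).hasDerivWithinAt) fun s hs => by
      refine (norm_inner_le_norm _ _).trans ?_
      have h3 := h (a + s • d) a
      rw [add_sub_cancel_left, norm_smul, Real.norm_of_nonneg hs.1] at h3
      have h4 : L * (s * ‖d‖) ≤ L * (1 * ‖d‖) := by gcongr; exact hs.2.le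
      nlinarith [norm_nonneg d]
  rw [Real.norm_eq_abs] at h2
  have h3 := (abs_le.1 h2).2
  simp only [one_smul, zero_smul, add_zero, one_mul, zero_mul, sub_zero] at h3
  linarith

end Calculus

/-! ### Derivatives of the global losses as averages, and node-wise bounds. -/

section Averages

variable {X Y : Type*} [NormedAddCommGroup X] [InnerProductSpace ℝ X] [CompleteSpace X]
  [NormedAddCommGroup Y] [InnerProductSpace ℝ Y] [CompleteSpace Y]
  {N : ℕ} {Ξ : Type u} {Z : Type v} [MeasurableSpace Ξ] [MeasurableSpace Z]
  {P : Problem N X Y Ξ Z} {L μ κ : ℝ}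

lemma hasGradientAt_mean {E : Type*} [NormedAddCommGroup E] [InnerProductSpace ℝ E]
    [CompleteSpace E] {φ : Fin N → E → ℝ} (h : ∀ i, Differentiable ℝ (φ i)) (v : E) :
    HasGradientAt (fun v => mean fun i => φ i v) (mean fun i => gradient (φ i) v) v := by
  rw [hasGradientAt_iff_hasFDerivAt]
  refine HasFDerivAt.congr_fderiv
    ((HasFDerivAt.fun_sum fun i _ => (h i v).hasFDerivAt).const_smul ((N : ℝ)⁻¹)) ?_
  ext w
  rw [InnerProductSpace.toDual_apply_apply, inner_mean]
  simp [mean]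

namespace Problem.Smooth

lemma mono {Lf Ldf Ldg Lddg : ℝ} (hs : P.Smooth Lf Ldf Ldg Lddg μ)
    (h1 : Lf ≤ L) (h2 : Ldf ≤ L) (h3 : Ldg ≤ L) (h4 : Lddg ≤ L) : P.Smooth L L L L μ where
  diff_f := hs.diff_f
  diff_g := hs.diff_g
  diff_grad_g := hs.diff_grad_g
  lip_f i v v' := (hs.lip_f i v v').trans (by gcongr)
  lip_g i v v' := (hs.lip_g i v v').trans (by gcongr)
  lip_hess_g i v v' := (hs.lip_hess_g i v v').trans (by gcongr)
  bound_f i x := (hs.bound_f i x).trans h1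
  strong := hs.strong

variable (hs : P.Smooth L L L L μ)
include hs

lemma gradient_fAvg (v : Joint X Y) : gradient P.fAvg v = mean fun i => gradient (P.f i) v :=
  (hasGradientAt_mean hs.diff_f v).gradient

lemma gradient_gAvg (v : Joint X Y) : gradient P.gAvg v = mean fun i => gradient (P.g i) v :=
  (hasGradientAt_mean hs.diff_g v).gradient

lemma differentiable_fAvg : Differentiable ℝ P.fAvg := fun v =>
  (hasGradientAt_mean hs.diff_f v).differentiableAt

lemma differentiable_gAvg : Differentiable ℝ P.gAvg := fun v =>
  (hasGradientAt_mean hs.diff_g v).differentiableAt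

lemma hasFDerivAt_gradient_gAvg (v : Joint X Y) :
    HasFDerivAt (gradient P.gAvg) (mean fun i => hess (P.g i) v) v := by
  rw [show gradient P.gAvg = fun v => mean fun i => gradient (P.g i) v from
    funext hs.gradient_gAvg]
  exact (HasFDerivAt.fun_sum fun i _ => (hs.diff_grad_g i v).hasFDerivAt).const_smul ((N : ℝ)⁻¹)

lemma differentiable_gradient_gAvg : Differentiable ℝ (gradient P.gAvg) := fun v =>
  (hs.hasFDerivAt_gradient_gAvg v).differentiableAt

lemma hess_gAvg (v : Joint X Y) : hess P.gAvg v = mean fun i => hess (P.g i) v :=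
  (hs.hasFDerivAt_gradient_gAvg v).fderiv

lemma grad1_fAvg (x : X) (y : Y) : grad1 P.fAvg x y = mean fun i => grad1 (P.f i) x y := by
  unfold grad1
  rw [hs.gradient_fAvg]
  exact map_mean (WithLp.fstL 2 ℝ X Y) _

lemma grad2_fAvg (x : X) (y : Y) : grad2 P.fAvg x y = mean fun i => grad2 (P.f i) x y := by
  unfold grad2
  rw [hs.gradient_fAvg]
  exact map_mean (WithLp.sndL 2 ℝ X Y) _

lemma grad2_gAvg (x : X) (y : Y) : grad2 P.gAvg x y = mean fun i => grad2 (P.g i) x y := by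
  unfold grad2
  rw [hs.gradient_gAvg]
  exact map_mean (WithLp.sndL 2 ℝ X Y) _

lemma hess12_gAvg_apply (x : X) (y z : Y) :
    hess12 P.gAvg x y z = mean fun i => hess12 (P.g i) x y z := by
  unfold hess12
  rw [hs.hess_gAvg, ContinuousLinearMap.comp_apply, ContinuousLinearMap.comp_apply]
  rw [show (mean fun i => hess (P.g i) (pair x y)) (inclY X Y z)
    = mean fun i => hess (P.g i) (pair x y) (inclY X Y z) from
    map_mean (ContinuousLinearMap.apply ℝ (Joint X Y) (inclY X Y z)) _]
  exact map_mean (WithLp.fstL 2 ℝ X Y) _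

lemma hess22_gAvg_apply (x : X) (y z : Y) :
    hess22 P.gAvg x y z = mean fun i => hess22 (P.g i) x y z := by
  unfold hess22
  rw [hs.hess_gAvg, ContinuousLinearMap.comp_apply, ContinuousLinearMap.comp_apply]
  rw [show (mean fun i => hess (P.g i) (pair x y)) (inclY X Y z)
    = mean fun i => hess (P.g i) (pair x y) (inclY X Y z) from
    map_mean (ContinuousLinearMap.apply ℝ (Joint X Y) (inclY X Y z)) _]
  exact map_mean (WithLp.sndL 2 ℝ X Y) _

lemma grad1_f_lip (i : Fin N) (x x' : X) (y y' : Y) :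
    ‖grad1 (P.f i) x y - grad1 (P.f i) x' y'‖ ≤ L * ‖pair x y - pair x' y'‖ :=
  (WithLp.norm_fst_le _ (gradient (P.f i) (pair x y) - gradient (P.f i) (pair x' y'))).trans
    (hs.lip_f i _ _)

lemma grad2_f_lip (i : Fin N) (x x' : X) (y y' : Y) :
    ‖grad2 (P.f i) x y - grad2 (P.f i) x' y'‖ ≤ L * ‖pair x y - pair x' y'‖ :=
  (WithLp.norm_snd_le _ (gradient (P.f i) (pair x y) - gradient (P.f i) (pair x' y'))).trans
    (hs.lip_f i _ _)

lemma grad2_g_lip (i : Fin N) (x x' : X) (y y' : Y) :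
    ‖grad2 (P.g i) x y - grad2 (P.g i) x' y'‖ ≤ L * ‖pair x y - pair x' y'‖ :=
  (WithLp.norm_snd_le _ (gradient (P.g i) (pair x y) - gradient (P.g i) (pair x' y'))).trans
    (hs.lip_g i _ _)

lemma hess12_g_lip (i : Fin N) (x x' : X) (y y' : Y) :
    ‖hess12 (P.g i) x y - hess12 (P.g i) x' y'‖ ≤ L * ‖pair x y - pair x' y'‖ :=
  (norm_hess12_sub_le _ _ _ _ _).trans (hs.lip_hess_g i _ _)

lemma hess22_g_lip (i : Fin N) (x x' : X) (y y' : Y) :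
    ‖hess22 (P.g i) x y - hess22 (P.g i) x' y'‖ ≤ L * ‖pair x y - pair x' y'‖ :=
  (norm_hess22_sub_le _ _ _ _ _).trans (hs.lip_hess_g i _ _)

lemma norm_hess12_g_le (hL : 0 ≤ L) (i : Fin N) (x : X) (y : Y) : ‖hess12 (P.g i) x y‖ ≤ L :=
  (norm_fst_comp_inclY_le _).trans (norm_hess_le hL (hs.lip_g i) _)

lemma norm_hess22_g_le (hL : 0 ≤ L) (i : Fin N) (x : X) (y : Y) : ‖hess22 (P.g i) x y‖ ≤ L :=
  (norm_snd_comp_inclY_le _).trans (norm_hess_le hL (hs.lip_g i) _)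

lemma strong_monotone_g (i : Fin N) (x : X) (y y' : Y) :
    μ * ‖y - y'‖ ^ 2 ≤ inner ℝ (grad2 (P.g i) x y - grad2 (P.g i) x y') (y - y') :=
  strong_monotone (hs.diff_g i) (hs.strong i x) y y'

lemma le_inner_hess22_g (i : Fin N) (x : X) (y v : Y) :
    μ * ‖v‖ ^ 2 ≤ inner ℝ (hess22 (P.g i) x y v) v :=
  le_inner_hess22 (hs.diff_grad_g i) (hs.strong_monotone_g i x) v

/-- Strong monotonicity and the Lipschitz bound are compared along one nonzero vector. This is the
source of `1 ≤ κ`, on which all later comparisons of powers of `κ` rest. -/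
lemma strong_convexity_le [Nontrivial Y] (hN : 0 < N) : μ ≤ L := by
  obtain ⟨v, hv⟩ := exists_ne (0 : Y)
  have h1 := norm_le_of_le_inner (hs.strong_monotone_g ⟨0, hN⟩ 0 v 0)
  have h2 := hs.grad2_g_lip ⟨0, hN⟩ 0 0 v 0
  rw [norm_pair_sub_left] at h2
  rw [sub_zero] at h1 h2
  exact le_of_mul_le_mul_right (h1.trans h2) (norm_pos_iff.2 hv)

end Problem.Smooth

end Averages

/-! ### Regularity of `y⋆`, `z⋆` and the hypergradient. -/

section Bilevel

variable {X Y : Type*} [NormedAddCommGroup X] [InnerProductSpace ℝ X] [CompleteSpace X]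
  [NormedAddCommGroup Y] [InnerProductSpace ℝ Y] [CompleteSpace Y]
  {N : ℕ} {Ξ : Type u} {Z : Type v} [MeasurableSpace Ξ] [MeasurableSpace Z]
  {P : Problem N X Y Ξ Z} {L μ κ : ℝ}

namespace Problem.Smooth

variable (hs : P.Smooth L L L L μ) (hN : 0 < N) (hL : 0 < L) (hμ : 0 < μ)
include hs hN

lemma grad2_gAvg_lip (x x' : X) (y y' : Y) :
    ‖grad2 P.gAvg x y - grad2 P.gAvg x' y'‖ ≤ L * ‖pair x y - pair x' y'‖ := by
  rw [hs.grad2_gAvg, hs.grad2_gAvg, ← mean_sub]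
  exact norm_mean_le hN _ fun i => hs.grad2_g_lip i x x' y y'

lemma grad1_fAvg_lip (x x' : X) (y y' : Y) :
    ‖grad1 P.fAvg x y - grad1 P.fAvg x' y'‖ ≤ L * ‖pair x y - pair x' y'‖ := by
  rw [hs.grad1_fAvg, hs.grad1_fAvg, ← mean_sub]
  exact norm_mean_le hN _ fun i => hs.grad1_f_lip i x x' y y'

lemma grad2_fAvg_lip (x x' : X) (y y' : Y) :
    ‖grad2 P.fAvg x y - grad2 P.fAvg x' y'‖ ≤ L * ‖pair x y - pair x' y'‖ := by
  rw [hs.grad2_fAvg, hs.grad2_fAvg, ← mean_sub]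
  exact norm_mean_le hN _ fun i => hs.grad2_f_lip i x x' y y'

lemma hess22_gAvg_sub_apply_le (x x' : X) (y y' z : Y) :
    ‖hess22 P.gAvg x y z - hess22 P.gAvg x' y' z‖ ≤ L * ‖pair x y - pair x' y'‖ * ‖z‖ := by
  rw [hs.hess22_gAvg_apply, hs.hess22_gAvg_apply, ← mean_sub]
  refine norm_mean_le hN _ fun i => ?_
  rw [← sub_apply]
  exact (ContinuousLinearMap.le_opNorm _ _).trans (by gcongr; exact hs.hess22_g_lip i x x' y y')

lemma hess12_gAvg_sub_apply_le (x x' : X) (y y' z : Y) :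
    ‖hess12 P.gAvg x y z - hess12 P.gAvg x' y' z‖ ≤ L * ‖pair x y - pair x' y'‖ * ‖z‖ := by
  rw [hs.hess12_gAvg_apply, hs.hess12_gAvg_apply, ← mean_sub]
  refine norm_mean_le hN _ fun i => ?_
  rw [← sub_apply]
  exact (ContinuousLinearMap.le_opNorm _ _).trans (by gcongr; exact hs.hess12_g_lip i x x' y y')

lemma strong_monotone_gAvg (x : X) (y y' : Y) :
    μ * ‖y - y'‖ ^ 2 ≤ inner ℝ (grad2 P.gAvg x y - grad2 P.gAvg x y') (y - y') := by
  rw [hs.grad2_gAvg, hs.grad2_gAvg, ← mean_sub, inner_mean,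
    ← mean_const hN (μ * ‖y - y'‖ ^ 2)]
  exact mean_le_mean fun i => hs.strong_monotone_g i x y y'

lemma le_inner_hess22_gAvg (x : X) (y v : Y) :
    μ * ‖v‖ ^ 2 ≤ inner ℝ (hess22 P.gAvg x y v) v :=
  le_inner_hess22 hs.differentiable_gradient_gAvg (hs.strong_monotone_gAvg hN x) v

lemma first_order_gAvg (x : X) (y y' : Y) :
    P.gAvg (pair x y) + inner ℝ (grad2 P.gAvg x y) (y' - y) + μ / 2 * ‖y' - y‖ ^ 2
      ≤ P.gAvg (pair x y') := by
  rw [hs.grad2_gAvg, inner_mean, ← mean_const hN (μ / 2 * ‖y' - y‖ ^ 2)]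
  unfold Problem.gAvg
  rw [← mean_add, ← mean_add]
  exact mean_le_mean fun i => strong_first_order (hs.diff_g i) (hs.strong i x) y y'

include hμ

include hL in
-- A zero `y₀` of the partial gradient exists and minimises with quadratic growth. Hence the choice
-- defining `yStar` is a genuine minimiser, and the growth forces it to equal `y₀`.
lemma grad2_gAvg_yStar (x : X) : grad2 P.gAvg x (P.yStar x) = 0 := by
  obtain ⟨y₀, h0⟩ := exists_zero_of_strong_monotone hμ hL (hs.strong_monotone_gAvg hN x)
    fun y y' => by simpa only [norm_pair_sub_left] using hs.grad2_gAvg_lip hN x x y y'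
  have h1 : ∀ y, P.gAvg (pair x y₀) + μ / 2 * ‖y - y₀‖ ^ 2 ≤ P.gAvg (pair x y) := fun y => by
    have := hs.first_order_gAvg hN x y₀ y
    rwa [h0, inner_zero_left, add_zero] at this
  have h2 : ∃ y, ∀ y', P.gAvg (pair x y) ≤ P.gAvg (pair x y') :=
    ⟨y₀, fun y => le_trans (le_add_of_nonneg_right (by positivity)) (h1 y)⟩
  have h3 := Classical.epsilon_spec h2 y₀
  have h4 := h1 (P.yStar x)
  have h5 : ‖P.yStar x - y₀‖ ^ 2 ≤ 0 := by
    change P.gAvg (pair x (P.yStar x)) ≤ _ at h3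
    nlinarith
  have h6 : P.yStar x = y₀ := by
    rw [← sub_eq_zero, ← norm_eq_zero]
    exact pow_eq_zero_iff two_ne_zero |>.1 (le_antisymm h5 (by positivity))
  rw [h6, h0]

variable (hκ : κ * μ = L) (hκ1 : 1 ≤ κ)
include hL hκ

/-- Strong monotonicity at `x` bounds the distance by `μ⁻¹‖∇₂g(x, y⋆(x'))‖`, and this gradient is
within `L‖x - x'‖` of `∇₂g(x', y⋆(x')) = 0`. -/
lemma yStar_lip (x x' : X) : ‖P.yStar x - P.yStar x'‖ ≤ κ * ‖x - x'‖ := by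
  have h1 := norm_le_of_le_inner (hs.strong_monotone_gAvg hN x (P.yStar x) (P.yStar x'))
  have h2 := hs.grad2_gAvg_lip hN x' x (P.yStar x') (P.yStar x')
  rw [hs.grad2_gAvg_yStar hN hL hμ, norm_pair_sub_right] at h2
  rw [hs.grad2_gAvg_yStar hN hL hμ] at h1
  rw [norm_sub_rev x' x] at h2
  have h3 := h1.trans h2
  rw [← hκ] at h3
  nlinarith

include hκ1

lemma norm_pair_yStar_sub_le (x x' : X) :
    ‖pair x (P.yStar x) - pair x' (P.yStar x')‖ ≤ 2 * κ * ‖x - x'‖ := by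
  refine le_of_sq_le_sq ?_ (by positivity)
  rw [norm_pair_sub_sq]
  have h := pow_le_pow_left₀ (norm_nonneg _) (hs.yStar_lip hN hL hμ hκ x x') 2
  nlinarith [mul_nonneg (sub_nonneg.2 (one_le_pow₀ hκ1 : 1 ≤ κ ^ 2)) (sq_nonneg ‖x - x'‖),
    mul_nonneg (sq_nonneg κ) (sq_nonneg ‖x - x'‖)]

variable [FiniteDimensional ℝ Y]

omit hL hκ hκ1 in
lemma isInvertible_hess22_gAvg (x : X) (y : Y) : (hess22 P.gAvg x y).IsInvertible :=
  isInvertible_of_coercive hμ (hs.le_inner_hess22_gAvg hN x y)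

omit hL hκ hκ1 in
lemma hess22_zStar (x : X) :
    hess22 P.gAvg x (P.yStar x) (P.zStar x) = grad2 P.fAvg x (P.yStar x) :=
  (hs.isInvertible_hess22_gAvg hN hμ x _).self_apply_inverse _

omit hL hκ1 in
lemma norm_zStar_le (x : X) : ‖P.zStar x‖ ≤ κ := by
  have h1 := norm_le_of_le_inner (hs.le_inner_hess22_gAvg hN x (P.yStar x) (P.zStar x))
  rw [hs.hess22_zStar hN hμ, hs.grad2_fAvg] at h1
  have h2 := h1.trans (norm_mean_le hN _ fun i => hs.bound_f i x)
  rw [← hκ, mul_comm] at h2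
  exact le_of_mul_le_mul_right h2 hμ

/-- The Hessian at `x` applied to the difference leaves the increment of `∇₂f` minus the increment
of the Hessian acting on `z⋆(x')`. With `‖z⋆‖ ≤ κ`, coercivity gives the constant `2κ²(1 + κ)`. -/
lemma zStar_lip (x x' : X) : ‖P.zStar x - P.zStar x'‖ ≤ 4 * κ ^ 3 * ‖x - x'‖ := by
  have hκ0 : 0 < κ := by linarith
  have h1 := norm_le_of_le_inner
    (hs.le_inner_hess22_gAvg hN x (P.yStar x) (P.zStar x - P.zStar x'))
  rw [map_sub, hs.hess22_zStar hN hμ] at h1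
  have h2 : ‖grad2 P.fAvg x (P.yStar x) - hess22 P.gAvg x (P.yStar x) (P.zStar x')‖
      ≤ L * ‖pair x (P.yStar x) - pair x' (P.yStar x')‖
        + L * ‖pair x (P.yStar x) - pair x' (P.yStar x')‖ * ‖P.zStar x'‖ := by
    have h3 := hs.hess22_gAvg_sub_apply_le hN x x' (P.yStar x) (P.yStar x') (P.zStar x')
    rw [hs.hess22_zStar hN hμ] at h3
    have h4 := hs.grad2_fAvg_lip hN x x' (P.yStar x) (P.yStar x')
    refine le_trans ?_ (add_le_add h4 h3)
    refine le_trans (le_of_eq ?_) (norm_sub_le _ _)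
    congr 1; abel
  have h5 := hs.norm_pair_yStar_sub_le hN hL hμ hκ hκ1 x x'
  have h6 := hs.norm_zStar_le hN hμ hκ x'
  have h7 : L * ‖pair x (P.yStar x) - pair x' (P.yStar x')‖
        + L * ‖pair x (P.yStar x) - pair x' (P.yStar x')‖ * ‖P.zStar x'‖
      ≤ L * (2 * κ * ‖x - x'‖) + L * (2 * κ * ‖x - x'‖) * κ := by gcongr
  have h8 := h1.trans (h2.trans h7)
  rw [← hκ] at h8
  have h9 : μ * ‖P.zStar x - P.zStar x'‖ ≤ μ * (4 * κ ^ 3 * ‖x - x'‖) := by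
    refine h8.trans ?_
    have : 0 ≤ μ * ‖x - x'‖ * κ ^ 2 * (2 * (κ - 1)) := by
      have : 0 ≤ κ - 1 := by linarith
      positivity
    nlinarith
  exact le_of_mul_le_mul_left h9 hμ

/-- Hypergradient `∇₁f(x, y⋆) - ∇²₁₂g(x, y⋆) z⋆`. -/
lemma hasGradientAt_Phi (x : X) : HasGradientAt P.Phi
    (grad1 P.fAvg x (P.yStar x) - hess12 P.gAvg x (P.yStar x) (P.zStar x)) x := by
  set v : X → Joint X Y := fun x => pair x (P.yStar x)
  set H := hess P.gAvg (v x)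
  set H22 := hess22 P.gAvg x (P.yStar x)
  have hinv := hs.isInvertible_hess22_gAvg hN hμ x (P.yStar x)
  let inclX : X →L[ℝ] Joint X Y :=
    ((WithLp.prodContinuousLinearEquiv 2 ℝ X Y).symm :
    (X × Y) →L[ℝ] Joint X Y).comp (ContinuousLinearMap.inl ℝ X Y)
  let H21 : X →L[ℝ] Y := (WithLp.sndL 2 ℝ X Y).comp (H.comp inclX)
  let D : X →L[ℝ] Y := -(H22.inverse.comp H21)
  have hv : (fun x' => v x' - v x) =O[𝓝 x] fun x' => x' - x :=
    Asymptotics.IsBigO.of_bound (2 * κ) (Eventually.of_forall fun x' =>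
      hs.norm_pair_yStar_sub_le hN hL hμ hκ hκ1 x' x)
  have hvt : Tendsto v (𝓝 x) (𝓝 (v x)) := by
    have h1 : Tendsto (fun x' => x' - x) (𝓝 x) (𝓝 0) := by
      have := (tendsto_id (α := X) (x := 𝓝 x)).sub_const x
      rwa [sub_self] at this
    have := (hv.trans_tendsto h1).add_const (v x)
    simpa using this
  -- Implicit differentiation. As `y⋆` is already Lipschitz, the Taylor remainder of `∇₂g = 0` along
  -- the curve `v` is `o(x' - x)`; applying the inverse of `H22` isolates the increment of `y⋆`.
  have hy : HasFDerivAt P.yStar D x := by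
    have h1 := (hasFDerivAt_iff_isLittleO.1
      (hs.differentiable_gradient_gAvg (v x)).hasFDerivAt).comp_tendsto hvt
    have h2 := (h1.trans_isBigO hv)
    have h3 := ((H22.inverse.comp (WithLp.sndL 2 ℝ X Y)).isBigO_comp _ (𝓝 x)).trans_isLittleO h2
    rw [hasFDerivAt_iff_isLittleO]
    refine h3.neg_left.congr_left fun x' => ?_
    have h4 : ∀ x, (gradient P.gAvg (v x)).snd = 0 := fun x =>
      hs.grad2_gAvg_yStar hN hL hμ x
    have h5 : (H (v x' - v x)).snd = H21 (x' - x) + H22 (P.yStar x' - P.yStar x) := by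
      have : v x' - v x = inclX (x' - x) + inclY X Y (P.yStar x' - P.yStar x) := by
        refine WithLp.ofLp_injective 2 (Prod.ext ?_ ?_)
        · change x' - x = (x' - x) + 0
          rw [add_zero]
        · change P.yStar x' - P.yStar x = 0 + (P.yStar x' - P.yStar x)
          rw [zero_add]
      rw [this, map_add]
      rfl
    simp only [Function.comp_apply, ContinuousLinearMap.comp_apply]
    change -(H22.inverse ((gradient P.gAvg (v x')).snd - (gradient P.gAvg (v x)).snd
      - (H (v x' - v x)).snd)) = _
    rw [h4, h4, h5, sub_zero, zero_sub, map_neg, neg_neg, map_add, hinv.inverse_apply_self]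
    change _ = _ - -(H22.inverse (H21 (x' - x)))
    abel
  have hvd : HasFDerivAt v (inclX + (inclY X Y).comp D) x := by
    have h1 := (inclX.hasFDerivAt (x := x)).add ((inclY X Y).hasFDerivAt.comp x hy)
    refine h1.congr_of_eventuallyEq (Eventually.of_forall fun x' => ?_)
    refine WithLp.ofLp_injective 2 (Prod.ext ?_ ?_)
    · change x' = x' + 0
      rw [add_zero]
    · change P.yStar x' = 0 + P.yStar x'
      rw [zero_add]
  have hΦ := (hs.differentiable_fAvg (v x)).hasFDerivAt.comp x hvd
  rw [hasGradientAt_iff_hasFDerivAt]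
  refine hΦ.congr_fderiv ?_
  ext dx
  rw [InnerProductSpace.toDual_apply_apply, ContinuousLinearMap.comp_apply, ← inner_gradient_left]
  have h6 : (inclX + (inclY X Y).comp D) dx = inclX dx + inclY X Y (D dx) := rfl
  have h7 : ∀ w : Joint X Y, inner ℝ w (inclX dx) = inner ℝ w.fst dx := fun w => by
    rw [WithLp.prod_inner_apply]
    change inner ℝ w.fst dx + inner ℝ w.snd 0 = _
    rw [inner_zero_right, add_zero]
  -- Symmetry of the Hessian moves `H22` from `z⋆` onto `H22⁻¹ H21 dx`, and then turns `H21` into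
  -- the block `∇²₁₂g`; no derivative of `z⋆` is needed.
  have h8 : ∀ w w' : Y, inner ℝ (H22 w) w' = inner ℝ w (H22 w') := fun w w' => by
    have := hess_symm hs.differentiable_gAvg hs.differentiable_gradient_gAvg (v x)
      (inclY X Y w) (inclY X Y w')
    rw [WithLp.prod_inner_apply, WithLp.prod_inner_apply] at this
    change inner ℝ _ 0 + inner ℝ (H22 w) w' = inner ℝ 0 _ + inner ℝ w (H22 w') at this
    rwa [inner_zero_left, inner_zero_right, zero_add, zero_add] at this
  have h9 : inner ℝ (P.zStar x) (H21 dx) = inner ℝ (hess12 P.gAvg x (P.yStar x) (P.zStar x)) dx := by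
    have := hess_symm hs.differentiable_gAvg hs.differentiable_gradient_gAvg (v x)
      (inclY X Y (P.zStar x)) (inclX dx)
    rw [h7, WithLp.prod_inner_apply] at this
    change inner ℝ (hess12 P.gAvg x (P.yStar x) (P.zStar x)) dx
      = inner ℝ 0 _ + inner ℝ (P.zStar x) (H21 dx) at this
    rw [this, inner_zero_left, zero_add]
  rw [h6, inner_add_right, h7, inner_gradient_inclY, inner_sub_left]
  change inner ℝ (grad1 P.fAvg x (P.yStar x)) dx + inner ℝ (grad2 P.fAvg x (P.yStar x))
    (-(H22.inverse (H21 dx))) = _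
  rw [← hs.hess22_zStar hN hμ, inner_neg_right, h8, hinv.self_apply_inverse, h9]
  ring

lemma differentiable_Phi : Differentiable ℝ P.Phi := fun x =>
  (hs.hasGradientAt_Phi hN hL hμ hκ hκ1 x).differentiableAt

lemma gradient_Phi (x : X) : gradient P.Phi x =
    grad1 P.fAvg x (P.yStar x) - hess12 P.gAvg x (P.yStar x) (P.zStar x) :=
  (hs.hasGradientAt_Phi hN hL hμ hκ hκ1 x).gradient

/-- The increments of `∇₁f`, of `∇²₁₂g` on a vector of norm at most `κ`, and of `z⋆` contribute
`2κ`, `2κ²` and `4κ³`, each times `L`. -/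
lemma gradient_Phi_lip (x x' : X) :
    ‖gradient P.Phi x - gradient P.Phi x'‖ ≤ 8 * L * κ ^ 3 * ‖x - x'‖ := by
  have hκ0 : 0 < κ := by linarith
  rw [hs.gradient_Phi hN hL hμ hκ hκ1, hs.gradient_Phi hN hL hμ hκ hκ1]
  have h1 := hs.grad1_fAvg_lip hN x x' (P.yStar x) (P.yStar x')
  have h2 := hs.hess12_gAvg_sub_apply_le hN x x' (P.yStar x) (P.yStar x') (P.zStar x)
  have h3 : ‖hess12 P.gAvg x' (P.yStar x') (P.zStar x - P.zStar x')‖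
      ≤ L * ‖P.zStar x - P.zStar x'‖ := by
    rw [hs.hess12_gAvg_apply]
    exact norm_mean_le hN _ fun i => (ContinuousLinearMap.le_opNorm _ _).trans
      (by gcongr; exact hs.norm_hess12_g_le hL.le i _ _)
  have h5 := hs.norm_pair_yStar_sub_le hN hL hμ hκ hκ1 x x'
  have h6 := hs.norm_zStar_le hN hμ hκ x
  have h7 := hs.zStar_lip hN hL hμ hκ hκ1 x x'
  have h8 : ∀ a a' b b' c : X, a - b - (a' - b') = (a - a') - (b - c) - (c - b') := by
    intros; abel
  rw [h8 _ _ _ _ (hess12 P.gAvg x' (P.yStar x') (P.zStar x)), ← map_sub]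
  have h9 : L * ‖pair x (P.yStar x) - pair x' (P.yStar x')‖
      + L * ‖pair x (P.yStar x) - pair x' (P.yStar x')‖ * ‖P.zStar x‖
      + L * ‖P.zStar x - P.zStar x'‖ ≤ L * (2 * κ * ‖x - x'‖) + L * (2 * κ * ‖x - x'‖) * κ
      + L * (4 * κ ^ 3 * ‖x - x'‖) := by gcongr
  refine ((norm_sub_le _ _).trans (add_le_add ((norm_sub_le _ _).trans (add_le_add h1 h2)) h3)).trans
    (h9.trans ?_)
  have h10 : 0 ≤ κ - 1 := by linarith
  have h11 : 0 ≤ L * ‖x - x'‖ * κ * ((κ - 1) * (4 * κ + 2)) := by positivity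
  linarith [show L * ‖x - x'‖ * κ * ((κ - 1) * (4 * κ + 2))
    = 8 * L * κ ^ 3 * ‖x - x'‖ - (L * (2 * κ * ‖x - x'‖) + L * (2 * κ * ‖x - x'‖) * κ
      + L * (4 * κ ^ 3 * ‖x - x'‖)) by ring]

end Problem.Smooth

end Bilevel

/-! ### Error quantities and deviations from the reference point. -/

section Recursion

variable {X Y : Type*} [NormedAddCommGroup X] [InnerProductSpace ℝ X] [CompleteSpace X]
  [NormedAddCommGroup Y] [InnerProductSpace ℝ Y] [CompleteSpace Y]
  {N : ℕ} {Ξ : Type u} {Z : Type v} [MeasurableSpace Ξ] [MeasurableSpace Z]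
  (P : Problem N X Y Ξ Z) (R : ProductRule X Y) (s : State N X Y)

/-- Squared error of the averaged lower-level variable. -/
def errY : ℝ := ‖mean s.y - P.yStar (mean s.x)‖ ^ 2

/-- Squared error of the averaged auxiliary variable. -/
def errZ : ℝ := ‖mean s.z - P.zStar (mean s.x)‖ ^ 2

/-- Squared error of the averaged hypergradient estimate. -/
def errH : ℝ := ‖mean s.h - gradient P.Phi (mean s.x)‖ ^ 2

/-- Consensus error of the first two variables together with the lower-level error. -/
def distSq : ℝ := spread s.x + spread s.y + errY P s

/-- The update direction of `z` at node `j`. -/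
def dirZ (j : Fin N) : Y :=
  R.pH (P.g j) (s.x j) (s.y j) (s.z j) - grad2 (P.f j) (s.x j) (s.y j)

/-- The local hypergradient estimate at node `j`. -/
def dirH (j : Fin N) : X :=
  grad1 (P.f j) (s.x j) (s.y j) - R.pJ (P.g j) (s.x j) (s.y j) (s.z j)

/-- The product rule has error at most `ε` at all nodes. -/
def RuleError (ε : ℝ) : Prop := ∀ j,
  ‖R.pH (P.g j) (s.x j) (s.y j) (s.z j) - hess22 (P.g j) (s.x j) (s.y j) (s.z j)‖ ≤ ε ∧
  ‖R.pJ (P.g j) (s.x j) (s.y j) (s.z j) - hess12 (P.g j) (s.x j) (s.y j) (s.z j)‖ ≤ ε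

/-- Value of the `z` direction at the reference point `(x, y⋆(x), z⋆(x))`. -/
def refZ (x : X) (j : Fin N) : Y :=
  hess22 (P.g j) x (P.yStar x) (P.zStar x) - grad2 (P.f j) x (P.yStar x)

/-- Local hypergradient at the reference point `(x, y⋆(x), z⋆(x))`. -/
def refH (x : X) (j : Fin N) : X :=
  grad1 (P.f j) x (P.yStar x) - hess12 (P.g j) x (P.yStar x) (P.zStar x)

variable {P R s} {L μ κ ε b₁ b₂ : ℝ}

lemma errY_nonneg : 0 ≤ errY P s := sq_nonneg _
lemma errZ_nonneg : 0 ≤ errZ P s := sq_nonneg _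
lemma errH_nonneg : 0 ≤ errH P s := sq_nonneg _

lemma mean_norm_pair_sub_sq (hN : 0 < N) (a : Fin N → X) (b : Fin N → Y) (x : X) (y : Y) :
    mean (fun j => ‖pair (a j) (b j) - pair x y‖ ^ 2)
      = spread a + ‖mean a - x‖ ^ 2 + (spread b + ‖mean b - y‖ ^ 2) := by
  simp_rw [norm_pair_sub_sq]
  rw [mean_add, mean_norm_sub_sq hN, mean_norm_sub_sq hN]

lemma mean_dist_reference (hN : 0 < N) :
    mean (fun j => ‖pair (s.x j) (s.y j) - pair (mean s.x) (P.yStar (mean s.x))‖ ^ 2)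
      = distSq P s := by
  rw [mean_norm_pair_sub_sq hN, sub_self, norm_zero, distSq, errY]
  ring

namespace Problem.Smooth

variable (hs : P.Smooth L L L L μ) (hN : 0 < N) (hL : 0 < L) (hμ : 0 < μ)
  (hκ : κ * μ = L) (hκ1 : 1 ≤ κ)

section Reference

variable [FiniteDimensional ℝ Y]
include hs hN hμ

/-- This is the equation defining `z⋆`. The local directions need not vanish, but their average
does, so dissimilarity does not disturb `z̄`. -/
lemma mean_refZ (x : X) : mean (refZ P x) = 0 := by
  have h := hs.hess22_zStar hN hμ x
  rw [hs.hess22_gAvg_apply, hs.grad2_fAvg] at h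
  unfold refZ
  rw [mean_sub, h, sub_self]

include hκ

lemma mean_refZ_sq_le (hd : P.Dissimilar b₁ b₂) (x : X) :
    mean (fun j => ‖refZ P x j‖ ^ 2) ≤ 2 * κ ^ 2 * b₂ ^ 2 + 2 * b₁ ^ 2 := by
  have h := hs.hess22_zStar hN hμ x
  have h1 : ∀ j, ‖refZ P x j‖ ^ 2 ≤
      2 * κ ^ 2 * ‖hess22 (P.g j) x (P.yStar x) - hess22 P.gAvg x (P.yStar x)‖ ^ 2
      + 2 * ‖grad2 (P.f j) x (P.yStar x) - grad2 P.fAvg x (P.yStar x)‖ ^ 2 := fun j => by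
    have h2 : refZ P x j = (hess22 (P.g j) x (P.yStar x) - hess22 P.gAvg x (P.yStar x)) (P.zStar x)
        - (grad2 (P.f j) x (P.yStar x) - grad2 P.fAvg x (P.yStar x)) := by
      rw [sub_apply, h, refZ]; abel
    rw [h2]
    refine (norm_sub_sq_le_two _ _).trans ?_
    have h3 := (ContinuousLinearMap.le_opNorm
      (hess22 (P.g j) x (P.yStar x) - hess22 P.gAvg x (P.yStar x)) (P.zStar x)).trans
      (mul_le_mul_of_nonneg_left (hs.norm_zStar_le hN hμ hκ x) (norm_nonneg _))
    have h4 := pow_le_pow_left₀ (norm_nonneg _) h3 2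
    rw [mul_pow] at h4
    linarith
  refine (mean_le_mean h1).trans ?_
  rw [mean_add, mean_mul_left, mean_mul_left]
  have h5 := hd.g22 x (P.yStar x)
  have h6 := hd.f2 x (P.yStar x)
  gcongr

include hL hκ1

lemma mean_refH (x : X) : mean (refH P x) = gradient P.Phi x := by
  rw [hs.gradient_Phi hN hL hμ hκ hκ1, hs.hess12_gAvg_apply, hs.grad1_fAvg]
  unfold refH
  rw [mean_sub]

lemma mean_refH_sub_sq_le (hd : P.Dissimilar b₁ b₂) (x : X) :
    mean (fun j => ‖refH P x j - gradient P.Phi x‖ ^ 2) ≤ 2 * κ ^ 2 * b₂ ^ 2 + 2 * b₁ ^ 2 := by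
  have h1 : ∀ j, ‖refH P x j - gradient P.Phi x‖ ^ 2 ≤
      2 * κ ^ 2 * ‖hess12 (P.g j) x (P.yStar x) - hess12 P.gAvg x (P.yStar x)‖ ^ 2
      + 2 * ‖grad1 (P.f j) x (P.yStar x) - grad1 P.fAvg x (P.yStar x)‖ ^ 2 := fun j => by
    have h2 : refH P x j - gradient P.Phi x
        = (grad1 (P.f j) x (P.yStar x) - grad1 P.fAvg x (P.yStar x))
        - (hess12 (P.g j) x (P.yStar x) - hess12 P.gAvg x (P.yStar x)) (P.zStar x) := by
      rw [sub_apply, hs.gradient_Phi hN hL hμ hκ hκ1, refH]; abel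
    rw [h2]
    refine (norm_sub_sq_le_two _ _).trans ?_
    have h3 := (ContinuousLinearMap.le_opNorm
      (hess12 (P.g j) x (P.yStar x) - hess12 P.gAvg x (P.yStar x)) (P.zStar x)).trans
      (mul_le_mul_of_nonneg_left (hs.norm_zStar_le hN hμ hκ x) (norm_nonneg _))
    have h4 := pow_le_pow_left₀ (norm_nonneg _) h3 2
    rw [mul_pow] at h4
    linarith
  refine (mean_le_mean h1).trans ?_
  rw [mean_add, mean_mul_left, mean_mul_left]
  have h5 := hd.g12 x (P.yStar x)
  have h6 := hd.f1 x (P.yStar x)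
  gcongr

end Reference

section Residual

variable [FiniteDimensional ℝ Y] (hR : RuleError P R s ε)
include hs hN hL hμ hκ hκ1 hR

/-- Deviation of the `z` directions from their affine model at the reference point. -/
lemma mean_dirZ_residual_le :
    mean (fun j => ‖dirZ P R s j - hess22 (P.g j) (s.x j) (s.y j)
        (mean s.z - P.zStar (mean s.x)) - refZ P (mean s.x) j‖ ^ 2)
      ≤ 3 * ε ^ 2 + 3 * L ^ 2 * spread s.z + 12 * L ^ 2 * κ ^ 2 * distSq P s := by
  set x := mean s.x
  set ys := P.yStar x
  set zs := P.zStar x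
  have h1 : ∀ j, ‖dirZ P R s j - hess22 (P.g j) (s.x j) (s.y j) (mean s.z - zs) - refZ P x j‖ ^ 2
      ≤ 3 * ε ^ 2 + 3 * L ^ 2 * ‖s.z j - mean s.z‖ ^ 2
        + 12 * L ^ 2 * κ ^ 2 * ‖pair (s.x j) (s.y j) - pair x ys‖ ^ 2 := fun j => by
    set d := ‖pair (s.x j) (s.y j) - pair x ys‖
    have hd0 : 0 ≤ d := norm_nonneg _
    -- The Hessian acting on `z̄ - z⋆` stays at the local point: coercivity holds at every point, so
    -- this term yields the contraction without any linearisation error.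
    have e1 : dirZ P R s j - hess22 (P.g j) (s.x j) (s.y j) (mean s.z - zs) - refZ P x j
        = ((R.pH (P.g j) (s.x j) (s.y j) (s.z j) - hess22 (P.g j) (s.x j) (s.y j) (s.z j))
          + hess22 (P.g j) (s.x j) (s.y j) (s.z j - mean s.z))
          + ((hess22 (P.g j) (s.x j) (s.y j) - hess22 (P.g j) x ys) zs
          - (grad2 (P.f j) (s.x j) (s.y j) - grad2 (P.f j) x ys)) := by
      simp only [dirZ, refZ, map_sub, sub_apply]
      abel
    have b1 := (hR j).1
    have b2 : ‖hess22 (P.g j) (s.x j) (s.y j) (s.z j - mean s.z)‖ ≤ L * ‖s.z j - mean s.z‖ :=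
      (ContinuousLinearMap.le_opNorm _ _).trans
        (by gcongr; exact hs.norm_hess22_g_le hL.le j _ _)
    have b3 : ‖(hess22 (P.g j) (s.x j) (s.y j) - hess22 (P.g j) x ys) zs‖ ≤ L * d * κ :=
      (ContinuousLinearMap.le_opNorm _ _).trans (by
        gcongr
        · exact hs.hess22_g_lip j _ _ _ _
        · exact hs.norm_zStar_le hN hμ hκ x)
    have b4 := hs.grad2_f_lip j (s.x j) x (s.y j) ys
    change _ ≤ L * d at b4
    have b5 : ‖dirZ P R s j - hess22 (P.g j) (s.x j) (s.y j) (mean s.z - zs) - refZ P x j‖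
        ≤ ε + L * ‖s.z j - mean s.z‖ + 2 * L * κ * d := by
      rw [e1]
      refine (norm_add_le _ _).trans ?_
      have c1 := (norm_add_le _ _).trans (add_le_add b1 b2)
      have c2 := (norm_sub_le _ _).trans (add_le_add b3 b4)
      have c3 : 0 ≤ L * d * (κ - 1) := mul_nonneg (by positivity) (by linarith)
      linarith
    have b6 := pow_le_pow_left₀ (norm_nonneg _) b5 2
    have b7 : ∀ a b c : ℝ, (a + b + c) ^ 2 ≤ 3 * a ^ 2 + 3 * b ^ 2 + 3 * c ^ 2 := fun a b c => by
      nlinarith [sq_nonneg (a - b), sq_nonneg (a - c), sq_nonneg (b - c)]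
    have b8 := b6.trans (b7 _ _ _)
    linarith
  refine (mean_le_mean h1).trans (le_of_eq ?_)
  rw [mean_add, mean_add, mean_const hN, mean_mul_left, mean_mul_left, ← mean_dist_reference hN,
    spread]

/-- Deviation of the local hypergradient estimates from the local hypergradients at the reference
point. -/
lemma mean_dirH_residual_le :
    mean (fun j => ‖dirH P R s j - refH P (mean s.x) j‖ ^ 2)
      ≤ 4 * ε ^ 2 + 4 * L ^ 2 * spread s.z + 4 * L ^ 2 * errZ P s
        + 16 * L ^ 2 * κ ^ 2 * distSq P s := by
  set x := mean s.x
  set ys := P.yStar x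
  set zs := P.zStar x
  have h1 : ∀ j, ‖dirH P R s j - refH P x j‖ ^ 2
      ≤ 4 * ε ^ 2 + 4 * L ^ 2 * ‖s.z j - mean s.z‖ ^ 2 + 4 * L ^ 2 * ‖mean s.z - zs‖ ^ 2
        + 16 * L ^ 2 * κ ^ 2 * ‖pair (s.x j) (s.y j) - pair x ys‖ ^ 2 := fun j => by
    set d := ‖pair (s.x j) (s.y j) - pair x ys‖
    have hd0 : 0 ≤ d := norm_nonneg _
    have e1 : dirH P R s j - refH P x j
        = (grad1 (P.f j) (s.x j) (s.y j) - grad1 (P.f j) x ys)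
          - (hess12 (P.g j) (s.x j) (s.y j) - hess12 (P.g j) x ys) zs
          - hess12 (P.g j) (s.x j) (s.y j) (s.z j - mean s.z)
          - hess12 (P.g j) (s.x j) (s.y j) (mean s.z - zs)
          - (R.pJ (P.g j) (s.x j) (s.y j) (s.z j) - hess12 (P.g j) (s.x j) (s.y j) (s.z j)) := by
      simp only [dirH, refH, map_sub, sub_apply]
      abel
    have b1 := (hR j).2
    have b2 : ∀ w, ‖hess12 (P.g j) (s.x j) (s.y j) w‖ ≤ L * ‖w‖ := fun w =>
      (ContinuousLinearMap.le_opNorm _ _).trans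
        (by gcongr; exact hs.norm_hess12_g_le hL.le j _ _)
    have b3 : ‖(hess12 (P.g j) (s.x j) (s.y j) - hess12 (P.g j) x ys) zs‖ ≤ L * d * κ :=
      (ContinuousLinearMap.le_opNorm _ _).trans (by
        gcongr
        · exact hs.hess12_g_lip j _ _ _ _
        · exact hs.norm_zStar_le hN hμ hκ x)
    have b4 := hs.grad1_f_lip j (s.x j) x (s.y j) ys
    change _ ≤ L * d at b4
    have b5 : ‖dirH P R s j - refH P x j‖
        ≤ ε + L * ‖s.z j - mean s.z‖ + L * ‖mean s.z - zs‖ + 2 * L * κ * d := by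
      rw [e1]
      have c1 := (norm_sub_le _ _).trans (add_le_add b4 b3)
      have c2 := (norm_sub_le _ _).trans (add_le_add c1 (b2 (s.z j - mean s.z)))
      have c3 := (norm_sub_le _ _).trans (add_le_add c2 (b2 (mean s.z - zs)))
      have c4 := (norm_sub_le _ _).trans (add_le_add c3 b1)
      have c5 : 0 ≤ L * d * (κ - 1) := mul_nonneg (by positivity) (by linarith)
      linarith
    have b6 := pow_le_pow_left₀ (norm_nonneg _) b5 2
    have b7 : ∀ a b c e : ℝ, (a + b + c + e) ^ 2
        ≤ 4 * a ^ 2 + 4 * b ^ 2 + 4 * c ^ 2 + 4 * e ^ 2 := fun a b c e => by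
      nlinarith [sq_nonneg (a - b), sq_nonneg (a - c), sq_nonneg (b - c), sq_nonneg (a - e),
        sq_nonneg (b - e), sq_nonneg (c - e)]
    have b8 := b6.trans (b7 _ _ _ _)
    linarith
  refine (mean_le_mean h1).trans (le_of_eq ?_)
  rw [mean_add, mean_add, mean_add, mean_const hN, mean_const hN, mean_mul_left, mean_mul_left,
    ← mean_dist_reference hN, spread, errZ]

/-- Second moments about `0` suffice. Each direction splits into the residual, a term of size `L‖z̄
- z⋆‖`, and the reference value, where dissimilarity enters. -/
lemma spread_dirZ_le (hd : P.Dissimilar b₁ b₂) :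
    spread (dirZ P R s) ≤ 3 * (3 * ε ^ 2 + 3 * L ^ 2 * spread s.z + 12 * L ^ 2 * κ ^ 2 * distSq P s)
      + 3 * L ^ 2 * errZ P s + 6 * κ ^ 2 * b₂ ^ 2 + 6 * b₁ ^ 2 := by
  refine (spread_le hN _ 0).trans ?_
  simp only [sub_zero]
  have h1 : ∀ j, ‖dirZ P R s j‖ ^ 2 ≤ (3 * ‖dirZ P R s j - hess22 (P.g j) (s.x j) (s.y j)
        (mean s.z - P.zStar (mean s.x)) - refZ P (mean s.x) j‖ ^ 2 + 3 * L ^ 2 * errZ P s)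
        + 3 * ‖refZ P (mean s.x) j‖ ^ 2 := fun j => by
    set w := hess22 (P.g j) (s.x j) (s.y j) (mean s.z - P.zStar (mean s.x))
    set r := refZ P (mean s.x) j
    have h2 : ‖w‖ ≤ L * ‖mean s.z - P.zStar (mean s.x)‖ :=
      (ContinuousLinearMap.le_opNorm _ _).trans
        (by gcongr; exact hs.norm_hess22_g_le hL.le j _ _)
    have h3 := pow_le_pow_left₀ (norm_nonneg _) h2 2
    have h4 : ‖dirZ P R s j‖ ≤ ‖dirZ P R s j - w - r‖ + ‖w‖ + ‖r‖ := by
      have : dirZ P R s j = (dirZ P R s j - w - r) + w + r := by abel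
      calc ‖dirZ P R s j‖ = ‖(dirZ P R s j - w - r) + w + r‖ := by rw [← this]
        _ ≤ _ := norm_add₃_le
    have h5 := pow_le_pow_left₀ (norm_nonneg _) h4 2
    have b7 : ∀ a b c : ℝ, (a + b + c) ^ 2 ≤ 3 * a ^ 2 + 3 * b ^ 2 + 3 * c ^ 2 := fun a b c => by
      nlinarith [sq_nonneg (a - b), sq_nonneg (a - c), sq_nonneg (b - c)]
    have h6 := h5.trans (b7 _ _ _)
    rw [mul_pow] at h3
    unfold errZ
    linarith
  refine (mean_le_mean h1).trans ?_
  rw [mean_add, mean_add, mean_const hN, mean_mul_left, mean_mul_left]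
  have h3 := hs.mean_dirZ_residual_le hN hL hμ hκ hκ1 hR
  have h4 := hs.mean_refZ_sq_le hN hμ hκ hd (mean s.x)
  linarith

lemma spread_dirH_le (hd : P.Dissimilar b₁ b₂) :
    spread (dirH P R s) ≤ 2 * (4 * ε ^ 2 + 4 * L ^ 2 * spread s.z + 4 * L ^ 2 * errZ P s
        + 16 * L ^ 2 * κ ^ 2 * distSq P s) + 4 * κ ^ 2 * b₂ ^ 2 + 4 * b₁ ^ 2 := by
  refine (spread_le hN _ (gradient P.Phi (mean s.x))).trans ?_
  have h1 : ∀ j, ‖dirH P R s j - gradient P.Phi (mean s.x)‖ ^ 2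
      ≤ 2 * ‖dirH P R s j - refH P (mean s.x) j‖ ^ 2
        + 2 * ‖refH P (mean s.x) j - gradient P.Phi (mean s.x)‖ ^ 2 := fun j => by
    have := norm_add_sq_le_two (dirH P R s j - refH P (mean s.x) j)
      (refH P (mean s.x) j - gradient P.Phi (mean s.x))
    rwa [sub_add_sub_cancel] at this
  refine (mean_le_mean h1).trans ?_
  rw [mean_add, mean_mul_left, mean_mul_left]
  have h3 := hs.mean_dirH_residual_le hN hL hμ hκ hκ1 hR
  have h4 := hs.mean_refH_sub_sq_le hN hL hμ hκ hκ1 hd (mean s.x)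
  linarith

end Residual

section LowerLevel

include hs hN hL

lemma mean_grad2_g_residual_le :
    mean (fun j => ‖grad2 (P.g j) (s.x j) (s.y j) - grad2 (P.g j) (mean s.x) (mean s.y)‖ ^ 2)
      ≤ L ^ 2 * (spread s.x + spread s.y) := by
  have h1 : ∀ j, ‖grad2 (P.g j) (s.x j) (s.y j) - grad2 (P.g j) (mean s.x) (mean s.y)‖ ^ 2
      ≤ L ^ 2 * ‖pair (s.x j) (s.y j) - pair (mean s.x) (mean s.y)‖ ^ 2 := fun j => by
    rw [← mul_pow]
    exact pow_le_pow_left₀ (norm_nonneg _) (hs.grad2_g_lip j _ _ _ _) 2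
  refine (mean_le_mean h1).trans (le_of_eq ?_)
  rw [mean_mul_left, mean_norm_pair_sub_sq hN, sub_self, sub_self, norm_zero, norm_zero]
  ring

/-- The comparison point is `(x̄, ȳ)` rather than `(x̄, y⋆)`, which keeps the lower-level error out
of the consensus recursion for `y`. -/
lemma spread_grad2_g_le (hd : P.Dissimilar b₁ b₂) :
    spread (fun j => grad2 (P.g j) (s.x j) (s.y j))
      ≤ 2 * L ^ 2 * (spread s.x + spread s.y) + 2 * b₂ ^ 2 := by
  refine (spread_le hN _ (grad2 P.gAvg (mean s.x) (mean s.y))).trans ?_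
  have h1 : ∀ j, ‖grad2 (P.g j) (s.x j) (s.y j) - grad2 P.gAvg (mean s.x) (mean s.y)‖ ^ 2
      ≤ 2 * ‖grad2 (P.g j) (s.x j) (s.y j) - grad2 (P.g j) (mean s.x) (mean s.y)‖ ^ 2
        + 2 * ‖grad2 (P.g j) (mean s.x) (mean s.y)
          - grad2 P.gAvg (mean s.x) (mean s.y)‖ ^ 2 := fun j => by
    have := norm_add_sq_le_two
      (grad2 (P.g j) (s.x j) (s.y j) - grad2 (P.g j) (mean s.x) (mean s.y))
      (grad2 (P.g j) (mean s.x) (mean s.y) - grad2 P.gAvg (mean s.x) (mean s.y))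
    rwa [sub_add_sub_cancel] at this
  refine (mean_le_mean h1).trans ?_
  rw [mean_add, mean_mul_left, mean_mul_left]
  have h3 := hs.mean_grad2_g_residual_le hN hL (s := s)
  have h4 := hd.g2 (mean s.x) (mean s.y)
  linarith

end LowerLevel

end Problem.Smooth

/-! ### One-step recursions for consensus, tracking errors and the objective. -/

section Step

variable {W : Matrix (Fin N) (Fin N) ℝ} {τ α ρ : ℝ}

/-- One noiseless iteration with equal step sizes. -/
def detStep (P : Problem N X Y Ξ Z) (W : Matrix (Fin N) (Fin N) ℝ) (τ α : ℝ)
    (R : ProductRule X Y) (s : State N X Y) : State N X Y :=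
  step W τ α α α α R P.f P.g s

lemma mean_detStep_x (hW : IsMixing W) :
    mean (detStep P W τ α R s).x = mean s.x - (τ * α) • mean s.h := by
  have := hW.mean_mix fun j => s.x j - (τ * α) • s.h j
  rwa [mean_sub, mean_smul] at this

lemma mean_detStep_y (hW : IsMixing W) :
    mean (detStep P W τ α R s).y
      = mean s.y - α • mean fun j => grad2 (P.g j) (s.x j) (s.y j) := by
  have := hW.mean_mix fun j => s.y j - α • grad2 (P.g j) (s.x j) (s.y j)
  rwa [mean_sub, mean_smul] at this

lemma mean_detStep_z (hW : IsMixing W) :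
    mean (detStep P W τ α R s).z = mean s.z - α • mean (dirZ P R s) := by
  have := hW.mean_mix fun j => s.z j - α • dirZ P R s j
  rwa [mean_sub, mean_smul] at this

lemma mean_detStep_h :
    mean (detStep P W τ α R s).h = (1 - α) • mean s.h + α • mean (dirH P R s) := by
  have := mean_add (fun j => (1 - α) • s.h j) (fun j => α • dirH P R s j)
  rwa [mean_smul, mean_smul] at this

section Consensus

variable [FiniteDimensional ℝ X] [FiniteDimensional ℝ Y]
  (hN : 0 < N) (hW : IsMixing W) (hρ : mixingRate W = ρ) (hρ1 : ρ < 1)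

include hN hW hρ hρ1

lemma spread_detStep_x_le : spread (detStep P W τ α R s).x
    ≤ ρ * spread s.x + ρ ^ 2 / (1 - ρ) * (τ * α) ^ 2 * spread s.h :=
  hW.spread_mix_sub_smul_le hN hρ hρ1 _ _ _

lemma spread_detStep_y_le : spread (detStep P W τ α R s).y
    ≤ ρ * spread s.y
      + ρ ^ 2 / (1 - ρ) * α ^ 2 * spread fun j => grad2 (P.g j) (s.x j) (s.y j) :=
  hW.spread_mix_sub_smul_le hN hρ hρ1 _ _ _

lemma spread_detStep_z_le : spread (detStep P W τ α R s).z
    ≤ ρ * spread s.z + ρ ^ 2 / (1 - ρ) * α ^ 2 * spread (dirZ P R s) :=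
  hW.spread_mix_sub_smul_le hN hρ hρ1 _ _ _

end Consensus

lemma spread_detStep_h_le (h0 : 0 ≤ α) (h1 : α ≤ 1) : spread (detStep P W τ α R s).h
    ≤ (1 - α) * spread s.h + α * spread (dirH P R s) :=
  spread_convex_le h0 h1 _ _

namespace Problem.Smooth

variable (hs : P.Smooth L L L L μ) (hN : 0 < N) (hL : 0 < L) (hμ : 0 < μ)
  (hκ : κ * μ = L) (hκ1 : 1 ≤ κ) (hW : IsMixing W) (hα : 0 < α) (hαL : α * L ^ 2 ≤ μ)

include hs hN hL hμ hκ hκ1 hW hα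

section Contraction

include hαL

omit hs hN hW in
lemma step_mul_le_one : α * μ ≤ 1 := by
  have h1 : μ ≤ L := by rw [← hκ]; nlinarith
  have h2 : α * μ ^ 2 ≤ μ := le_trans (by gcongr) hαL
  nlinarith

/-- An exact gradient step on `g(x̄, ·)` contracts, as `α L² ≤ μ` gives `1 - 2αμ + α²L² ≤ 1 - αμ`.
The perturbations are the consensus residual of the averaged gradient and the drift of `y⋆`. -/
lemma errY_detStep_le : errY P (detStep P W τ α R s) ≤ (1 - α * μ / 2) * errY P s
    + 3 / (α * μ) * (2 * α ^ 2 * L ^ 2 * (spread s.x + spread s.y)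
      + 2 * κ ^ 2 * (τ * α) ^ 2 * ‖mean s.h‖ ^ 2) := by
  unfold errY
  rw [mean_detStep_y hW, mean_detStep_x hW]
  set x := mean s.x
  set y := mean s.y
  set x' := x - (τ * α) • mean s.h
  set e := y - P.yStar x
  set a := grad2 P.gAvg x y - grad2 P.gAvg x (P.yStar x)
  set m := mean fun j => grad2 (P.g j) (s.x j) (s.y j)
  have e1 : y - α • m - P.yStar x'
      = (e - α • a) + (α • (grad2 P.gAvg x y - m) + (P.yStar x - P.yStar x')) := by
    simp only [a, e, hs.grad2_gAvg_yStar hN hL hμ]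
    module
  have h1 : ‖e - α • a‖ ^ 2 ≤ (1 - α * μ) * ‖e‖ ^ 2 := by
    have hl := hs.grad2_gAvg_lip hN x x y (P.yStar x)
    rw [norm_pair_sub_left] at hl
    refine (norm_sub_smul_sq_le hα.le (hs.strong_monotone_gAvg hN x y (P.yStar x)) hl).trans ?_
    gcongr
    nlinarith
  rw [e1]
  refine (norm_add_sq_le_of_contraction (mul_pos hα hμ)
    (step_mul_le_one hL hμ hκ hκ1 hα hαL) h1 (sq_nonneg _)).trans ?_
  gcongr
  refine (norm_add_sq_le_two _ _).trans ?_
  have h2 : ‖grad2 P.gAvg x y - m‖ ^ 2 ≤ L ^ 2 * (spread s.x + spread s.y) := by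
    rw [hs.grad2_gAvg, norm_sub_rev, ← mean_sub]
    exact (norm_mean_sq_le hN _).trans (hs.mean_grad2_g_residual_le hN hL)
  have h3 : ‖P.yStar x - P.yStar x'‖ ^ 2 ≤ (κ * ‖(τ * α) • mean s.h‖) ^ 2 := by
    refine pow_le_pow_left₀ (norm_nonneg _) ?_ 2
    simpa [x'] using hs.yStar_lip hN hL hμ hκ x x'
  rw [mul_pow, norm_smul, mul_pow, Real.norm_eq_abs, sq_abs] at h3
  rw [norm_smul, mul_pow, Real.norm_eq_abs, sq_abs]
  nlinarith [mul_le_mul_of_nonneg_left h2 (sq_nonneg α)]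

variable [FiniteDimensional ℝ Y]

lemma errZ_detStep_le (hR : RuleError P R s ε) :
    errZ P (detStep P W τ α R s) ≤ (1 - α * μ / 2) * errZ P s
    + 3 / (α * μ) * (2 * α ^ 2 * (3 * ε ^ 2 + 3 * L ^ 2 * spread s.z
        + 12 * L ^ 2 * κ ^ 2 * distSq P s)
      + 32 * κ ^ 6 * (τ * α) ^ 2 * ‖mean s.h‖ ^ 2) := by
  unfold errZ
  rw [mean_detStep_z hW, mean_detStep_x hW]
  have hκ0 : 0 < κ := by linarith
  have hres := hs.mean_dirZ_residual_le hN hL hμ hκ hκ1 hR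
  set x := mean s.x
  set x' := x - (τ * α) • mean s.h
  set e := mean s.z - P.zStar x
  set A : Fin N → Y := fun j => hess22 (P.g j) (s.x j) (s.y j) e
  have e0 : mean (fun j => dirZ P R s j - A j - refZ P x j) = mean (dirZ P R s) - mean A := by
    rw [mean_sub, mean_sub, hs.mean_refZ hN hμ, sub_zero]
  have e1 : mean s.z - α • mean (dirZ P R s) - P.zStar x'
      = (e - α • mean A) + (α • -(mean (dirZ P R s) - mean A) + (P.zStar x - P.zStar x')) := by
    simp only [e]
    module
  have h1 : ‖e - α • mean A‖ ^ 2 ≤ (1 - α * μ) * ‖e‖ ^ 2 := by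
    -- The Hessians are taken at different local points, but coercivity with the same `μ` survives
    -- averaging.
    have hin : μ * ‖e‖ ^ 2 ≤ inner ℝ (mean A) e := by
      rw [inner_mean, ← mean_const hN (μ * ‖e‖ ^ 2)]
      exact mean_le_mean fun j => hs.le_inner_hess22_g j _ _ e
    have hl : ‖mean A‖ ≤ L * ‖e‖ := norm_mean_le hN _ fun j =>
      (ContinuousLinearMap.le_opNorm _ _).trans
        (by gcongr; exact hs.norm_hess22_g_le hL.le j _ _)
    refine (norm_sub_smul_sq_le hα.le hin hl).trans ?_
    gcongr
    nlinarith
  rw [e1]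
  refine (norm_add_sq_le_of_contraction (mul_pos hα hμ)
    (step_mul_le_one hL hμ hκ hκ1 hα hαL) h1 (sq_nonneg _)).trans ?_
  gcongr
  refine (norm_add_sq_le_two _ _).trans ?_
  have h2 : ‖-(mean (dirZ P R s) - mean A)‖ ^ 2 ≤ 3 * ε ^ 2 + 3 * L ^ 2 * spread s.z
        + 12 * L ^ 2 * κ ^ 2 * distSq P s := by
    rw [norm_neg, ← e0]
    exact (norm_mean_sq_le hN _).trans hres
  have h3 : ‖P.zStar x - P.zStar x'‖ ^ 2 ≤ (4 * κ ^ 3) ^ 2 * ((τ * α) ^ 2 * ‖mean s.h‖ ^ 2) := by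
    rw [← sq_abs (τ * α), ← mul_pow _ ‖mean s.h‖, ← mul_pow, ← Real.norm_eq_abs, ← norm_smul]
    refine pow_le_pow_left₀ (norm_nonneg _) ?_ 2
    simpa [x'] using hs.zStar_lip hN hL hμ hκ hκ1 x x'
  rw [norm_smul, mul_pow, Real.norm_eq_abs, sq_abs]
  nlinarith [mul_le_mul_of_nonneg_left h2 (sq_nonneg α)]

end Contraction

variable [FiniteDimensional ℝ Y]

/-- The moving average contracts by itself, as `(1 - α)² ≤ 1 - α`; its rate involves `α` but not
`μ`, so no power of `κ` is lost. The drift uses the Lipschitz constant of `∇Φ`. -/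
lemma errH_detStep_le (hα1 : α ≤ 1) (hR : RuleError P R s ε) :
    errH P (detStep P W τ α R s) ≤ (1 - α / 2) * errH P s
    + 3 / α * (2 * α ^ 2 * (4 * ε ^ 2 + 4 * L ^ 2 * spread s.z + 4 * L ^ 2 * errZ P s
        + 16 * L ^ 2 * κ ^ 2 * distSq P s)
      + 128 * L ^ 2 * κ ^ 6 * (τ * α) ^ 2 * ‖mean s.h‖ ^ 2) := by
  have hκ0 : 0 < κ := by linarith
  have hres := hs.mean_dirH_residual_le hN hL hμ hκ hκ1 hR
  unfold errH
  rw [mean_detStep_h, mean_detStep_x hW]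
  set x := mean s.x
  set x' := x - (τ * α) • mean s.h
  set e := mean s.h - gradient P.Phi x
  have e0 : mean (fun j => dirH P R s j - refH P x j) = mean (dirH P R s) - gradient P.Phi x := by
    rw [mean_sub, hs.mean_refH hN hL hμ hκ hκ1]
  have e1 : (1 - α) • mean s.h + α • mean (dirH P R s) - gradient P.Phi x'
      = (1 - α) • e + (α • (mean (dirH P R s) - gradient P.Phi x)
        + (gradient P.Phi x - gradient P.Phi x')) := by
    simp only [e]
    module
  have h1 : ‖(1 - α) • e‖ ^ 2 ≤ (1 - α) * ‖e‖ ^ 2 := by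
    rw [norm_smul, mul_pow, Real.norm_eq_abs, sq_abs]
    gcongr
    nlinarith
  rw [e1]
  refine (norm_add_sq_le_of_contraction hα hα1 h1 (sq_nonneg _)).trans ?_
  gcongr
  refine (norm_add_sq_le_two _ _).trans ?_
  have h2 : ‖mean (dirH P R s) - gradient P.Phi x‖ ^ 2 ≤ 4 * ε ^ 2 + 4 * L ^ 2 * spread s.z
      + 4 * L ^ 2 * errZ P s + 16 * L ^ 2 * κ ^ 2 * distSq P s := by
    rw [← e0]
    exact (norm_mean_sq_le hN _).trans hres
  have h3 : ‖gradient P.Phi x - gradient P.Phi x'‖ ^ 2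
      ≤ (8 * L * κ ^ 3) ^ 2 * ((τ * α) ^ 2 * ‖mean s.h‖ ^ 2) := by
    rw [← sq_abs (τ * α), ← mul_pow _ ‖mean s.h‖, ← mul_pow, ← Real.norm_eq_abs, ← norm_smul]
    refine pow_le_pow_left₀ (norm_nonneg _) ?_ 2
    simpa [x'] using hs.gradient_Phi_lip hN hL hμ hκ hκ1 x x'
  rw [norm_smul, mul_pow, Real.norm_eq_abs, sq_abs]
  nlinarith [mul_le_mul_of_nonneg_left h2 (sq_nonneg α)]

/-- Polarisation of the inner product gives `-½‖∇Φ‖² - ½‖h̄‖² + ½‖h̄ - ∇Φ‖²`, times `τα`; the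
step-size bound keeps the quadratic remainder below `¼ τα‖h̄‖²`. The surviving `-¼‖h̄‖²` pays for
the drifts. -/
lemma Phi_detStep_le (hτ : 0 < τ) (hτα : 32 * L * κ ^ 3 * (τ * α) ≤ 1) :
    P.Phi (mean (detStep P W τ α R s).x) ≤ P.Phi (mean s.x)
      - τ * α / 2 * ‖gradient P.Phi (mean s.x)‖ ^ 2 - τ * α / 4 * ‖mean s.h‖ ^ 2
      + τ * α / 2 * errH P s := by
  rw [mean_detStep_x hW, sub_eq_add_neg]
  have hκ0 : 0 < κ := by linarith
  have h1 := descent (hs.differentiable_Phi hN hL hμ hκ hκ1) (by positivity)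
    (hs.gradient_Phi_lip hN hL hμ hκ hκ1) (mean s.x) (-((τ * α) • mean s.h))
  refine h1.trans ?_
  have h2 := norm_sub_sq_real (mean s.h) (gradient P.Phi (mean s.x))
  rw [inner_neg_right, inner_smul_right, norm_neg, norm_smul, mul_pow, Real.norm_eq_abs, sq_abs]
  unfold errH
  rw [h2, real_inner_comm]
  have h3 : 0 ≤ τ * α * ‖mean s.h‖ ^ 2 := by positivity
  nlinarith [mul_le_mul_of_nonneg_right hτα h3]

end Problem.Smooth

end Step

end Recursion

/-! ### Elimination in the system of summed recursions. -/

section Sums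

lemma mul_sum_le_of_contraction {T : ℕ} {c : ℝ} {a b : ℕ → ℝ} (ha : 0 ≤ a T)
    (h : ∀ t < T, a (t + 1) ≤ (1 - c) * a t + b t) :
    c * ∑ t ∈ Finset.range T, a t ≤ a 0 + ∑ t ∈ Finset.range T, b t := by
  have key : ∀ n ≤ T, a n + c * ∑ t ∈ Finset.range n, a t ≤ a 0 + ∑ t ∈ Finset.range n, b t := by
    intro n
    induction n with
    | zero => intro _; simp
    | succ n ih =>
      intro hn
      have h1 := ih (by omega)
      have h2 := h n (by omega)
      rw [Finset.sum_range_succ, Finset.sum_range_succ]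
      linarith
  linarith [key T le_rfl]

lemma pow_mul_le_pow_mul {κ w : ℝ} (hκ : 1 ≤ κ) {m n : ℕ} (hmn : m ≤ n) (hw : 0 ≤ w) :
    κ ^ m * w ≤ κ ^ n * w :=
  mul_le_mul_of_nonneg_right (pow_le_pow_right₀ hκ hmn) hw

/-- Elimination of the tracking errors from the summed recursions. -/
lemma sum_tracking_le {κ K c τ d e V Sz Sey Sez Seh SG B : ℝ}
    (hκ : 1 ≤ κ) (hK : 1 ≤ K) (hc : c = 1 / (24 * K ^ 3)) (hτ : τ * κ ^ 4 = c)
    (hd : 0 ≤ d) (he : 0 ≤ e) (hV : 0 ≤ V) (hSz : 0 ≤ Sz) (hSey : 0 ≤ Sey)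
    (hSG : 0 ≤ SG) (hB : 0 ≤ B)
    (h5 : Sey ≤ K * (κ * d + κ ^ 2 * V + κ ^ 4 * τ ^ 2 * B))
    (h6 : Sez ≤ K * (κ * d + κ ^ 2 * (κ ^ 2 * (V + Sey) + Sz + e) + κ ^ 8 * τ ^ 2 * B))
    (h7 : Seh ≤ K * (d + Sez + κ ^ 2 * (V + Sey) + Sz + e + κ ^ 6 * τ ^ 2 * B))
    (h8 : B + 2 * SG ≤ 96 * K ^ 3 * κ ^ 4 * d + 2 * Seh) :
    κ ^ 4 * Sey ≤ 2 * K * (κ ^ 5 * d + κ ^ 2 * e + (κ ^ 6 * V + κ ^ 2 * Sz)) ∧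
    Sez ≤ 4 * K ^ 2 * (κ ^ 5 * d + κ ^ 2 * e + (κ ^ 6 * V + κ ^ 2 * Sz)) ∧
    SG ≤ 52 * K ^ 3 * (κ ^ 5 * d + κ ^ 2 * e + (κ ^ 6 * V + κ ^ 2 * Sz)) := by
  have hκ0 : 0 < κ := by linarith
  have hK0 : 0 < K := by linarith
  have hc0 : 0 < c := by rw [hc]; positivity
  have hK2 : K ≤ K ^ 2 := by nlinarith
  have hK3 : 1 ≤ K ^ 3 := one_le_pow₀ hK
  have hcK : c * K ^ 3 = 1 / 24 := by rw [hc]; field_simp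
  have hc1 : c ≤ 1 / 24 := by
    rw [← hcK]; exact le_mul_of_one_le_right hc0.le hK3
  have hc8 : κ ^ 8 * τ ^ 2 = c ^ 2 := by rw [← hτ]; ring
  have hτB : 0 ≤ τ ^ 2 * B := by positivity
  obtain ⟨M, hM⟩ : ∃ M, M = κ ^ 5 * d + κ ^ 2 * e := ⟨_, rfl⟩
  obtain ⟨Q, hQ⟩ : ∃ Q, Q = κ ^ 6 * V + κ ^ 2 * Sz := ⟨_, rfl⟩
  rw [← hM, ← hQ]
  have hM0 : 0 ≤ M := by rw [hM]; positivity
  have hQ0 : 0 ≤ Q := by rw [hQ]; positivity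
  -- All tracking sums are bounded by this one quantity: `Q` carries the weighted spreads, and `τκ⁴
  -- = c` reduces the drift to `c²B`.
  obtain ⟨S, hS⟩ : ∃ S, S = M + Q + c ^ 2 * B := ⟨_, rfl⟩
  have hS0 : 0 ≤ S := by rw [hS]; positivity
  have p1 : κ * d ≤ κ ^ 5 * d := by simpa using pow_mul_le_pow_mul hκ (by norm_num : 1 ≤ 5) hd
  have p0 : d ≤ κ ^ 5 * d := by simpa using pow_mul_le_pow_mul hκ (by norm_num : 0 ≤ 5) hd
  have p4 : κ ^ 4 * d ≤ κ ^ 5 * d := pow_mul_le_pow_mul hκ (by norm_num) hd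
  have pe : e ≤ κ ^ 2 * e := by simpa using pow_mul_le_pow_mul hκ (by norm_num : 0 ≤ 2) he
  have pz : Sz ≤ κ ^ 2 * Sz := by simpa using pow_mul_le_pow_mul hκ (by norm_num : 0 ≤ 2) hSz
  have pV : κ ^ 2 * V ≤ κ ^ 6 * V := pow_mul_le_pow_mul hκ (by norm_num) hV
  have pV4 : κ ^ 4 * V ≤ κ ^ 6 * V := pow_mul_le_pow_mul hκ (by norm_num) hV
  have py : κ ^ 2 * Sey ≤ κ ^ 4 * Sey := pow_mul_le_pow_mul hκ (by norm_num) hSey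
  have pτ : κ ^ 6 * (τ ^ 2 * B) ≤ κ ^ 8 * (τ ^ 2 * B) := pow_mul_le_pow_mul hκ (by norm_num) hτB
  have pVn : 0 ≤ κ ^ 6 * V := by positivity
  have pzn : 0 ≤ κ ^ 2 * Sz := by positivity
  have pdn : 0 ≤ κ ^ 5 * d := by positivity
  have pen : 0 ≤ κ ^ 2 * e := by positivity
  have pBn : 0 ≤ c ^ 2 * B := by positivity
  have pB : κ ^ 8 * (τ ^ 2 * B) = c ^ 2 * B := by rw [← hc8]; ring
  have q5 : κ ^ 4 * Sey ≤ K * S := by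
    have h := mul_le_mul_of_nonneg_left h5 (by positivity : 0 ≤ κ ^ 4)
    have h' : κ ^ 4 * (K * (κ * d + κ ^ 2 * V + κ ^ 4 * τ ^ 2 * B))
        = K * (κ ^ 5 * d + κ ^ 6 * V + κ ^ 8 * (τ ^ 2 * B)) := by ring
    rw [h', pB] at h
    refine h.trans (mul_le_mul_of_nonneg_left ?_ hK0.le)
    linarith
  have hKS : K * S ≤ K ^ 2 * S := mul_le_mul_of_nonneg_right hK2 hS0
  have q6 : Sez ≤ 2 * K ^ 2 * S := by
    have h' : κ * d + κ ^ 2 * (κ ^ 2 * (V + Sey) + Sz + e) + κ ^ 8 * τ ^ 2 * B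
        ≤ S + K * S := by
      have : κ * d + κ ^ 2 * (κ ^ 2 * (V + Sey) + Sz + e) + κ ^ 8 * τ ^ 2 * B
        = κ * d + κ ^ 4 * V + κ ^ 4 * Sey + κ ^ 2 * Sz + κ ^ 2 * e + κ ^ 8 * (τ ^ 2 * B) := by ring
      linarith
    have := h6.trans (mul_le_mul_of_nonneg_left h' hK0.le)
    linarith
  have q7 : Seh ≤ 4 * K ^ 3 * S := by
    have h' : d + Sez + κ ^ 2 * (V + Sey) + Sz + e + κ ^ 6 * τ ^ 2 * B
        ≤ 4 * K ^ 2 * S := by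
      have h1 : κ ^ 6 * τ ^ 2 * B = κ ^ 6 * (τ ^ 2 * B) := by ring
      have h2 : κ ^ 2 * (V + Sey) = κ ^ 2 * V + κ ^ 2 * Sey := by ring
      have h3 : S ≤ K * S := le_mul_of_one_le_left hS0 hK
      linarith
    have := h7.trans (mul_le_mul_of_nonneg_left h' hK0.le)
    linarith
  have hcK2 : c ^ 2 * K ^ 3 ≤ 1 / 16 := by
    have : c ^ 2 * K ^ 3 = c * (c * K ^ 3) := by ring
    rw [this, hcK]; linarith
  -- The error of `h̄` returns `8K³c²B ≤ B/2`, so half of `B` is absorbed; the definition of `c` is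
  -- made for this.
  have q8 : B / 2 + 2 * SG ≤ 104 * K ^ 3 * (M + Q) := by
    have t1 : c ^ 2 * K ^ 3 * B ≤ 1 / 16 * B := by gcongr
    have t2 : K ^ 3 * (κ ^ 4 * d) ≤ K ^ 3 * (M + Q) := by
      gcongr; linarith
    rw [hS] at q7
    linarith
  have q9 : c ^ 2 * B ≤ M + Q := by
    have t1 : B ≤ 208 * K ^ 3 * (M + Q) := by linarith
    have t2 : c ^ 2 * B ≤ c ^ 2 * (208 * K ^ 3 * (M + Q)) := by gcongr
    have t3 : c ^ 2 * (208 * K ^ 3 * (M + Q)) = 208 * c * (c * K ^ 3) * (M + Q) := by ring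
    rw [t3, hcK] at t2
    have t4 : 208 * c * (1 / 24) * (M + Q) ≤ 1 * (M + Q) := by gcongr; linarith
    linarith
  have q10 : S ≤ 2 * (M + Q) := by linarith
  refine ⟨q5.trans ?_, q6.trans ?_, by linarith⟩
  · calc K * S ≤ K * (2 * (M + Q)) := by gcongr
      _ = _ := by ring
  · calc 2 * K ^ 2 * S ≤ 2 * K ^ 2 * (2 * (M + Q)) := by gcongr
      _ = _ := by ring

/-- Elimination of the consensus errors from the summed recursions. -/
lemma sum_consensus_le {κ K τ d q i b₁ b₂ e x₀ y₀ z₀ M Sx Sy Sz Sh Sey Sez : ℝ}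
    (hκ : 1 ≤ κ) (hK : 1 ≤ K) (hτ : κ ^ 8 * τ ^ 2 ≤ 1)
    (hd : 0 ≤ d) (hdM : d ≤ M) (heM : e ≤ M)
    (hq : 0 ≤ q) (hqκ : q * κ ^ 2 * (80 * K ^ 3) ≤ 1) (he : 0 ≤ e)
    (hb₁ : 0 ≤ b₁) (hb₂ : 0 ≤ b₂)
    (hSx : 0 ≤ Sx) (hSy : 0 ≤ Sy) (hSz : 0 ≤ Sz) (hSey : 0 ≤ Sey) (hSez : 0 ≤ Sez) (hz₀ : 0 ≤ z₀)
    (h0 : κ ^ 2 * (x₀ + y₀) + z₀ ≤ i)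
    (h1 : Sx ≤ x₀ + q * τ ^ 2 * Sh)
    (h2 : Sy ≤ y₀ + q * K * (b₂ + (Sx + Sy)))
    (h3 : Sz ≤ z₀ + q * K * (b₁ + κ ^ 2 * b₂ + e + κ ^ 2 * (Sx + Sy + Sey) + Sz + Sez))
    (h4 : Sh ≤ d + K * (b₁ + κ ^ 2 * b₂ + e + κ ^ 2 * (Sx + Sy + Sey) + Sz + Sez))
    (h5 : κ ^ 4 * Sey ≤ 2 * K * (M + (κ ^ 6 * (Sx + Sy) + κ ^ 2 * Sz)))
    (h6 : Sez ≤ 4 * K ^ 2 * (M + (κ ^ 6 * (Sx + Sy) + κ ^ 2 * Sz))) :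
    κ ^ 6 * (Sx + Sy) + κ ^ 2 * Sz
      ≤ 2 * (κ ^ 4 * i) + 2 * M + 6 * K * (q * (κ ^ 2 * b₁ + κ ^ 6 * b₂)) := by
  have hκ0 : 0 < κ := by linarith
  have hK0 : 0 < K := by linarith
  have hK2 : K ≤ K ^ 2 := by nlinarith
  have hK3 : K ≤ K ^ 3 := hK2.trans (pow_le_pow_right₀ hK (by norm_num))
  obtain ⟨V, hV⟩ : ∃ V, V = Sx + Sy := ⟨_, rfl⟩
  have hV0 : 0 ≤ V := by rw [hV]; linarith
  rw [← hV] at h2 h3 h4 h5 h6 ⊢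
  obtain ⟨Q, hQ⟩ : ∃ Q, Q = κ ^ 6 * V + κ ^ 2 * Sz := ⟨_, rfl⟩
  rw [← hQ] at h5 h6 ⊢
  have hM0 : 0 ≤ M := he.trans heM
  have hQ0 : 0 ≤ Q := by rw [hQ]; positivity
  have pz : Sz ≤ κ ^ 2 * Sz := by simpa using pow_mul_le_pow_mul hκ (by norm_num : 0 ≤ 2) hSz
  have pV : κ ^ 2 * V ≤ κ ^ 6 * V := pow_mul_le_pow_mul hκ (by norm_num) hV0
  have py : κ ^ 2 * Sey ≤ κ ^ 4 * Sey := pow_mul_le_pow_mul hκ (by norm_num) hSey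
  have pzn : 0 ≤ κ ^ 2 * Sz := by positivity
  obtain ⟨MQ, hMQ⟩ : ∃ MQ, MQ = M + Q := ⟨_, rfl⟩
  rw [← hMQ] at h5 h6
  have hMQ0 : 0 ≤ MQ := by rw [hMQ]; positivity
  obtain ⟨E, hE⟩ : ∃ E, E = b₁ + κ ^ 2 * b₂ + e + κ ^ 2 * (V + Sey) + Sz + Sez := ⟨_, rfl⟩
  rw [← hE] at h3 h4
  have hE0 : 0 ≤ E := by rw [hE]; positivity
  -- The tracking bounds are inserted here, after which the spreads are bounded in terms of
  -- themselves, with small factors in `q`.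
  have qE : E ≤ b₁ + κ ^ 2 * b₂ + 7 * K ^ 2 * MQ := by
    have t1 : κ ^ 2 * (V + Sey) = κ ^ 2 * V + κ ^ 2 * Sey := by ring
    have t2 : K * MQ ≤ K ^ 2 * MQ := by gcongr
    have t3 : MQ ≤ K ^ 2 * MQ := le_mul_of_one_le_left hMQ0 (one_le_pow₀ hK)
    linarith
  have qx : κ ^ 6 * Sx ≤ κ ^ 6 * x₀ + q * (d + K * E) := by
    have t0 := mul_le_mul_of_nonneg_left h1 (by positivity : 0 ≤ κ ^ 6)
    have t1 : κ ^ 6 * τ ^ 2 ≤ 1 :=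
      (pow_mul_le_pow_mul hκ (by norm_num) (sq_nonneg τ)).trans hτ
    have t2 : q * (κ ^ 6 * τ ^ 2 * Sh) ≤ q * (κ ^ 6 * τ ^ 2 * (d + K * E)) := by gcongr
    have t3 : q * (κ ^ 6 * τ ^ 2 * (d + K * E)) ≤ q * (1 * (d + K * E)) := by gcongr
    linarith
  have qy : κ ^ 6 * Sy ≤ κ ^ 6 * y₀ + q * K * (κ ^ 6 * b₂ + Q) := by
    have t0 := mul_le_mul_of_nonneg_left h2 (by positivity : 0 ≤ κ ^ 6)
    have t1 : q * K * (κ ^ 6 * V) ≤ q * K * Q := by gcongr; linarith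
    linarith
  have qz : κ ^ 2 * Sz ≤ κ ^ 2 * z₀ + q * κ ^ 2 * K * E := by
    have t0 := mul_le_mul_of_nonneg_left h3 (by positivity : 0 ≤ κ ^ 2)
    linarith
  have qi : κ ^ 6 * x₀ + κ ^ 6 * y₀ + κ ^ 2 * z₀ ≤ κ ^ 4 * i := by
    have t1 := mul_le_mul_of_nonneg_left h0 (by positivity : 0 ≤ κ ^ 4)
    have t2 : κ ^ 2 * z₀ ≤ κ ^ 4 * z₀ := pow_mul_le_pow_mul hκ (by norm_num) hz₀
    linarith
  have hqq : q ≤ q * κ ^ 2 := le_mul_of_one_le_right hq (one_le_pow₀ hκ)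
  have hqκ0 : 0 ≤ q * κ ^ 2 := by positivity
  have r1 : q * (d + K * E) ≤ q * κ ^ 2 * K ^ 3 * M + q * κ ^ 2 * K * E := by
    have t1 : q * d ≤ q * κ ^ 2 * K ^ 3 * M := by
      refine mul_le_mul ?_ hdM hd (by positivity)
      exact hqq.trans (le_mul_of_one_le_right hqκ0 (one_le_pow₀ hK))
    have t2 : q * (K * E) ≤ q * κ ^ 2 * (K * E) := by gcongr
    linarith
  have r2 : q * κ ^ 2 * K * E ≤ q * κ ^ 2 * K * (b₁ + κ ^ 2 * b₂)
      + 7 * (q * κ ^ 2 * K ^ 3) * MQ := by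
    have := mul_le_mul_of_nonneg_left qE (by positivity : 0 ≤ q * κ ^ 2 * K)
    linarith
  have r3 : q * K * Q ≤ q * κ ^ 2 * K ^ 3 * Q := by
    have : q * K ≤ q * κ ^ 2 * K ^ 3 := mul_le_mul hqq hK3 hK0.le hqκ0
    gcongr
  have hη : q * κ ^ 2 * K ^ 3 ≤ 1 / 80 := by linarith
  have r4 : q * κ ^ 2 * K ^ 3 * M ≤ 1 / 80 * M := by gcongr
  have r5 : q * κ ^ 2 * K ^ 3 * MQ ≤ 1 / 80 * MQ := by gcongr
  have r6 : q * κ ^ 2 * K ^ 3 * Q ≤ 1 / 80 * Q := by gcongr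
  have r7 : q * K * (κ ^ 4 * b₂) ≤ q * K * (κ ^ 6 * b₂) :=
    mul_le_mul_of_nonneg_left (pow_mul_le_pow_mul hκ (by norm_num) hb₂) (by positivity)
  have hQ' : Q = κ ^ 6 * Sx + κ ^ 6 * Sy + κ ^ 2 * Sz := by rw [hQ, hV]; ring
  have n1 : 0 ≤ q * K * (κ ^ 2 * b₁) := by positivity
  have n2 : 0 ≤ q * K * (κ ^ 6 * b₂) := by positivity
  -- The spreads of `x` and `z` each return `7/80` of `MQ`, that of `y` returns `1/80` of `Q`; in
  -- total `15/80` of `Q` is absorbed on the left.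
  have hfin : Q ≤ κ ^ 4 * i + (1 / 80 * M + 14 / 80 * MQ + 1 / 80 * Q)
      + 3 * (q * K * (κ ^ 2 * b₁) + q * K * (κ ^ 6 * b₂)) := by
    linarith
  rw [hMQ] at hfin
  linarith

/-- Elimination of all errors from the summed recursions. -/
lemma sum_gradient_le {κ K c τ d q i b₁ b₂ e x₀ y₀ z₀ Sx Sy Sz Sh Sey Sez Seh SG B : ℝ}
    (hκ : 1 ≤ κ) (hK : 1 ≤ K) (hc : c = 1 / (24 * K ^ 3)) (hτ : τ * κ ^ 4 = c)
    (hd : 0 ≤ d) (hq : 0 ≤ q) (hqκ : q * κ ^ 2 * (80 * K ^ 3) ≤ 1) (he : 0 ≤ e)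
    (hb₁ : 0 ≤ b₁) (hb₂ : 0 ≤ b₂)
    (hSx : 0 ≤ Sx) (hSy : 0 ≤ Sy) (hSz : 0 ≤ Sz) (hSey : 0 ≤ Sey) (hSez : 0 ≤ Sez)
    (hSG : 0 ≤ SG) (hB : 0 ≤ B) (hz₀ : 0 ≤ z₀) (hi : 0 ≤ i)
    (h0 : κ ^ 2 * (x₀ + y₀) + z₀ ≤ i)
    (h1 : Sx ≤ x₀ + q * τ ^ 2 * Sh)
    (h2 : Sy ≤ y₀ + q * K * (b₂ + (Sx + Sy)))
    (h3 : Sz ≤ z₀ + q * K * (b₁ + κ ^ 2 * b₂ + e + κ ^ 2 * (Sx + Sy + Sey) + Sz + Sez))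
    (h4 : Sh ≤ d + K * (b₁ + κ ^ 2 * b₂ + e + κ ^ 2 * (Sx + Sy + Sey) + Sz + Sez))
    (h5 : Sey ≤ K * (κ * d + κ ^ 2 * (Sx + Sy) + κ ^ 4 * τ ^ 2 * B))
    (h6 : Sez ≤ K * (κ * d + κ ^ 2 * (κ ^ 2 * (Sx + Sy + Sey) + Sz + e) + κ ^ 8 * τ ^ 2 * B))
    (h7 : Seh ≤ K * (d + Sez + κ ^ 2 * (Sx + Sy + Sey) + Sz + e + κ ^ 6 * τ ^ 2 * B))
    (h8 : B + 2 * SG ≤ 96 * K ^ 3 * κ ^ 4 * d + 2 * Seh) :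
    SG ≤ 312 * K ^ 4 * (κ ^ 5 * d + κ ^ 2 * e + κ ^ 4 * i
      + q * (κ ^ 2 * b₁ + κ ^ 6 * b₂)) := by
  have hK0 : 0 < K := by linarith
  obtain ⟨t1, t2, t3⟩ := sum_tracking_le hκ hK hc hτ hd he (add_nonneg hSx hSy) hSz hSey hSG hB
    h5 h6 h7 h8
  have hκd : d ≤ κ ^ 5 * d := le_mul_of_one_le_left hd (one_le_pow₀ hκ)
  have hκe : e ≤ κ ^ 2 * e := le_mul_of_one_le_left he (one_le_pow₀ hκ)
  have hc1 : κ ^ 8 * τ ^ 2 ≤ 1 := by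
    have h : κ ^ 8 * τ ^ 2 = c ^ 2 := by rw [← hτ]; ring
    have hK3 : 1 ≤ K ^ 3 := one_le_pow₀ hK
    rw [h, hc]
    refine pow_le_one₀ (by positivity) ?_
    rw [div_le_one (by positivity)]
    linarith
  have hQ := sum_consensus_le hκ hK hc1 hd (by linarith) (by linarith) hq hqκ he hb₁ hb₂ hSx hSy hSz
    hSey hSez hz₀ h0 h1 h2 h3 h4 t1 t2
  obtain ⟨M, hM⟩ : ∃ M, M = κ ^ 5 * d + κ ^ 2 * e := ⟨_, rfl⟩
  obtain ⟨I, hI⟩ : ∃ I, I = κ ^ 4 * i := ⟨_, rfl⟩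
  obtain ⟨b, hb⟩ : ∃ b, b = q * (κ ^ 2 * b₁ + κ ^ 6 * b₂) := ⟨_, rfl⟩
  rw [← hM] at hQ t3 ⊢
  rw [← hI, ← hb] at hQ ⊢
  have hκ0 : 0 < κ := by linarith
  have hM0 : 0 ≤ M := by rw [hM]; positivity
  have hI0 : 0 ≤ I := by rw [hI]; positivity
  have hb0 : 0 ≤ b := by rw [hb]; positivity
  have r1 : M ≤ K * M := le_mul_of_one_le_left hM0 hK
  have r2 : I ≤ K * I := le_mul_of_one_le_left hI0 hK
  calc SG ≤ _ := t3
    _ ≤ 52 * K ^ 3 * (6 * K * (M + I + b)) := by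
      gcongr
      linarith
    _ = _ := by ring

end Sums

/-! ### Summed recursions along a whole trajectory. -/

section Trajectory

lemma consensus_sum_le {r ρ α S a U : ℝ} (hr : 0 < r)
    (h : r * S ≤ a + ρ ^ 2 / r * α ^ 2 * U) : S ≤ a / r + (ρ * α / r) ^ 2 * U := by
  have : a / r + (ρ * α / r) ^ 2 * U = (a + ρ ^ 2 / r * α ^ 2 * U) / r := by
    field_simp
  rw [this, le_div_iff₀ hr, mul_comm]
  exact h

/-- Division by the rate `αμ/2` with `1/μ = κ/L`: the initial error costs one factor `κ/α`, the
forcing terms cost `κ²` but no power of `1/α`. -/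
lemma tracking_sum_le {κ L μ α τ S a D U c B : ℝ} (hL : 0 < L) (hμ : 0 < μ) (hκ : κ * μ = L)
    (hα : 0 < α) (ha : a ≤ D)
    (h : α * μ / 2 * S ≤ a + 3 / (α * μ) * (2 * α ^ 2 * U + c * (τ * α) ^ 2 * B)) :
    S ≤ 2 / L * (κ * (D / α)) + 12 * κ ^ 2 / L ^ 2 * U + 6 * c * κ ^ 2 / L ^ 2 * (τ ^ 2 * B) := by
  have hκ0 : 0 < κ := by by_contra hc; nlinarith
  have h1 : 2 / L * (κ * (D / α)) + 12 * κ ^ 2 / L ^ 2 * U + 6 * c * κ ^ 2 / L ^ 2 * (τ ^ 2 * B)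
      = (D + 3 / (α * μ) * (2 * α ^ 2 * U + c * (τ * α) ^ 2 * B)) / (α * μ / 2) := by
    rw [← hκ]
    field_simp
    ring
  rw [h1, le_div_iff₀ (by positivity), mul_comm]
  linarith

lemma momentum_sum_le {α τ S a D U c B : ℝ} (hα : 0 < α) (ha : a ≤ D)
    (h : α / 2 * S ≤ a + 3 / α * (2 * α ^ 2 * U + c * (τ * α) ^ 2 * B)) :
    S ≤ 2 * (D / α) + 12 * U + 6 * c * (τ ^ 2 * B) := by
  have h1 : 2 * (D / α) + 12 * U + 6 * c * (τ ^ 2 * B)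
      = (D + 3 / α * (2 * α ^ 2 * U + c * (τ * α) ^ 2 * B)) / (α / 2) := by
    field_simp
    ring
  rw [h1, le_div_iff₀ (by positivity), mul_comm]
  linarith

variable {X Y : Type*} [NormedAddCommGroup X] [InnerProductSpace ℝ X] [CompleteSpace X]
  [NormedAddCommGroup Y] [InnerProductSpace ℝ Y] [CompleteSpace Y]
  {N : ℕ} {Ξ : Type u} {Z : Type v} [MeasurableSpace Ξ] [MeasurableSpace Z]
  {P : Problem N X Y Ξ Z} {L μ κ ε b₁ b₂ τ α ρ D : ℝ} {W : Matrix (Fin N) (Fin N) ℝ}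

/-- The constant through which the smoothness constant enters the recursions. -/
def recConst (L : ℝ) : ℝ := 1000 * (1 + L ^ 2 + 1 / L ^ 2)

/-- The sum `1 + L² + 1/L²` dominates `1`, `L`, `L²`, `1/L` and `1/L²`. The factor `1000` covers the
numerical constants of the recursions, the largest of which is `768`. -/
lemma recConst_bounds (hL : 0 < L) : 1000 ≤ recConst L ∧ 1000 * L ^ 2 ≤ recConst L ∧
    1000 / L ^ 2 ≤ recConst L ∧ 1000 * L ≤ recConst L ∧ 1000 / L ≤ recConst L := by
  have h1 : 0 < 1 / L ^ 2 := by positivity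
  have h2 : 0 < L ^ 2 := by positivity
  have h3 : L ≤ 1 + L ^ 2 := by nlinarith [sq_nonneg (L - 1)]
  have h4 : 1 / L ≤ 1 + 1 / L ^ 2 := by
    have : 1 / L ^ 2 = (1 / L) ^ 2 := by rw [div_pow, one_pow]
    rw [this]; nlinarith [sq_nonneg (1 / L - 1)]
  unfold recConst
  refine ⟨by linarith, by linarith, ?_, by linarith, ?_⟩
  · rw [show 1000 / L ^ 2 = 1000 * (1 / L ^ 2) by ring]; linarith
  · rw [show 1000 / L = 1000 * (1 / L) by ring]; linarith

/-- The initial consensus error is bounded as a sum over nodes, whereas `spread` is a mean; the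
quotient is the `1/N` in the third term of the rate. -/
lemma InitBound.spread_le {s : State N X Y} (hN : 0 < N) (hi : InitBound P κ s D) :
    κ ^ 2 * (spread s.x + spread s.y) + spread s.z ≤ D / N := by
  have hN' : (0 : ℝ) < N := by positivity
  have e : ∀ a : Fin N → ℝ, mean a = (∑ i, a i) / N := fun a => by
    rw [mean, smul_eq_mul, div_eq_inv_mul]
  simp only [spread, e]
  refine le_trans (le_of_eq ?_) (div_le_div_of_nonneg_right hi.consensus hN'.le)
  ring

set_option maxHeartbeats 1000000 in
-- Every one-step recursion is summed over `t < T`, its numerical constants are absorbed into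
-- `recConst L`, and `sum_gradient_le` solves the resulting linear system. The step size is still
-- free.
theorem Problem.Smooth.sum_sq_gradient_le [FiniteDimensional ℝ X] [FiniteDimensional ℝ Y]
    (hs : P.Smooth L L L L μ) (hN : 0 < N) (hL : 0 < L) (hμ : 0 < μ)
    (hκ : κ * μ = L) (hκ1 : 1 ≤ κ) (hd : P.Dissimilar b₁ b₂) (hW : IsMixing W)
    (hρ : mixingRate W = ρ) (hρ1 : ρ < 1)
    (hα : 0 < α) (hα1 : α ≤ 1) (hαL : α * L ^ 2 ≤ μ)
    (hτ : τ * κ ^ 4 = 1 / (24 * recConst L ^ 3))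
    (hq : (ρ * α / (1 - ρ)) ^ 2 * κ ^ 2 * (80 * recConst L ^ 3) ≤ 1)
    (hD : 0 ≤ D) {T : ℕ} {s : ℕ → State N X Y} {R : ℕ → ProductRule X Y}
    (hi : InitBound P κ (s 0) D) (hstep : ∀ t < T, s (t + 1) = detStep P W τ α (R t) (s t))
    (hR : ∀ t < T, RuleError P (R t) (s t) ε) :
    ∑ t ∈ Finset.range T, ‖gradient P.Phi (mean (s t).x)‖ ^ 2 ≤ 312 * recConst L ^ 4 *
      (κ ^ 5 * (D / α) + κ ^ 2 * (T * ε ^ 2) + κ ^ 4 * (D / N / (1 - ρ))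
        + (ρ * α / (1 - ρ)) ^ 2 * (κ ^ 2 * (T * b₁ ^ 2) + κ ^ 6 * (T * b₂ ^ 2))) := by
  obtain ⟨k1, k2, k3, k4, k5⟩ := recConst_bounds hL
  set K := recConst L
  have hr : 0 < 1 - ρ := by linarith
  have hκ0 : 0 < κ := by linarith
  have hN' : (0 : ℝ) < N := by positivity
  have hK3 : 1 ≤ K ^ 3 := one_le_pow₀ (by linarith)
  have hKK : K ≤ K ^ 3 := by
    calc K = K ^ 1 := (pow_one K).symm
      _ ≤ K ^ 3 := pow_le_pow_right₀ (by linarith) (by norm_num)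
  have hτ0 : 0 < τ := by
    have h1 : 0 < τ * κ ^ 4 := by rw [hτ]; positivity
    exact pos_of_mul_pos_left h1 (by positivity)
  obtain ⟨q, hqd⟩ : ∃ q, q = (ρ * α / (1 - ρ)) ^ 2 := ⟨_, rfl⟩
  have hq0 : 0 ≤ q := by rw [hqd]; positivity
  set Sx := ∑ t ∈ Finset.range T, spread (s t).x with hSx
  set Sy := ∑ t ∈ Finset.range T, spread (s t).y with hSy
  set Sz := ∑ t ∈ Finset.range T, spread (s t).z with hSz
  set Sh := ∑ t ∈ Finset.range T, spread (s t).h with hSh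
  set Sey := ∑ t ∈ Finset.range T, errY P (s t) with hSey
  set Sez := ∑ t ∈ Finset.range T, errZ P (s t) with hSez
  set Seh := ∑ t ∈ Finset.range T, errH P (s t) with hSeh
  set SG := ∑ t ∈ Finset.range T, ‖gradient P.Phi (mean (s t).x)‖ ^ 2 with hSG
  set B := ∑ t ∈ Finset.range T, ‖mean (s t).h‖ ^ 2 with hB
  have hSx0 : 0 ≤ Sx := Finset.sum_nonneg fun _ _ => spread_nonneg _
  have hSy0 : 0 ≤ Sy := Finset.sum_nonneg fun _ _ => spread_nonneg _
  have hSz0 : 0 ≤ Sz := Finset.sum_nonneg fun _ _ => spread_nonneg _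
  have hSey0 : 0 ≤ Sey := Finset.sum_nonneg fun _ _ => errY_nonneg
  have hSez0 : 0 ≤ Sez := Finset.sum_nonneg fun _ _ => errZ_nonneg
  have hSG0 : 0 ≤ SG := Finset.sum_nonneg fun _ _ => sq_nonneg _
  have hB0 : 0 ≤ B := Finset.sum_nonneg fun _ _ => sq_nonneg _
  have hdist : ∑ t ∈ Finset.range T, distSq P (s t) = Sx + Sy + Sey := by
    simp only [distSq, Finset.sum_add_distrib, hSx, hSy, hSey]
  set V := Sx + Sy with hV
  have hV0 : 0 ≤ V := add_nonneg hSx0 hSy0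
  have hTε : 0 ≤ T * ε ^ 2 := by positivity
  have hT1 : 0 ≤ T * b₁ ^ 2 := by positivity
  have hT2 : 0 ≤ T * b₂ ^ 2 := by positivity
  obtain ⟨E, hE⟩ : ∃ E, E = T * b₁ ^ 2 + κ ^ 2 * (T * b₂ ^ 2) + T * ε ^ 2
    + κ ^ 2 * (V + Sey) + Sz + Sez := ⟨_, rfl⟩
  -- consensus
  have h1 : Sx ≤ spread (s 0).x / (1 - ρ) + q * τ ^ 2 * Sh := by
    have h := mul_sum_le_of_contraction (T := T) (c := 1 - ρ) (a := fun t => spread (s t).x)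
      (b := fun t => ρ ^ 2 / (1 - ρ) * α ^ 2 * (τ ^ 2 * spread (s t).h)) (spread_nonneg _)
      fun t ht => by
        rw [hstep t ht]
        have := spread_detStep_x_le (τ := τ) (α := α) (R := R t) (P := P) (s := s t) hN hW hρ hρ1
        linarith
    rw [← Finset.mul_sum, ← Finset.mul_sum] at h
    have := consensus_sum_le hr h
    rw [← hqd] at this
    linarith
  have h2 : Sy ≤ spread (s 0).y / (1 - ρ) + q * K * (T * b₂ ^ 2 + V) := by
    have h := mul_sum_le_of_contraction (T := T) (c := 1 - ρ) (a := fun t => spread (s t).y)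
      (b := fun t => ρ ^ 2 / (1 - ρ) * α ^ 2 *
        (2 * L ^ 2 * (spread (s t).x + spread (s t).y) + 2 * b₂ ^ 2)) (spread_nonneg _)
      fun t ht => by
        rw [hstep t ht]
        have h1 := spread_detStep_y_le (τ := τ) (α := α) (R := R t) (P := P) (s := s t) hN hW hρ hρ1
        have h2 := mul_le_mul_of_nonneg_left (hs.spread_grad2_g_le hN hL hd (s := s t))
          (by positivity : 0 ≤ ρ ^ 2 / (1 - ρ) * α ^ 2)
        linarith
    rw [← Finset.mul_sum, Finset.sum_add_distrib, ← Finset.mul_sum, Finset.sum_add_distrib,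
      Finset.sum_const, Finset.card_range, nsmul_eq_mul] at h
    have h3 := consensus_sum_le hr h
    rw [← hqd] at h3
    refine h3.trans (add_le_add_right ?_ _)
    rw [mul_assoc q K]
    refine mul_le_mul_of_nonneg_left ?_ hq0
    change 2 * L ^ 2 * V + _ ≤ _
    have e1 : 2 * L ^ 2 * V ≤ K * V := by gcongr; linarith [sq_nonneg L]
    have e2 : 2 * (T * b₂ ^ 2) ≤ K * (T * b₂ ^ 2) := by gcongr; linarith
    linarith
  have h3 : Sz ≤ spread (s 0).z / (1 - ρ) + q * K * E := by
    have h := mul_sum_le_of_contraction (T := T) (c := 1 - ρ) (a := fun t => spread (s t).z)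
      (b := fun t => ρ ^ 2 / (1 - ρ) * α ^ 2 *
        (9 * L ^ 2 * spread (s t).z + 36 * L ^ 2 * κ ^ 2 * distSq P (s t)
          + 3 * L ^ 2 * errZ P (s t) + (9 * ε ^ 2 + 6 * κ ^ 2 * b₂ ^ 2 + 6 * b₁ ^ 2)))
      (spread_nonneg _)
      fun t ht => by
        rw [hstep t ht]
        have h1 := spread_detStep_z_le (τ := τ) (α := α) (R := R t) (P := P) (s := s t) hN hW hρ hρ1
        have h2 := mul_le_mul_of_nonneg_left
          (hs.spread_dirZ_le hN hL hμ hκ hκ1 (hR t ht) hd)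
          (by positivity : 0 ≤ ρ ^ 2 / (1 - ρ) * α ^ 2)
        linarith
    rw [← Finset.mul_sum, Finset.sum_add_distrib, Finset.sum_add_distrib, Finset.sum_add_distrib,
      ← Finset.mul_sum, ← Finset.mul_sum, ← Finset.mul_sum, hdist,
      Finset.sum_const, Finset.card_range, nsmul_eq_mul] at h
    have h3 := consensus_sum_le hr h
    rw [← hqd] at h3
    refine h3.trans (add_le_add_right ?_ _)
    rw [mul_assoc q K]
    refine mul_le_mul_of_nonneg_left ?_ hq0
    change 9 * L ^ 2 * Sz + _ + 3 * L ^ 2 * Sez + _ ≤ _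
    have e1 : 9 * L ^ 2 * Sz ≤ K * Sz := by gcongr; linarith [sq_nonneg L]
    have e2 : 36 * L ^ 2 * (κ ^ 2 * (V + Sey)) ≤ K * (κ ^ 2 * (V + Sey)) := by
      gcongr; linarith [sq_nonneg L]
    have e3 : 3 * L ^ 2 * Sez ≤ K * Sez := by gcongr; linarith [sq_nonneg L]
    have e4 : 9 * (T * ε ^ 2) ≤ K * (T * ε ^ 2) := by gcongr; linarith
    have e5 : 6 * (κ ^ 2 * (T * b₂ ^ 2)) ≤ K * (κ ^ 2 * (T * b₂ ^ 2)) := by gcongr; linarith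
    have e6 : 6 * (T * b₁ ^ 2) ≤ K * (T * b₁ ^ 2) := by gcongr; linarith
    rw [hE]
    linarith
  -- The variable `h` is not mixed, so its spread contracts only at rate `α` and its forcing has no
  -- small factor; smallness comes from `q τ²` in front of `Sh` in `h1`.
  have h4 : Sh ≤ D / α + K * E := by
    have h := mul_sum_le_of_contraction (T := T) (c := α) (a := fun t => spread (s t).h)
      (b := fun t => α *
        (8 * L ^ 2 * spread (s t).z + 32 * L ^ 2 * κ ^ 2 * distSq P (s t)
          + 8 * L ^ 2 * errZ P (s t) + (8 * ε ^ 2 + 4 * κ ^ 2 * b₂ ^ 2 + 4 * b₁ ^ 2)))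
      (spread_nonneg _)
      fun t ht => by
        rw [hstep t ht]
        have h1 := spread_detStep_h_le (τ := τ) (R := R t) (P := P) (s := s t) (W := W) hα.le hα1
        have h2 := mul_le_mul_of_nonneg_left
          (hs.spread_dirH_le hN hL hμ hκ hκ1 (hR t ht) hd) hα.le
        linarith
    rw [← Finset.mul_sum, Finset.sum_add_distrib, Finset.sum_add_distrib, Finset.sum_add_distrib,
      ← Finset.mul_sum, ← Finset.mul_sum, ← Finset.mul_sum, hdist,
      Finset.sum_const, Finset.card_range, nsmul_eq_mul] at h
    change α * Sh ≤ spread (s 0).h + α * (8 * L ^ 2 * Sz + _ + 8 * L ^ 2 * Sez + _) at h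
    have h0 : spread (s 0).h ≤ D := hi.h_consensus
    have e1 : 8 * L ^ 2 * Sz ≤ K * Sz := by gcongr; linarith [sq_nonneg L]
    have e2 : 32 * L ^ 2 * (κ ^ 2 * (V + Sey)) ≤ K * (κ ^ 2 * (V + Sey)) := by
      gcongr; linarith [sq_nonneg L]
    have e3 : 8 * L ^ 2 * Sez ≤ K * Sez := by gcongr; linarith [sq_nonneg L]
    have e4 : 8 * (T * ε ^ 2) ≤ K * (T * ε ^ 2) := by gcongr; linarith
    have e5 : 4 * (κ ^ 2 * (T * b₂ ^ 2)) ≤ K * (κ ^ 2 * (T * b₂ ^ 2)) := by gcongr; linarith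
    have e6 : 4 * (T * b₁ ^ 2) ≤ K * (T * b₁ ^ 2) := by gcongr; linarith
    have e7 : α * Sh ≤ α * (D / α + K * E) := by
      rw [mul_add, mul_div_cancel₀ _ hα.ne']
      refine h.trans (add_le_add h0 (mul_le_mul_of_nonneg_left ?_ hα.le))
      rw [hE]
      linarith
    exact le_of_mul_le_mul_left e7 hα
  -- tracking
  have hαμ : α * μ ≤ 1 := step_mul_le_one hL hμ hκ hκ1 hα hαL
  have hdα : 0 ≤ κ * (D / α) := by positivity
  have hτB : 0 ≤ τ ^ 2 * B := by positivity
  have h5 : Sey ≤ K * (κ * (D / α) + κ ^ 2 * V + κ ^ 4 * τ ^ 2 * B) := by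
    have h := mul_sum_le_of_contraction (T := T) (c := α * μ / 2) (a := fun t => errY P (s t))
      (b := fun t => 3 / (α * μ) * (2 * α ^ 2 * (L ^ 2 * (spread (s t).x + spread (s t).y))
        + 2 * κ ^ 2 * (τ * α) ^ 2 * ‖mean (s t).h‖ ^ 2)) errY_nonneg
      fun t ht => by
        rw [hstep t ht]
        have := hs.errY_detStep_le hN hL hμ hκ hκ1 hW hα hαL (τ := τ) (R := R t) (s := s t)
        linarith
    rw [← Finset.mul_sum, Finset.sum_add_distrib, ← Finset.mul_sum, ← Finset.mul_sum,
      ← Finset.mul_sum, Finset.sum_add_distrib] at h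
    have h' := tracking_sum_le hL hμ hκ hα hi.y_err h
    refine h'.trans ?_
    have e0 : 2 / L * (κ * (D / α)) ≤ K * (κ * (D / α)) := by
      gcongr; exact le_trans (by gcongr; norm_num) k5
    have e1 : 12 * κ ^ 2 / L ^ 2 * (L ^ 2 * (Sx + Sy)) = 12 * (κ ^ 2 * V) := by
      rw [hV]; field_simp
    have e2 : 12 * (κ ^ 2 * V) ≤ K * (κ ^ 2 * V) := by gcongr; linarith
    have e3 : 6 * (2 * κ ^ 2) * κ ^ 2 / L ^ 2 * (τ ^ 2 * B)
        = 12 / L ^ 2 * (κ ^ 4 * (τ ^ 2 * B)) := by ring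
    have e4 : 12 / L ^ 2 * (κ ^ 4 * (τ ^ 2 * B)) ≤ K * (κ ^ 4 * (τ ^ 2 * B)) := by
      gcongr; exact le_trans (by gcongr; norm_num) k3
    change 2 / L * (κ * (D / α)) + 12 * κ ^ 2 / L ^ 2 * (L ^ 2 * (Sx + Sy)) + _ ≤ _
    rw [e1, e3]
    linarith
  have h6 : Sez ≤ K * (κ * (D / α) + κ ^ 2 * (κ ^ 2 * (V + Sey) + Sz + T * ε ^ 2)
      + κ ^ 8 * τ ^ 2 * B) := by
    have h := mul_sum_le_of_contraction (T := T) (c := α * μ / 2) (a := fun t => errZ P (s t))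
      (b := fun t => 3 / (α * μ) * (2 * α ^ 2 * (3 * ε ^ 2 + 3 * L ^ 2 * spread (s t).z
          + 12 * L ^ 2 * κ ^ 2 * distSq P (s t))
        + 32 * κ ^ 6 * (τ * α) ^ 2 * ‖mean (s t).h‖ ^ 2)) errZ_nonneg
      fun t ht => by
        rw [hstep t ht]
        have := hs.errZ_detStep_le hN hL hμ hκ hκ1 hW hα hαL (τ := τ) (hR t ht)
        linarith
    rw [← Finset.mul_sum, Finset.sum_add_distrib, ← Finset.mul_sum, ← Finset.mul_sum,
      Finset.sum_add_distrib, Finset.sum_add_distrib, Finset.sum_const, Finset.card_range,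
      nsmul_eq_mul, ← Finset.mul_sum, ← Finset.mul_sum, hdist] at h
    have h' := tracking_sum_le hL hμ hκ hα hi.z_err h
    refine h'.trans ?_
    have e0 : 2 / L * (κ * (D / α)) ≤ K * (κ * (D / α)) := by
      gcongr; exact le_trans (by gcongr; norm_num) k5
    have e1 : 12 * κ ^ 2 / L ^ 2 * (T * (3 * ε ^ 2) + 3 * L ^ 2 * Sz
        + 12 * L ^ 2 * κ ^ 2 * (V + Sey))
        = 36 / L ^ 2 * (κ ^ 2 * (T * ε ^ 2)) + 36 * (κ ^ 2 * Sz)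
          + 144 * (κ ^ 2 * (κ ^ 2 * (V + Sey))) := by
      field_simp; ring
    have e2 : 36 / L ^ 2 * (κ ^ 2 * (T * ε ^ 2)) ≤ K * (κ ^ 2 * (T * ε ^ 2)) := by
      gcongr; exact le_trans (by gcongr; norm_num) k3
    have e3 : 36 * (κ ^ 2 * Sz) ≤ K * (κ ^ 2 * Sz) := by gcongr; linarith
    have e4 : 144 * (κ ^ 2 * (κ ^ 2 * (V + Sey))) ≤ K * (κ ^ 2 * (κ ^ 2 * (V + Sey))) := by
      gcongr; linarith
    have e5 : 6 * (32 * κ ^ 6) * κ ^ 2 / L ^ 2 * (τ ^ 2 * B)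
        = 192 / L ^ 2 * (κ ^ 8 * (τ ^ 2 * B)) := by ring
    have e6 : 192 / L ^ 2 * (κ ^ 8 * (τ ^ 2 * B)) ≤ K * (κ ^ 8 * (τ ^ 2 * B)) := by
      gcongr; exact le_trans (by gcongr; norm_num) k3
    change 2 / L * (κ * (D / α)) + 12 * κ ^ 2 / L ^ 2 * (T * (3 * ε ^ 2) + 3 * L ^ 2 * Sz
        + 12 * L ^ 2 * κ ^ 2 * (V + Sey)) + _ ≤ _
    rw [e1, e5]
    linarith
  have h7 : Seh ≤ K * (D / α + Sez + κ ^ 2 * (V + Sey) + Sz + T * ε ^ 2 + κ ^ 6 * τ ^ 2 * B) := by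
    have h := mul_sum_le_of_contraction (T := T) (c := α / 2) (a := fun t => errH P (s t))
      (b := fun t => 3 / α * (2 * α ^ 2 * (4 * ε ^ 2 + 4 * L ^ 2 * spread (s t).z
          + 4 * L ^ 2 * errZ P (s t) + 16 * L ^ 2 * κ ^ 2 * distSq P (s t))
        + 128 * L ^ 2 * κ ^ 6 * (τ * α) ^ 2 * ‖mean (s t).h‖ ^ 2)) errH_nonneg
      fun t ht => by
        rw [hstep t ht]
        have := hs.errH_detStep_le hN hL hμ hκ hκ1 hW hα (τ := τ) hα1 (hR t ht)
        linarith
    rw [← Finset.mul_sum, Finset.sum_add_distrib, ← Finset.mul_sum, ← Finset.mul_sum,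
      Finset.sum_add_distrib, Finset.sum_add_distrib, Finset.sum_add_distrib, Finset.sum_const,
      Finset.card_range, nsmul_eq_mul, ← Finset.mul_sum, ← Finset.mul_sum, ← Finset.mul_sum,
      hdist] at h
    have h' := momentum_sum_le hα hi.h_err h
    refine h'.trans ?_
    change 2 * (D / α) + 12 * (T * (4 * ε ^ 2) + 4 * L ^ 2 * Sz + 4 * L ^ 2 * Sez
      + 16 * L ^ 2 * κ ^ 2 * (V + Sey)) + 6 * (128 * L ^ 2 * κ ^ 6) * (τ ^ 2 * B) ≤ _
    have e0 : 2 * (D / α) ≤ K * (D / α) := by gcongr; linarith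
    have e1 : 48 * (T * ε ^ 2) ≤ K * (T * ε ^ 2) := by gcongr; linarith
    have e2 : 48 * L ^ 2 * Sz ≤ K * Sz := by gcongr; linarith [sq_nonneg L]
    have e3 : 48 * L ^ 2 * Sez ≤ K * Sez := by gcongr; linarith [sq_nonneg L]
    have e4 : 192 * L ^ 2 * (κ ^ 2 * (V + Sey)) ≤ K * (κ ^ 2 * (V + Sey)) := by
      gcongr; linarith [sq_nonneg L]
    have e5 : 768 * L ^ 2 * (κ ^ 6 * (τ ^ 2 * B)) ≤ K * (κ ^ 6 * (τ ^ 2 * B)) := by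
      gcongr; linarith [sq_nonneg L]
    linarith
  -- descent
  have h8 : B + 2 * SG ≤ 96 * K ^ 3 * κ ^ 4 * (D / α) + 2 * Seh := by
    have hτα : 32 * L * κ ^ 3 * (τ * α) ≤ 1 := by
      have e1 : τ * κ ^ 3 ≤ 1 / (24 * K ^ 3) := by
        rw [← hτ]; gcongr; linarith
      have e2 : 1 / (24 * K ^ 3) ≤ 1 / (24 * K) := by gcongr
      have e3 : 32 * L * (1 / (24 * K)) ≤ 1 := by
        rw [mul_one_div, div_le_one (by positivity)]; linarith
      calc 32 * L * κ ^ 3 * (τ * α) = 32 * L * (τ * κ ^ 3) * α := by ring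
        _ ≤ 32 * L * (1 / (24 * K)) * 1 := by gcongr; exact e1.trans e2
        _ ≤ 1 := by linarith
    have key : ∀ n ≤ T, P.Phi (mean (s n).x) ≤ P.Phi (mean (s 0).x)
        - τ * α / 2 * ∑ t ∈ Finset.range n, ‖gradient P.Phi (mean (s t).x)‖ ^ 2
        - τ * α / 4 * ∑ t ∈ Finset.range n, ‖mean (s t).h‖ ^ 2
        + τ * α / 2 * ∑ t ∈ Finset.range n, errH P (s t) := by
      intro n
      induction n with
      | zero => intro _; simp
      | succ n ih =>
        intro hn
        have e1 := ih (by omega)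
        have e2 := hs.Phi_detStep_le hN hL hμ hκ hκ1 hW hα (R := R n) (s := s n) hτ0 hτα
        rw [← hstep n (by omega)] at e2
        rw [Finset.sum_range_succ, Finset.sum_range_succ, Finset.sum_range_succ]
        linarith
    have e1 := key T le_rfl
    change _ ≤ _ - τ * α / 2 * SG - τ * α / 4 * B + τ * α / 2 * Seh at e1
    have e2 := hi.gap (mean (s T).x)
    -- The normalisation `τκ⁴ = 1/(24K³)` accounts for the factor `96 = 4 · 24`.
    have e3 : 96 * K ^ 3 * κ ^ 4 * (D / α) = 4 * D / (τ * α) := by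
      have : 96 * K ^ 3 * (τ * κ ^ 4) = 4 := by rw [hτ]; field_simp; norm_num
      rw [eq_div_iff (by positivity)]
      calc 96 * K ^ 3 * κ ^ 4 * (D / α) * (τ * α) = 96 * K ^ 3 * (τ * κ ^ 4) * D * (α / α) := by ring
        _ = 4 * D := by rw [this, div_self hα.ne', mul_one]
    have e4 : B + 2 * SG - 2 * Seh ≤ 4 * D / (τ * α) := by
      rw [le_div_iff₀ (by positivity)]
      linarith
    linarith
  have h0 : κ ^ 2 * (spread (s 0).x / (1 - ρ) + spread (s 0).y / (1 - ρ)) + spread (s 0).z / (1 - ρ)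
      ≤ D / N / (1 - ρ) := by
    have := div_le_div_of_nonneg_right (hi.spread_le hN) hr.le
    refine le_trans (le_of_eq ?_) this
    ring
  rw [hE] at h3 h4
  rw [← hqd] at hq ⊢
  exact sum_gradient_le hκ1 (by linarith) rfl hτ (by positivity) hq0 hq hTε hT1 hT2
    hSx0 hSy0 hSz0 hSey0 hSez0 hSG0 hB0 (div_nonneg (spread_nonneg _) hr.le) (by positivity)
    h0 h1 h2 h3 h4 h5 h6 h7 h8

end Trajectory

/-! ### Noiseless oracles and the accuracy of the product rules. -/

section Oracles

variable {X Y : Type*} [NormedAddCommGroup X] [InnerProductSpace ℝ X] [CompleteSpace X]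
  [NormedAddCommGroup Y] [InnerProductSpace ℝ Y] [CompleteSpace Y]
  {N : ℕ} {Ξ : Type u} {Z : Type v} [MeasurableSpace Ξ] [MeasurableSpace Z]
  {P : Problem N X Y Ξ Z} {Lf Ldf Ldg Lddg μ : ℝ}

lemma UnbiasedOracle.ae_eq {S : Type*} [MeasurableSpace S] {E : Type*} [NormedAddCommGroup E]
    [NormedSpace ℝ E] {ν : Measure S} {o : S → E} {m : E} (h : UnbiasedOracle ν o m 0) :
    ∀ᵐ s ∂ν, o s = m := by
  obtain ⟨hi, -, h0⟩ := h
  have hm : AEMeasurable (fun s => ‖o s - m‖ₑ ^ 2) ν :=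
    (hi.aestronglyMeasurable.sub aestronglyMeasurable_const).enorm.pow_const 2
  have h1 : ∫⁻ s, ‖o s - m‖ₑ ^ 2 ∂ν = 0 := by
    refine le_antisymm (h0.trans ?_) (zero_le)
    simp
  rw [lintegral_eq_zero_iff' hm] at h1
  filter_upwards [h1] with s hs
  have : ‖o s - m‖ₑ = 0 := by simpa using hs
  exact sub_eq_zero.1 (enorm_eq_zero.1 this)

lemma contDiff_gradient {E : Type*} [NormedAddCommGroup E] [InnerProductSpace ℝ E]
    [CompleteSpace E] {φ : E → ℝ} (h : ContDiff ℝ 2 φ) : ContDiff ℝ 1 (gradient φ) := by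
  have h1 : ContDiff ℝ 1 (fderiv ℝ φ) := h.fderiv_right (by norm_num)
  exact (InnerProductSpace.toDual ℝ E).symm.toContinuousLinearEquiv.contDiff.comp h1

lemma continuous_hess12_line {φ : Joint X Y → ℝ} (h : Continuous (hess φ)) (x : X) (y z : Y) :
    Continuous fun s : ℝ => hess12 φ x (y + s • z) z := by
  have h1 : Continuous fun s : ℝ => pair x (y + s • z) :=
    continuous_iff_continuousAt.2 fun s => (hasDerivAt_pair_line x y z s).continuousAt
  have h2 : Continuous fun s : ℝ => hess φ (pair x (y + s • z)) (inclY X Y z) :=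
    (h.comp h1).clm_apply continuous_const
  exact (WithLp.fstL 2 ℝ X Y).continuous.comp h2

lemma Problem.Smooth.continuous_hess_g (hs : P.Smooth Lf Ldf Ldg Lddg μ) (i : Fin N) :
    Continuous (hess (P.g i)) := by
  have h : LipschitzWith Lddg.toNNReal (hess (P.g i)) :=
    LipschitzWith.of_dist_le_mul fun v v' => by
      rw [dist_eq_norm, dist_eq_norm]
      exact (hs.lip_hess_g i v v').trans (by gcongr; exact Real.le_coe_toNNReal _)
  exact h.continuous

/-- Differences of the sampled `∇₁G` along `y` agree almost surely with those of `∇₁gᵢ`: they are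
determined by `∇²₁₂G`. -/
lemma Problem.Stochastic.ae_grad1_sub_eq (hst : P.Stochastic 0)
    (hs : P.Smooth Lf Ldf Ldg Lddg μ) (i : Fin N) (x : X) (y z : Y) (a b : ℝ) :
    ∀ᵐ ζ ∂P.Dg i, grad1 (P.G ζ) x (y + a • z) - grad1 (P.G ζ) x (y + b • z)
      = grad1 (P.g i) x (y + a • z) - grad1 (P.g i) x (y + b • z) := by
  -- Almost sure equality is available at countably many points only; rational points of the line
  -- suffice because both Hessians are continuous. Equal derivatives then make the difference of the
  -- two gradients constant along the line.
  have h : ∀ᵐ ζ ∂P.Dg i, ∀ q : ℚ,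
      hess12 (P.G ζ) x (y + (q : ℝ) • z) = hess12 (P.g i) x (y + (q : ℝ) • z) :=
    ae_all_iff.2 fun q => (hst.G12 i x (y + (q : ℝ) • z)).ae_eq
  filter_upwards [h] with ζ hζ
  have hG := contDiff_gradient (hst.diff_G ζ)
  have hGd : Differentiable ℝ (gradient (P.G ζ)) := hG.differentiable (by norm_num)
  have hGc : Continuous (hess (P.G ζ)) := hG.continuous_fderiv (by norm_num)
  have heq : (fun s : ℝ => hess12 (P.G ζ) x (y + s • z) z)
      = fun s : ℝ => hess12 (P.g i) x (y + s • z) z := by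
    refine Rat.denseRange_cast.equalizer (continuous_hess12_line hGc x y z)
      (continuous_hess12_line (hs.continuous_hess_g i) x y z) (funext fun q => ?_)
    simp only [Function.comp_apply, hζ q]
  have hd : ∀ s : ℝ, HasDerivAt
      (fun s : ℝ => grad1 (P.G ζ) x (y + s • z) - grad1 (P.g i) x (y + s • z)) 0 s := fun s =>
    ((hasDerivAt_grad1_line hGd x y z s).sub
      (hasDerivAt_grad1_line (hs.diff_grad_g i) x y z s)).congr_deriv
      (sub_eq_zero.2 (congrFun heq s))
  have hc := is_const_of_deriv_eq_zero (fun s => (hd s).differentiableAt)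
    (fun s => (hd s).deriv) a b
  rw [sub_eq_sub_iff_sub_eq_sub]
  exact hc

/-- On the sample losses of `P` the product rule gives almost surely the same values as on the
local losses. -/
def RuleExact (P : Problem N X Y Ξ Z) (R : ProductRule X Y) : Prop :=
  ∀ i x y z, ∀ᵐ ζ ∂P.Dg i,
    R.pH (P.G ζ) x y z = R.pH (P.g i) x y z ∧ R.pJ (P.G ζ) x y z = R.pJ (P.g i) x y z

lemma Problem.Stochastic.ruleExact_secondOrder (hst : P.Stochastic 0) :
    RuleExact P (secondOrder X Y) := fun i x y z => by
  filter_upwards [(hst.G22 i x y).ae_eq, (hst.G12 i x y).ae_eq] with ζ h1 h2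
  exact ⟨congrArg (· z) h1, congrArg (· z) h2⟩

lemma Problem.Stochastic.ruleExact_firstOrder (hst : P.Stochastic 0)
    (hs : P.Smooth Lf Ldf Ldg Lddg μ) (δ : ℝ) : RuleExact P (firstOrder X Y δ) :=
  fun i x y z => by
  filter_upwards [(hst.G2 i x (y + δ • z)).ae_eq, (hst.G2 i x (y - δ • z)).ae_eq,
    hst.ae_grad1_sub_eq hs i x y z δ (-δ)] with ζ h1 h2 h3
  rw [neg_smul, ← sub_eq_add_neg] at h3
  simp only [firstOrder, h1, h2, h3, and_self]

lemma ruleError_secondOrder (s : State N X Y) {ε : ℝ} (hε : 0 ≤ ε) :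
    RuleError P (secondOrder X Y) s ε := fun j => by
  simp [secondOrder, hε]

/-- Along the segment the directional derivative varies with Lipschitz constant `Lddg ‖z‖²`: one
factor `‖z‖` from the displacement, one from the vector to which the Hessian is applied. -/
lemma Problem.Smooth.ruleError_firstOrder (hs : P.Smooth Lf Ldf Ldg Lddg μ) (hL : 0 ≤ Lddg)
    {δ ε : ℝ} (hδ : 0 < δ) {s : State N X Y} (h : ∀ i, Lddg * δ * ‖s.z i‖ ^ 2 ≤ ε) :
    RuleError P (firstOrder X Y δ) s ε := fun j => by
  set x := s.x j
  set y := s.y j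
  set z := s.z j
  have hp : ∀ r : ℝ, ‖pair x (y + r • z) - pair x (y + (0 : ℝ) • z)‖ = |r| * ‖z‖ := fun r => by
    rw [norm_pair_sub_left, zero_smul, add_zero, add_sub_cancel_left, norm_smul, Real.norm_eq_abs]
  have hC : 0 ≤ Lddg * ‖z‖ ^ 2 := by positivity
  have hle : Lddg * ‖z‖ ^ 2 * δ ≤ ε := by have := h j; linarith
  constructor
  · have h1 := norm_central_diff_sub_le hC hδ (hasDerivAt_grad2_line (hs.diff_grad_g j) x y z)
      fun r => by
        rw [← sub_apply]
        refine (ContinuousLinearMap.le_opNorm _ _).trans ?_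
        have h2 := (norm_hess22_sub_le (φ := P.g j) (P.g j) x x (y + r • z)
          (y + (0 : ℝ) • z)).trans (hs.lip_hess_g j _ _)
        rw [hp] at h2
        exact (mul_le_mul_of_nonneg_right h2 (norm_nonneg z)).trans (le_of_eq (by ring))
    rw [zero_smul, add_zero, neg_smul, ← sub_eq_add_neg] at h1
    exact h1.trans hle
  · have h1 := norm_central_diff_sub_le hC hδ (hasDerivAt_grad1_line (hs.diff_grad_g j) x y z)
      fun r => by
        rw [← sub_apply]
        refine (ContinuousLinearMap.le_opNorm _ _).trans ?_
        have h2 := (norm_hess12_sub_le (φ := P.g j) (P.g j) x x (y + r • z)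
          (y + (0 : ℝ) • z)).trans (hs.lip_hess_g j _ _)
        rw [hp] at h2
        exact (mul_le_mul_of_nonneg_right h2 (norm_nonneg z)).trans (le_of_eq (by ring))
    rw [zero_smul, add_zero, neg_smul, ← sub_eq_add_neg] at h1
    exact h1.trans hle

/-- The trajectory of the algorithm run with the local losses. -/
def detRun (P : Problem N X Y Ξ Z) (W : Matrix (Fin N) (Fin N) ℝ) (τ α : ℝ)
    (R : ℕ → ProductRule X Y) (s₀ : State N X Y) : ℕ → State N X Y :=
  iterate W τ α α α α R (fun _ => P.f) (fun _ => P.g) s₀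

lemma detRun_succ (W : Matrix (Fin N) (Fin N) ℝ) (τ α : ℝ)
    (R : ℕ → ProductRule X Y) (s₀ : State N X Y) (t : ℕ) :
    detRun P W τ α R s₀ (t + 1) = detStep P W τ α (R t) (detRun P W τ α R s₀ t) := rfl

/-- The oracles are compared at the points of the nonrandom trajectory, one null set for each time
and node. Off these null sets induction identifies the two runs. Only the laws of the samples
matter; their independence is irrelevant. -/
lemma Problem.Stochastic.ae_iterate_eq {Ω : Type w} [MeasurableSpace Ω] {ℙ : Measure Ω}
    (hst : P.Stochastic 0) {W : Matrix (Fin N) (Fin N) ℝ} {τ α : ℝ} {R : ℕ → ProductRule X Y}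
    (hR : ∀ t, RuleExact P (R t)) (s₀ : State N X Y) {ξ : ℕ → Fin N → Ω → Ξ}
    {ζ : ℕ → Fin N → Ω → Z} (hξ : ∀ t i, ProbabilityTheory.HasLaw (ξ t i) (P.Df i) ℙ)
    (hζ : ∀ t i, ProbabilityTheory.HasLaw (ζ t i) (P.Dg i) ℙ) :
    ∀ᵐ ω ∂ℙ, iterate W τ α α α α R (fun t i => P.F (ξ t i ω)) (fun t i => P.G (ζ t i ω)) s₀
      = detRun P W τ α R s₀ := by
  set d := detRun P W τ α R s₀
  have hf : ∀ᵐ ω ∂ℙ, ∀ t i,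
      grad1 (P.F (ξ t i ω)) ((d t).x i) ((d t).y i) = grad1 (P.f i) ((d t).x i) ((d t).y i) ∧
      grad2 (P.F (ξ t i ω)) ((d t).x i) ((d t).y i) = grad2 (P.f i) ((d t).x i) ((d t).y i) :=
    ae_all_iff.2 fun t => ae_all_iff.2 fun i => by
      refine ae_of_ae_map (p := fun ξ =>
        grad1 (P.F ξ) ((d t).x i) ((d t).y i) = grad1 (P.f i) ((d t).x i) ((d t).y i) ∧
        grad2 (P.F ξ) ((d t).x i) ((d t).y i) = grad2 (P.f i) ((d t).x i) ((d t).y i))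
        (hξ t i).aemeasurable ?_
      rw [(hξ t i).map_eq]
      exact (hst.F1 i _ _).ae_eq.and (hst.F2 i _ _).ae_eq
  have hg : ∀ᵐ ω ∂ℙ, ∀ t i,
      grad2 (P.G (ζ t i ω)) ((d t).x i) ((d t).y i) = grad2 (P.g i) ((d t).x i) ((d t).y i) ∧
      (R t).pH (P.G (ζ t i ω)) ((d t).x i) ((d t).y i) ((d t).z i)
        = (R t).pH (P.g i) ((d t).x i) ((d t).y i) ((d t).z i) ∧
      (R t).pJ (P.G (ζ t i ω)) ((d t).x i) ((d t).y i) ((d t).z i)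
        = (R t).pJ (P.g i) ((d t).x i) ((d t).y i) ((d t).z i) :=
    ae_all_iff.2 fun t => ae_all_iff.2 fun i => by
      refine ae_of_ae_map (p := fun ζ =>
        grad2 (P.G ζ) ((d t).x i) ((d t).y i) = grad2 (P.g i) ((d t).x i) ((d t).y i) ∧
        (R t).pH (P.G ζ) ((d t).x i) ((d t).y i) ((d t).z i)
          = (R t).pH (P.g i) ((d t).x i) ((d t).y i) ((d t).z i) ∧
        (R t).pJ (P.G ζ) ((d t).x i) ((d t).y i) ((d t).z i)
          = (R t).pJ (P.g i) ((d t).x i) ((d t).y i) ((d t).z i))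
        (hζ t i).aemeasurable ?_
      rw [(hζ t i).map_eq]
      exact (hst.G2 i _ _).ae_eq.and (hR t i _ _ _)
  filter_upwards [hf, hg] with ω h1 h2
  funext t
  induction t with
  | zero => rfl
  | succ t ih =>
    change step W τ α α α α (R t) _ _ (iterate W τ α α α α R (fun t i => P.F (ξ t i ω))
      (fun t i => P.G (ζ t i ω)) s₀ t) = step W τ α α α α (R t) P.f P.g (d t)
    rw [ih]
    simp only [step, h1 t, h2 t]

/-- Perturbations can be chosen along the noiseless trajectory so that all of them are small. -/
lemma exists_smallPerturbation (P : Problem N X Y Ξ Z) (W : Matrix (Fin N) (Fin N) ℝ) (τ α : ℝ)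
    (s₀ : State N X Y) (T : ℕ) {ι : ℝ} (hL : 0 < Lddg) (hι : 0 < ι) : ∃ δ : ℕ → ℝ,
    SmallPerturbation Lddg ι T δ (detRun P W τ α (fun t => firstOrder X Y (δ t)) s₀) := by
  -- The perturbation depends on the current state alone, so states and perturbations can be built
  -- together by recursion; the summand `1` keeps the quotient positive and finite.
  let pick : State N X Y → ℝ := fun s => √3 * ι / (1 + Lddg * ∑ i, ‖s.z i‖ ^ 2)
  let st : ℕ → State N X Y := fun t =>
    Nat.rec s₀ (fun _ s => detStep P W τ α (firstOrder X Y (pick s)) s) t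
  have hst : detRun P W τ α (fun t => firstOrder X Y (pick (st t))) s₀ = st := by
    funext t
    induction t with
    | zero => rfl
    | succ t ih => rw [detRun_succ, ih]
  refine ⟨fun t => pick (st t), fun t _ => ?_⟩
  rw [hst]
  have h0 : 0 ≤ ∑ i, ‖(st t).z i‖ ^ 2 := Finset.sum_nonneg fun _ _ => sq_nonneg _
  have h1 : 0 < 1 + Lddg * ∑ i, ‖(st t).z i‖ ^ 2 := by positivity
  have h3 : 0 < √3 * ι := by positivity
  refine ⟨div_pos h3 h1, fun i => ?_⟩
  have h2 : ‖(st t).z i‖ ^ 2 ≤ ∑ i, ‖(st t).z i‖ ^ 2 :=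
    Finset.single_le_sum (f := fun i => ‖(st t).z i‖ ^ 2) (fun _ _ => sq_nonneg _)
      (Finset.mem_univ i)
  have h4 : Lddg * ‖(st t).z i‖ ^ 2 ≤ 1 + Lddg * ∑ i, ‖(st t).z i‖ ^ 2 := by
    have := mul_le_mul_of_nonneg_left h2 hL.le
    linarith
  change Lddg * (√3 * ι / (1 + Lddg * ∑ i, ‖(st t).z i‖ ^ 2)) * ‖(st t).z i‖ ^ 2 ≤ √3 * ι
  rw [mul_div_assoc', div_mul_eq_mul_div, div_le_iff₀ h1]
  nlinarith

end Oracles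

/-! ### Balancing the step size against heterogeneity. -/

section StepSize

/-- The term of the rate that stems from the heterogeneity of the nodes. -/
def rateTerm (ρ T b k : ℝ) : ℝ :=
  ρ ^ (2 / 3 : ℝ) * (b ^ (2 / 3 : ℝ) * k) / (T ^ (2 / 3 : ℝ) * (1 - ρ) ^ (2 / 3 : ℝ))

lemma rpow_two_thirds_pow_three {x : ℝ} (hx : 0 ≤ x) : (x ^ (2 / 3 : ℝ)) ^ 3 = x ^ 2 := by
  rw [← Real.rpow_natCast, ← Real.rpow_mul hx, ← Real.rpow_natCast x 2]
  norm_num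

lemma rateTerm_nonneg {ρ T b k : ℝ} (hρ : 0 ≤ ρ) (hρ1 : ρ < 1) (hT : 0 < T) (hb : 0 ≤ b)
    (hk : 0 ≤ k) : 0 ≤ rateTerm ρ T b k := by
  have : 0 < 1 - ρ := by linarith
  unfold rateTerm
  positivity

lemma rateTerm_pow_three {ρ T b k : ℝ} (hρ : 0 ≤ ρ) (hρ1 : ρ < 1) (hT : 0 < T) (hb : 0 ≤ b) :
    rateTerm ρ T b k ^ 3 * T ^ 2 = (ρ / (1 - ρ)) ^ 2 * b ^ 2 * k ^ 3 := by
  have : 0 < 1 - ρ := by linarith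
  unfold rateTerm
  rw [div_pow, mul_pow, mul_pow, mul_pow, rpow_two_thirds_pow_three hρ,
    rpow_two_thirds_pow_three hb, rpow_two_thirds_pow_three hT.le,
    rpow_two_thirds_pow_three this.le]
  field_simp

/-- A step size below `κ⁵ / (T r)` balances the heterogeneity term against `r`. -/
lemma heterogeneity_le_rateTerm {ρ T b k α κ : ℝ} {m n : ℕ} (hρ : 0 ≤ ρ) (hρ1 : ρ < 1) (hT : 0 < T)
    (hb : 0 ≤ b) (hκ : 1 ≤ κ) (hk : k ^ 3 = κ ^ (m + n)) (hk0 : 0 ≤ k) (hn : 10 ≤ n) (hα : 0 ≤ α)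
    (h : α * (T * rateTerm ρ T b k) ≤ κ ^ 5) :
    (ρ * α / (1 - ρ)) ^ 2 * (κ ^ m * b ^ 2) ≤ rateTerm ρ T b k := by
  have hR := rateTerm_nonneg hρ hρ1 hT hb hk0
  have h3 := rateTerm_pow_three (k := k) hρ hρ1 hT hb
  set R := rateTerm ρ T b k
  have hκ0 : 0 < κ := by linarith
  -- The exponents `2/3` are such that `R³T²` is the heterogeneity coefficient; the left side is
  -- then quadratic in `αTR`, to which the bound `κ⁵` applies.
  have h1 : κ ^ n * ((ρ * α / (1 - ρ)) ^ 2 * (κ ^ m * b ^ 2)) = (α * (T * R)) ^ 2 * R := by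
    rw [hk, pow_add] at h3
    calc κ ^ n * ((ρ * α / (1 - ρ)) ^ 2 * (κ ^ m * b ^ 2))
        = α ^ 2 * ((ρ / (1 - ρ)) ^ 2 * b ^ 2 * (κ ^ m * κ ^ n)) := by ring
      _ = (α * (T * R)) ^ 2 * R := by rw [← h3]; ring
  have h2 : (α * (T * R)) ^ 2 * R ≤ κ ^ n * R := by
    have : (α * (T * R)) ^ 2 ≤ (κ ^ 5) ^ 2 := pow_le_pow_left₀ (by positivity) h 2
    rw [← pow_mul] at this
    exact mul_le_mul_of_nonneg_right (this.trans (pow_le_pow_right₀ hκ hn)) hR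
  rw [← h1] at h2
  exact le_of_mul_le_mul_left h2 (by positivity)

end StepSize

/-! ### The explicit rate for the deterministic run. -/

section Rate

variable {X Y : Type*} [NormedAddCommGroup X] [InnerProductSpace ℝ X] [CompleteSpace X]
  [NormedAddCommGroup Y] [InnerProductSpace ℝ Y] [CompleteSpace Y]
  [FiniteDimensional ℝ X] [FiniteDimensional ℝ Y]
  {N : ℕ} {Ξ : Type u} {Z : Type v} [MeasurableSpace Ξ] [MeasurableSpace Z]
  {P : Problem N X Y Ξ Z} {L μ κ b₁ b₂ ρ D : ℝ} {W : Matrix (Fin N) (Fin N) ℝ}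

/-- The reciprocal of the step size. -/
def invStep (L κ ρ T b₁ b₂ : ℝ) : ℝ :=
  80 * recConst L ^ 3 * (κ + ρ * κ / (1 - ρ))
    + T / κ ^ 5 * (rateTerm ρ T b₁ (κ ^ (16 / 3 : ℝ)) + rateTerm ρ T b₂ (κ ^ 6))

lemma recConst_pos {L : ℝ} (hL : 0 < L) : 0 < recConst L := by
  linarith [(recConst_bounds hL).1]

lemma invStep_pos {T : ℝ} (hL : 0 < L) (hκ : 0 < κ) (hρ : 0 ≤ ρ) (hρ1 : ρ < 1) (hT : 0 < T)
    (hb₁ : 0 ≤ b₁) (hb₂ : 0 ≤ b₂) : 0 < invStep L κ ρ T b₁ b₂ := by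
  have hr : 0 < 1 - ρ := by linarith
  have hK := recConst_pos hL
  have h1 := rateTerm_nonneg (k := κ ^ (16 / 3 : ℝ)) hρ hρ1 hT hb₁ (by positivity)
  have h2 := rateTerm_nonneg (k := κ ^ 6) hρ hρ1 hT hb₂ (by positivity)
  unfold invStep
  positivity

/-- The constant of the rate. -/
def rateConst (L D : ℝ) : ℝ := 312 * recConst L ^ 4 * (D * (80 * recConst L ^ 3) + D + 5)

/-- The rate for the noiseless run with product rules of accuracy `2 / T`. -/
theorem Problem.Smooth.avgSqGrad_le {T : ℕ} {α : ℝ} {s : ℕ → State N X Y}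
    {R : ℕ → ProductRule X Y}
    (hs : P.Smooth L L L L μ) (hN : 0 < N) (hT : 0 < T) (hL : 0 < L) (hμ : 0 < μ)
    (hκ : κ * μ = L) (hκ1 : 1 ≤ κ) (hb₁ : 0 ≤ b₁) (hb₂ : 0 ≤ b₂) (hd : P.Dissimilar b₁ b₂)
    (hW : IsMixing W) (hρ : mixingRate W = ρ) (hρ1 : ρ < 1) (hD : 0 ≤ D)
    (hα : α = (invStep L κ ρ T b₁ b₂)⁻¹)
    (hi : InitBound P κ (s 0) D)
    (hstep : ∀ t < T, s (t + 1)
      = detStep P W (1 / (24 * recConst L ^ 3) * κ ^ (-4 : ℤ)) α (R t) (s t))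
    (hR : ∀ t < T, RuleError P (R t) (s t) (2 * (T : ℝ)⁻¹)) :
    avgSqGrad P T s ≤ rateConst L D *
      (ρ ^ (2 / 3 : ℝ) * (b₁ ^ (2 / 3 : ℝ) * κ ^ (16 / 3 : ℝ) + b₂ ^ (2 / 3 : ℝ) * κ ^ 6)
            / ((T : ℝ) ^ (2 / 3 : ℝ) * (1 - ρ) ^ (2 / 3 : ℝ))
          + ρ * κ ^ 6 / ((1 - ρ) * T) + κ ^ 4 / ((1 - ρ) * N * T) + κ ^ 13 / T) := by
  have hρ0 : 0 ≤ ρ := hρ ▸ norm_nonneg _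
  have hr : 0 < 1 - ρ := by linarith
  have hκ0 : 0 < κ := by linarith
  have hT' : (0 : ℝ) < T := by positivity
  have hT1 : (1 : ℝ) ≤ T := by exact_mod_cast hT
  have hN' : (0 : ℝ) < N := by positivity
  obtain ⟨k1, -, -, k4, -⟩ := recConst_bounds hL
  have hinv := invStep_pos hL hκ0 hρ0 hρ1 hT' hb₁ hb₂
  have hα0 : 0 < α := by rw [hα]; positivity
  have hαinv : α⁻¹ = invStep L κ ρ T b₁ b₂ := by rw [hα, inv_inv]
  have hαmul : α * invStep L κ ρ T b₁ b₂ = 1 := by rw [hα, inv_mul_cancel₀ hinv.ne']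
  have hR1 := rateTerm_nonneg (k := κ ^ (16 / 3 : ℝ)) hρ0 hρ1 hT' hb₁ (by positivity)
  have hR2 := rateTerm_nonneg (k := κ ^ 6) hρ0 hρ1 hT' hb₂ (by positivity)
  have hk : (κ ^ (16 / 3 : ℝ)) ^ 3 = κ ^ (2 + 14) := by
    rw [← Real.rpow_natCast, ← Real.rpow_mul hκ0.le, ← Real.rpow_natCast]
    norm_num
  have hrate : ρ ^ (2 / 3 : ℝ) * (b₁ ^ (2 / 3 : ℝ) * κ ^ (16 / 3 : ℝ) + b₂ ^ (2 / 3 : ℝ) * κ ^ 6)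
        / ((T : ℝ) ^ (2 / 3 : ℝ) * (1 - ρ) ^ (2 / 3 : ℝ))
      = rateTerm ρ T b₁ (κ ^ (16 / 3 : ℝ)) + rateTerm ρ T b₂ (κ ^ 6) := by
    unfold rateTerm; ring
  rw [hrate]
  have het1 := fun h => heterogeneity_le_rateTerm (m := 2) (n := 14) hρ0 hρ1 hT' hb₁ hκ1 hk
    (by positivity) (by norm_num) hα0.le h
  have het2 := fun h => heterogeneity_le_rateTerm (m := 6) (n := 12) hρ0 hρ1 hT' hb₂ hκ1
    (k := κ ^ 6) (by ring) (by positivity) (by norm_num) hα0.le h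
  unfold rateConst
  have hmain := fun h1 h2 h3 h4 => hs.sum_sq_gradient_le hN hL hμ hκ hκ1 hd hW hρ hρ1 hα0 h1 h2 h3
    h4 hD hi hstep hR
  unfold invStep at hαinv hαmul
  obtain ⟨K, hK⟩ : ∃ K, K = recConst L := ⟨_, rfl⟩
  obtain ⟨R₁, hR₁⟩ : ∃ R₁, R₁ = rateTerm ρ T b₁ (κ ^ (16 / 3 : ℝ)) := ⟨_, rfl⟩
  obtain ⟨R₂, hR₂⟩ : ∃ R₂, R₂ = rateTerm ρ T b₂ (κ ^ 6) := ⟨_, rfl⟩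
  simp only [← hK, ← hR₁, ← hR₂] at hαinv hαmul hR1 hR2 het1 het2 hmain k1 k4 ⊢
  clear hrate hk hR₁ hR₂ hstep hR
  have hK3 : 1 ≤ K ^ 3 := one_le_pow₀ (by linarith)
  have hKK : K ≤ K ^ 3 := le_self_pow₀ (by linarith) (by norm_num)
  have a1 : 0 ≤ α * (80 * K ^ 3 * κ) := by positivity
  have a2 : 0 ≤ α * (80 * K ^ 3 * (ρ * κ / (1 - ρ))) := by positivity
  have a3 : 0 ≤ α * (T / κ ^ 5 * R₁) := by positivity
  have a4 : 0 ≤ α * (T / κ ^ 5 * R₂) := by positivity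
  -- The reciprocal step size is a sum of nonnegative terms, so `α` times each is at most `1`. The
  -- first gives `α ≤ 1` and `α L² ≤ μ`, the second the smallness needed for consensus, the last two
  -- the balance with heterogeneity.
  have asum : α * (80 * K ^ 3 * κ) + α * (80 * K ^ 3 * (ρ * κ / (1 - ρ)))
      + α * (T / κ ^ 5 * R₁) + α * (T / κ ^ 5 * R₂) = 1 := by
    linear_combination hαmul
  have hακ : α * (80 * K ^ 3 * κ) ≤ 1 := by linarith
  have hακρ : α * (80 * K ^ 3 * (ρ * κ / (1 - ρ))) ≤ 1 := by linarith
  have hαR : ∀ R, α * (T / κ ^ 5 * R) ≤ 1 → α * (T * R) ≤ κ ^ 5 := fun R h => by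
    have : α * (T / κ ^ 5 * R) = α * (T * R) / κ ^ 5 := by ring
    rw [this, div_le_one (by positivity)] at h
    exact h
  have h1 : α ≤ 1 := by
    refine le_trans (le_mul_of_one_le_right hα0.le ?_) hακ
    nlinarith
  have h2 : α * L ^ 2 ≤ μ := by
    have e1 : α * (L * κ) ≤ 1 := le_trans (by gcongr; linarith) hακ
    have e2 : α * L ^ 2 = α * (L * κ) * μ := by rw [← hκ]; ring
    rw [e2]
    nlinarith
  have h3 : 1 / (24 * K ^ 3) * κ ^ (-4 : ℤ) * κ ^ 4 = 1 / (24 * K ^ 3) := by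
    rw [mul_assoc, zpow_neg, show κ ^ (4 : ℤ) = κ ^ 4 from zpow_natCast κ 4,
      inv_mul_cancel₀ (by positivity), mul_one]
  have h4 : (ρ * α / (1 - ρ)) ^ 2 * κ ^ 2 * (80 * K ^ 3) ≤ 1 := by
    have e1 : (ρ * α / (1 - ρ)) ^ 2 * κ ^ 2 * (80 * K ^ 3) * (80 * K ^ 3)
        = (α * (80 * K ^ 3 * (ρ * κ / (1 - ρ)))) ^ 2 := by ring
    have e2 : (α * (80 * K ^ 3 * (ρ * κ / (1 - ρ)))) ^ 2 ≤ 1 := pow_le_one₀ a2 hακρ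
    have e3 : 0 ≤ (ρ * α / (1 - ρ)) ^ 2 * κ ^ 2 * (80 * K ^ 3) := by positivity
    nlinarith
  have hm := hmain h1 h2 h3 h4
  have g1 := het1 (hαR _ (by linarith))
  have g2 := het2 (hαR _ (by linarith))
  unfold avgSqGrad
  have hm' := mul_le_mul_of_nonneg_left hm (inv_nonneg.2 hT'.le)
  refine hm'.trans ?_
  -- Each part of `1/α` becomes one term of the rate. The argument yields `κ⁶/T` here; the power
  -- `κ¹³` of the rate is reached only by weakening.
  have t1 : (T : ℝ)⁻¹ * (κ ^ 5 * (D / α)) = D * (80 * K ^ 3) * (κ ^ 6 / T)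
      + D * (80 * K ^ 3) * (ρ * κ ^ 6 / ((1 - ρ) * T)) + D * (R₁ + R₂) := by
    rw [div_eq_mul_inv, hαinv]
    field_simp
  have t2 : (T : ℝ)⁻¹ * (κ ^ 2 * (T * (2 * (T : ℝ)⁻¹) ^ 2)) ≤ 4 * (κ ^ 13 / T) := by
    have e1 : (T : ℝ)⁻¹ * (κ ^ 2 * (T * (2 * (T : ℝ)⁻¹) ^ 2)) = 4 * (κ ^ 2 / T ^ 2) := by
      field_simp; norm_num
    rw [e1]
    have e2 : (T : ℝ) ≤ T ^ 2 := le_self_pow₀ hT1 (by norm_num)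
    have e3 : κ ^ 2 ≤ κ ^ 13 := pow_le_pow_right₀ hκ1 (by norm_num)
    gcongr
  have t3 : (T : ℝ)⁻¹ * (κ ^ 4 * (D / N / (1 - ρ))) = D * (κ ^ 4 / ((1 - ρ) * N * T)) := by
    field_simp
  have t4 : (T : ℝ)⁻¹ * ((ρ * α / (1 - ρ)) ^ 2 * (κ ^ 2 * (T * b₁ ^ 2) + κ ^ 6 * (T * b₂ ^ 2)))
      = (ρ * α / (1 - ρ)) ^ 2 * (κ ^ 2 * b₁ ^ 2) + (ρ * α / (1 - ρ)) ^ 2 * (κ ^ 6 * b₂ ^ 2) := by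
    have : (T : ℝ)⁻¹ * T = 1 := inv_mul_cancel₀ hT'.ne'
    linear_combination ((ρ * α / (1 - ρ)) ^ 2 * (κ ^ 2 * b₁ ^ 2)
      + (ρ * α / (1 - ρ)) ^ 2 * (κ ^ 6 * b₂ ^ 2)) * this
  have t5 : κ ^ 6 / T ≤ κ ^ 13 / T := by
    have e3 : κ ^ 6 ≤ κ ^ 13 := pow_le_pow_right₀ hκ1 (by norm_num)
    gcongr
  have n1 : 0 ≤ ρ * κ ^ 6 / ((1 - ρ) * T) := by positivity
  have n2 : 0 ≤ κ ^ 4 / ((1 - ρ) * N * T) := by positivity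
  have n3 : 0 ≤ κ ^ 13 / T := by positivity
  have n4 : 0 ≤ R₁ + R₂ := by positivity
  have hDA : 0 ≤ D * (80 * K ^ 3) := by positivity
  have hsum : (T : ℝ)⁻¹ * (κ ^ 5 * (D / α) + κ ^ 2 * (T * (2 * (T : ℝ)⁻¹) ^ 2)
      + κ ^ 4 * (D / N / (1 - ρ))
      + (ρ * α / (1 - ρ)) ^ 2 * (κ ^ 2 * (T * b₁ ^ 2) + κ ^ 6 * (T * b₂ ^ 2)))
      ≤ (D * (80 * K ^ 3) + D + 5) * (R₁ + R₂ + ρ * κ ^ 6 / ((1 - ρ) * T)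
        + κ ^ 4 / ((1 - ρ) * N * T) + κ ^ 13 / T) := by
    rw [mul_add, mul_add, mul_add, t1, t3, t4]
    have m1 := mul_le_mul_of_nonneg_left t5 hDA
    have m2 := mul_nonneg hDA n2
    have m3 := mul_nonneg hDA n4
    have m4 := mul_nonneg hD n1
    have m5 := mul_nonneg hD n3
    have m6 := mul_nonneg hDA n1
    have m7 := mul_nonneg hD n2
    have m8 := mul_nonneg hD n4
    simp only [add_mul, mul_add] at m3 m8 ⊢
    linarith
  calc (T : ℝ)⁻¹ * (312 * K ^ 4 * _) = 312 * K ^ 4 * ((T : ℝ)⁻¹ * _) := by rw [mul_left_comm]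
    _ ≤ 312 * K ^ 4 * _ := mul_le_mul_of_nonneg_left hsum (by positivity)
    _ = _ := by rw [mul_assoc (312 * K ^ 4)]

end Rate
end DSOBA
end

theorem corollary3 (L D : ℝ) (hL : 0 < L) (hD : 0 ≤ D) :
    ∃ C c₁ c₂ c₃ c₄ : ℝ, 0 < C ∧ 0 < c₁ ∧ 0 < c₂ ∧ 0 < c₃ ∧ 0 < c₄ ∧
    ∀ (N T : ℕ) (Lf Ldf Ldg Lddg μ b₁ b₂ ρ κ : ℝ),
      0 < N → 0 < T → 0 < Lf → 0 < Ldf → 0 < Ldg → 0 < Lddg → 0 < μ →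
      max (max Lf Ldf) (max Ldg Lddg) = L → κ = L / μ →
      0 ≤ b₁ → 0 ≤ b₂ → 0 ≤ ρ → ρ < 1 →
    ∃ α ι : ℝ, 0 < α ∧ 0 < ι ∧
    ∀ (d p : ℕ), 0 < p →
    ∀ (Ξ : Type u) (Z : Type v) (Ω : Type w)
      [MeasurableSpace Ξ] [MeasurableSpace Z] [MeasurableSpace Ω]
      (ℙ : Measure Ω) [IsProbabilityMeasure ℙ]
      (P : DSOBA.Problem N (EuclideanSpace ℝ (Fin d)) (EuclideanSpace ℝ (Fin p)) Ξ Z) (W : Matrix (Fin N) (Fin N) ℝ) (s₀ : DSOBA.State N (EuclideanSpace ℝ (Fin d)) (EuclideanSpace ℝ (Fin p)))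
      (ξ : ℕ → Fin N → Ω → Ξ) (ζ : ℕ → Fin N → Ω → Z),
      P.Smooth Lf Ldf Ldg Lddg μ → P.Dissimilar b₁ b₂ → P.Stochastic 0 →
      DSOBA.IsMixing W → DSOBA.mixingRate W = ρ →
      DSOBA.InitBound P κ s₀ D →
      (∀ t i, ProbabilityTheory.HasLaw (ξ t i) (P.Df i) ℙ) →
      (∀ t i, ProbabilityTheory.HasLaw (ζ t i) (P.Dg i) ℙ) →
      let run (R : ℕ → DSOBA.ProductRule (EuclideanSpace ℝ (Fin d)) (EuclideanSpace ℝ (Fin p))) (ω : Ω) : ℕ → DSOBA.State N (EuclideanSpace ℝ (Fin d)) (EuclideanSpace ℝ (Fin p)) :=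
        DSOBA.iterate W (c₄ * κ ^ (-4 : ℤ)) α (c₁ * α) (c₂ * α) (c₃ * α) R
          (fun t i => P.F (ξ t i ω)) (fun t i => P.G (ζ t i ω)) s₀
      let rate : ℝ :=
        ρ ^ (2 / 3 : ℝ) * (b₁ ^ (2 / 3 : ℝ) * κ ^ (16 / 3 : ℝ) + b₂ ^ (2 / 3 : ℝ) * κ ^ 6)
            / ((T : ℝ) ^ (2 / 3 : ℝ) * (1 - ρ) ^ (2 / 3 : ℝ))
          + ρ * κ ^ 6 / ((1 - ρ) * T) + κ ^ 4 / ((1 - ρ) * N * T) + κ ^ 13 / T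
      Differentiable ℝ P.Phi ∧
      (∀ᵐ ω ∂ℙ, DSOBA.avgSqGrad P T (run (fun _ => DSOBA.secondOrder (EuclideanSpace ℝ (Fin d)) (EuclideanSpace ℝ (Fin p))) ω) ≤ C * rate) ∧
      (∃ δ : ℕ → ℝ, ∀ᵐ ω ∂ℙ, DSOBA.SmallPerturbation Lddg ι T δ
        (run (fun t => DSOBA.firstOrder (EuclideanSpace ℝ (Fin d)) (EuclideanSpace ℝ (Fin p)) (δ t)) ω)) ∧
      (∀ δ : ℕ → ℝ, ∀ᵐ ω ∂ℙ, DSOBA.SmallPerturbation Lddg ι T δ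
          (run (fun t => DSOBA.firstOrder (EuclideanSpace ℝ (Fin d)) (EuclideanSpace ℝ (Fin p)) (δ t)) ω) →
        DSOBA.avgSqGrad P T (run (fun t => DSOBA.firstOrder (EuclideanSpace ℝ (Fin d)) (EuclideanSpace ℝ (Fin p)) (δ t)) ω) ≤ C * rate) := by
  have hK := DSOBA.recConst_pos hL
  -- All step sizes except that of `x` equal `α`; the last constant is the value of `τκ⁴` required
  -- by the drift absorption.
  refine ⟨DSOBA.rateConst L D, 1, 1, 1, 1 / (24 * DSOBA.recConst L ^ 3), ?_, one_pos, one_pos,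
    one_pos, by positivity, ?_⟩
  · unfold DSOBA.rateConst
    positivity
  intro N T Lf Ldf Ldg Lddg μ b₁ b₂ ρ κ hN hT _ _ _ hLddg hμ hmax hκ hb₁ hb₂ hρ0 hρ1
  have hκ0 : 0 < κ := hκ ▸ div_pos hL hμ
  have hκμ : κ * μ = L := by rw [hκ, div_mul_cancel₀ _ hμ.ne']
  have hT' : (0 : ℝ) < T := Nat.cast_pos.2 hT
  -- With `ι = 1/T` the finite differences have error at most `√3/T ≤ 2/T`, which adds at most
  -- `4κ²/T²` to the average before the common prefactor.
  refine ⟨(DSOBA.invStep L κ ρ T b₁ b₂)⁻¹, (T : ℝ)⁻¹,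
    inv_pos.2 (DSOBA.invStep_pos hL hκ0 hρ0 hρ1 hT' hb₁ hb₂), inv_pos.2 hT', ?_⟩
  intro d p hp Ξ Z Ω _ _ _ ℙ _ P W s₀ ξ ζ hs hd hst hW hρ hi hξ hζ
  simp only [one_mul]
  -- A positive lower-level dimension makes the space nontrivial, which `strong_convexity_le` needs
  -- for `1 ≤ κ`.
  have : Nonempty (Fin p) := ⟨⟨0, hp⟩⟩
  have hs' : P.Smooth L L L L μ := hs.mono
    (hmax ▸ (le_max_left _ _).trans (le_max_left _ _))
    (hmax ▸ (le_max_right _ _).trans (le_max_left _ _))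
    (hmax ▸ (le_max_left _ _).trans (le_max_right _ _))
    (hmax ▸ (le_max_right _ _).trans (le_max_right _ _))
  have hκ1 : 1 ≤ κ := by
    rw [hκ, one_le_div hμ]
    exact hs'.strong_convexity_le hN
  refine ⟨hs'.differentiable_Phi hN hL hμ hκμ hκ1, ?_, ?_, fun δ => ?_⟩
  · filter_upwards [hst.ae_iterate_eq (fun _ => hst.ruleExact_secondOrder) s₀ hξ hζ] with ω hω
    rw [hω]
    exact hs'.avgSqGrad_le hN hT hL hμ hκμ hκ1 hb₁ hb₂ hd hW hρ hρ1 hD rfl hi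
      (fun t _ => DSOBA.detRun_succ W _ _ _ s₀ t)
      fun t _ => DSOBA.ruleError_secondOrder _ (by positivity)
  · obtain ⟨δ, hδ⟩ := DSOBA.exists_smallPerturbation P W
      (1 / (24 * DSOBA.recConst L ^ 3) * κ ^ (-4 : ℤ)) (DSOBA.invStep L κ ρ T b₁ b₂)⁻¹ s₀ T hLddg
      (inv_pos.2 hT')
    refine ⟨δ, ?_⟩
    filter_upwards [hst.ae_iterate_eq (fun t => hst.ruleExact_firstOrder hs (δ t)) s₀ hξ hζ]
      with ω hω
    rw [hω]
    exact hδ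
  · filter_upwards [hst.ae_iterate_eq (fun t => hst.ruleExact_firstOrder hs (δ t)) s₀ hξ hζ]
      with ω hω
    rw [hω]
    intro hδ
    have h3 : √3 * (T : ℝ)⁻¹ ≤ 2 * (T : ℝ)⁻¹ := by
      gcongr
      rw [Real.sqrt_le_left (by norm_num)]
      norm_num
    exact hs'.avgSqGrad_le hN hT hL hμ hκμ hκ1 hb₁ hb₂ hd hW hρ hρ1 hD rfl hi
      (fun t _ => DSOBA.detRun_succ W _ _ _ s₀ t)
      fun t ht => hs.ruleError_firstOrder hLddg.le (hδ t ht).1 fun i => ((hδ t ht).2 i).trans h3
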